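/- **Setting.** Let $q\in\mathbb C$, $0<|q|<1$, let $a_1,a_2,a_3,a_4,t\in\mathbb C^*$ and $\sigma\in\mathbb C$ with $|q^{\sigma+1}|<1$. Put $$w(x)=x^{\sigma}\,\frac{(x/(a_1t),\,x/a_3;q)_\infty}{(x/(a_2t),\,x/a_4;q)_\infty},\qquad L(g)=\int_{e_1}^{e_2}w(x)g(x)\,d_qx ,$$ a Jackson $q$-integral with $e_1,e_2\in\{0,qa_1t,qa_3\}$, where $w$ has no pole on the support and $x^\sigma$ is a determination of the power with $(qx)^\sigma=q^\sigma x^\sigma$. Let $(p_n)_{n\ge0}$, $\deg p_n=n$, be polynomials with $L(p_ip_j)=\delta_{ij}$; let $\gamma_n$ be the leading coefficient of $p_n$, $\mathsf a_n=\gamma_{n-1}/\gamma_n$, and $\mathsf b_n=L(xp_n^2)$. Let $D_q g(x)=\frac{g(x)-g(qx)}{x(1-q)}$, $W=a_2a_4(x-a_1t)(x-a_3)x(1-q)$, $2V=a_2a_4(x-a_1t)(x-a_3)-q^\sigma a_1a_3(x-a_2t)(x-a_4)$, so $WD_qw=2Vw$. Let $f=\sum_k L(x^k)x^{-k-1}$,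 let $U$ be the polynomial $WD_qf-2Vf$, and let $\phi_{n-1}$ be the polynomial part of $fp_n$. Put $$\Theta_n=W(p_nD_q\phi_{n-1}-\phi_{n-1}D_qp_n)-2V\phi_{n-1}p_n(qx)-U\,p_n\,p_n(qx),$$ $$\Omega_n=\mathsf a_nW(p_{n-1}D_q\phi_{n-1}-\phi_{n-2}D_qp_n)-V(2\mathsf a_n\phi_{n-2}p_n(qx)+1)-U\,\mathsf a_np_{n-1}p_n(qx)$$ (for $n=0$: $\mathsf a_0p_{-1}=0$, $\mathsf a_0\phi_{-2}=-1/p_0$). Up to conjugation by a diagonal matrix constant in $x$, the polynomial coefficient matrix of the linear $q$-difference equation in $x$ satisfied by $p_n,p_{n-1}$ is, for $n\ge 1$, $$A_n^*(x)=q^\sigma a_1a_3(x-a_2t)(x-a_4)I-\begin{pmatrix}\Omega_n-V&-\Theta_n\\ \mathsf a_n^2\Theta_{n-1}&\Omega_{n-1}-V-(x-\mathsf b_{n-1})\Theta_{n-1}\end{pmatrix},$$ while for $n=0$ it has the same first row and second row $(0,\ a_2a_4(x-a_1t)(x-a_3))$. The natural coordinates are $y_n$, the zero of the upper right entry (a polynomial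 of degree at most one in $x$), and $z_n$, defined by $(A_n^*(y_n))_{11}=\dfrac{(y_n-a_1t)(y_n-a_2t)}{q z_n}$; they are said to be defined when the linear coefficient of that upper right entry and $(A_n^*(y_n))_{11}$ are non-zero. Put $\kappa_1=q^{n+\sigma}a_1a_3$ and $\kappa_2=a_2a_4q^{-n}$. In general, q-$\mathrm P_{\mathrm{VI}}$ parameters are non-zero $q,a_1,\dots,a_4,\kappa_1,\kappa_2,\theta_1,\theta_2$ with $$a_5=\frac{a_1a_2}{\theta_1},\quad a_6=\frac{a_1a_2}{\theta_2},\quad a_7=\frac1{q\kappa_1},\quad a_8=\frac1{\kappa_2},\qquad \frac{a_5a_6}{a_7a_8}=\frac{q\,a_1a_2}{a_3a_4},$$ and q-$\mathrm P_{\mathrm{VI}}$ is, with $\hat y=y(qt)$, $\hat z=z(qt)$, $$\hat z z=\frac{a_7a_8(y-a_1t)(y-a_2t)}{(y-a_3)(y-a_4)},\qquad \hat y y=\frac{a_3a_4(\hat z-a_5t)(\hat z-a_6t)}{(\hat z-a_7)(\hat z-a_8)} .$$ **Theorem.** (1) There are $\theta_1,\theta_2$, independent of $n$, such that $A_n^*(0)$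 has eigenvalues $\theta_1t,\theta_2t$ for all $n\ge 0$, and for every $n$ the above is a set of q-$\mathrm P_{\mathrm{VI}}$ parameters. For every $n\ge0$ for which $(y_n,z_n)$ and $(y_{n+1},z_{n+1})$ are defined and the denominators below do not vanish, $$z_{n+1}=\frac{\kappa_2z_n[y_n(a_1t-y_n)+\zeta_n][y_n(a_2t-y_n)+\zeta_n]}{q^2\kappa_1[\kappa_2y_nz_n(a_3-y_n)+\zeta_n][\kappa_2y_nz_n(a_4-y_n)+\zeta_n]},$$ $$y_{n+1}=\frac{\kappa_2y_n(1-\kappa_2z_n)}{q^2\kappa_1(1-q^2\kappa_1z_{n+1})}\cdot\frac{\zeta_n-(y_n-a_1t)(y_n-a_2t)+\frac{z_n(q\theta_1t-\kappa_2a_1a_2t^2)}{1-\kappa_2z_n}}{\kappa_2y_nz_n(a_3-y_n)+\zeta_n}\cdot\frac{\zeta_n-(y_n-a_1t)(y_n-a_2t)+\frac{z_n(q\theta_2t-\kappa_2a_1a_2t^2)}{1-\kappa_2z_n}}{\kappa_2y_nz_n(a_4-y_n)+\zeta_n},$$ where $$(\kappa_2-q^2\kappa_1)\zeta_n=\kappa_2(y_n-a_1t)(y_n-a_2t)-q^2\kappa_1\kappa_2(y_n-a_3)(y_n-a_4)z_n+\frac{\kappa_2z_n}{1-\kappa_2z_n}\,\frac{(t\theta_1-q\kappa_1a_3a_4)(t\theta_2-q\kappa_1a_3a_4)}{\kappa_1a_3a_4}.$$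 (2) The shift $n\to n+1$ acts on the parameters by $\kappa_1\to q\kappa_1$, $\kappa_2\to\kappa_2/q$, that is by $a_7\to a_7/q$, $a_8\to q\,a_8$, with $q,a_1,\dots,a_6$ fixed; this preserves the relation $\frac{a_5a_6}{a_7a_8}=\frac{q\,a_1a_2}{a_3a_4}$. (3) It is a Bäcklund transformation: for arbitrary q-$\mathrm P_{\mathrm{VI}}$ parameters and a set $T\subset\mathbb C^*$ with $qT\subseteq T$, if $(y,z)$ solves q-$\mathrm P_{\mathrm{VI}}$ on $T$, with $y,z$ non-zero and non-vanishing denominators, then its image $(Y,Z)$ under the formulas of (1) (with $(y,z)$ for $(y_n,z_n)$ and $(Y,Z)$ for $(y_{n+1},z_{n+1})$) solves q-$\mathrm P_{\mathrm{VI}}$ with the shifted parameters on $T$, provided that the denominators in these formulas and in the shifted equations do not vanish. (4) It is a translation in the extended affine Weyl group of type $D_5^{(1)}$. Let the nodes of the Dynkin diagram be $0,\dots,5$ with edges $02,12,23,34,35$ and let $\delta=\alpha_0+\alpha_1+2\alpha_2+2\alpha_3+\alpha_4+\alpha_5$. On data $(b_1,\dots,b_8;y,z)$ let $s_0,s_1,s_4,s_5$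 exchange $b_1\leftrightarrow b_2$, $b_3\leftrightarrow b_4$, $b_5\leftrightarrow b_6$, $b_7\leftrightarrow b_8$ respectively; let $s_2$ exchange $b_1\leftrightarrow b_3$, multiply $b_5,b_6$ by $b_3/b_1$ and send $z\mapsto z\frac{y-b_3}{y-b_1}$; let $s_3$ exchange $b_5\leftrightarrow b_7$, multiply $b_1,b_2$ by $b_7/b_5$ and send $y\mapsto y\frac{z-b_7}{z-b_5}$ (old values on the right). These maps act on the multiplicative root variables $\frac{b_2}{b_1},\frac{b_3}{b_4},\frac{b_1}{b_3},\frac{b_7}{b_5},\frac{b_5}{b_6},\frac{b_8}{b_7}$ (of $\alpha_0,\dots,\alpha_5$) as the simple reflections of type $D_5^{(1)}$, and satisfy the Coxeter relations as birational maps. There is a word in the $s_i$ whose value in the extended affine Weyl group (acting on the root lattice) is the translation $\alpha\mapsto\alpha+\langle\alpha,\alpha_5^\vee\rangle\delta$, and whose birational action on generic data $b=(a_1t,a_2t,a_3,a_4,a_5t/q,a_6t/q,a_7,a_8)$, $(y,z)$ is the shift given by (1) and (2), up to a rescaling $y\to\lambda y$, $b_{1},\dots,b_4\to\lambda b_1,\dots,\lambda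 b_4$, $z\to\mu z$, $b_5,\dots,b_8\to\mu b_5,\dots,\mu b_8$ of the two coordinates. -/

import Mathlib

open Polynomial

noncomputable section

namespace QOrth

/-! ### The deformed little q-Jacobi orthogonal polynomials and their linear problem -/

/-- The infinite q-Pochhammer symbol `(a;q)_∞`. -/
def qPoch (q a : ℂ) : ℂ := ∏' k : ℕ, (1 - a * q ^ k)

/-- The Jackson integral `∫_0^e f(x) d_q x`. -/
def jackson (q e : ℂ) (f : ℂ → ℂ) : ℂ := e * (1 - q) * ∑' k : ℕ, q ^ k * f (e * q ^ k)

/-- The q-derivative `(g(x) - g(qx)) / (x(1-q))` of a polynomial. -/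
def qDeriv (q : ℂ) (g : ℂ[X]) : ℂ[X] :=
  C (1 - q)⁻¹ * divX (g - g.comp (C q * X))

/-- The polynomial part of the formal series `(∑ₖ μₖ x^{-k-1}) g(x)` at `x = ∞`. -/
def polyPart (μ : ℕ → ℂ) (g : ℂ[X]) : ℂ[X] :=
  g.sum fun i c => ∑ j ∈ Finset.range i, C (c * μ (i - 1 - j)) * X ^ j

/-- The data of the weight
`w(x) = x^σ (x/(a₁t), x/a₃; q)_∞ / (x/(a₂t), x/a₄; q)_∞` together with the end points
`e₁, e₂` of the Jackson integral and a determination `ℓ` of the logarithm, `x^σ = exp (σ ℓ(x))`. -/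
structure WeightData where
  q : ℂ
  σ : ℂ
  a₁ : ℂ
  a₂ : ℂ
  a₃ : ℂ
  a₄ : ℂ
  t : ℂ
  ℓ : ℂ → ℂ
  e₁ : ℂ
  e₂ : ℂ

namespace WeightData

variable (J : WeightData)

/-- The weight. -/
def w (x : ℂ) : ℂ :=
  Complex.exp (J.σ * J.ℓ x) * (qPoch J.q (x / (J.a₁ * J.t)) * qPoch J.q (x / J.a₃)) /
    (qPoch J.q (x / (J.a₂ * J.t)) * qPoch J.q (x / J.a₄))

/-- Standing assumptions on the weight and on the support of the Jackson integral. -/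
structure Admissible : Prop where
  q_pos : 0 < ‖J.q‖
  q_lt : ‖J.q‖ < 1
  ha₁ : J.a₁ ≠ 0
  ha₂ : J.a₂ ≠ 0
  ha₃ : J.a₃ ≠ 0
  ha₄ : J.a₄ ≠ 0
  ht : J.t ≠ 0
  /-- `ℓ` is a logarithm ... -/
  exp_log : ∀ x : ℂ, x ≠ 0 → Complex.exp (J.ℓ x) = x
  /-- ... for which `(q x)^σ = q^σ x^σ`. -/
  log_mul : ∀ x : ℂ, x ≠ 0 → J.ℓ (J.q * x) = J.ℓ x + Complex.log J.q
  /-- the Jackson integrals converge at `x = 0` -/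
  conv : ‖J.q ^ (J.σ + 1)‖ < 1
  he₁ : J.e₁ = 0 ∨ J.e₁ = J.q * J.a₁ * J.t ∨ J.e₁ = J.q * J.a₃
  he₂ : J.e₂ = 0 ∨ J.e₂ = J.q * J.a₁ * J.t ∨ J.e₂ = J.q * J.a₃
  /-- the weight has no pole on the support -/
  no_pole : ∀ k : ℕ, ∀ e : ℂ, (e = J.e₁ ∨ e = J.e₂) →
    qPoch J.q (e * J.q ^ k / (J.a₂ * J.t)) ≠ 0 ∧ qPoch J.q (e * J.q ^ k / J.a₄) ≠ 0

/-- The linear functional `L(g) = ∫_{e₁}^{e₂} w(x) g(x) d_q x`. -/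
def L (g : ℂ[X]) : ℂ :=
  jackson J.q J.e₂ (fun x => J.w x * g.eval x) - jackson J.q J.e₁ (fun x => J.w x * g.eval x)

/-- The moments; the Stieltjes function is the formal series `f = ∑ₖ μₖ x^{-k-1}`. -/
def μ (k : ℕ) : ℂ := J.L (X ^ k)

/-- `p` is an orthonormal polynomial system for `L`. -/
def IsOrthonormal (p : ℕ → ℂ[X]) : Prop :=
  (∀ n, (p n).natDegree = n) ∧ ∀ i j, J.L (p i * p j) = if i = j then 1 else 0

/-- Spectral data: `W D_q w = 2 V w`. -/
def W : ℂ[X] :=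
  C (J.a₂ * J.a₄ * (1 - J.q)) * (X - C (J.a₁ * J.t)) * (X - C J.a₃) * X

/-- The polynomial `(W - 2x(1-q)V) / (x(1-q)) = q^σ a₁ a₃ (x - a₂ t)(x - a₄)`. -/
def G : ℂ[X] :=
  C (J.q ^ J.σ * J.a₁ * J.a₃) * (X - C (J.a₂ * J.t)) * (X - C J.a₄)

/-- The polynomial `W / (x(1-q)) = a₂ a₄ (x - a₁ t)(x - a₃)`. -/
def H : ℂ[X] :=
  C (J.a₂ * J.a₄) * (X - C (J.a₁ * J.t)) * (X - C J.a₃)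

/-- Spectral data: `2V = a₂ a₄ (x - a₁ t)(x - a₃) - q^σ a₁ a₃ (x - a₂ t)(x - a₄)`. -/
def V : ℂ[X] := C (1 / 2) * (J.H - J.G)

/-- The coefficients of the series `D_q f = ∑ₖ νₖ x^{-k-1}`. -/
def ν : ℕ → ℂ
  | 0 => 0
  | k + 1 => J.μ k * (1 - (J.q ^ (k + 1))⁻¹) / (1 - J.q)

/-- Spectral data: the polynomial `U` with `W D_q f = 2 V f + U`. -/
def U : ℂ[X] := polyPart J.ν J.W - polyPart J.μ (2 * J.V)

variable (p : ℕ → ℂ[X])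

/-- `J.φ p n` is the polynomial part `φ_{n-1}` of `f pₙ`. -/
def φ (n : ℕ) : ℂ[X] := polyPart J.μ (p n)

/-- `recA p n` is the recurrence coefficient `a_{n+1} = γₙ / γ_{n+1}`. -/
def recA (n : ℕ) : ℂ := (p n).leadingCoeff / (p (n + 1)).leadingCoeff

/-- The recurrence coefficient `bₙ`. -/
def recB (n : ℕ) : ℂ := J.L (X * p n * p n)

/-- `aₙ p_{n-1}`, equal to `0` for `n = 0`. -/
def prevP : ℕ → ℂ[X]
  | 0 => 0
  | n + 1 => C (recA p n) * p n

/-- `aₙ φ_{n-2}`; its value at `n = 0` is the one for which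
`aₙ φ_{n-1} p_{n-1} - aₙ φ_{n-2} pₙ = 1`. -/
def prevφ : ℕ → ℂ[X]
  | 0 => -C ((p 0).leadingCoeff)⁻¹
  | n + 1 => C (recA p n) * J.φ p n

/-- The polynomial `Θₙ`. -/
def Θ (n : ℕ) : ℂ[X] :=
  J.W * (p n * qDeriv J.q (J.φ p n) - J.φ p n * qDeriv J.q (p n))
    - 2 * J.V * J.φ p n * (p n).comp (C J.q * X)
    - J.U * p n * (p n).comp (C J.q * X)

/-- The polynomial `Ωₙ`. -/
def Ω (n : ℕ) : ℂ[X] :=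
  J.W * (prevP p n * qDeriv J.q (J.φ p n) - J.prevφ p n * qDeriv J.q (p n))
    - J.V * (2 * J.prevφ p n * (p n).comp (C J.q * X) + 1)
    - J.U * prevP p n * (p n).comp (C J.q * X)

/-- The polynomial coefficient matrix of the linear q-difference equation in `x`, that is
`q^σ a₁ a₃ (x - a₂ t)(x - a₄) (I - x(1-q) Aₙ)` where `D_q Yₙ = Aₙ Yₙ`, written for the columns
with entries proportional to `pₙ` and `aₙ p_{n-1}`. A further conjugation by a diagonal matrix
constant in `x` changes neither the diagonal, nor the zero of the upper right entry, nor the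
eigenvalues. For `n = 0` the second row of `Y₀` is proportional to `(0, 1/w)`. -/
def A : ℕ → Matrix (Fin 2) (Fin 2) ℂ[X]
  | 0 => !![J.G - (J.Ω p 0 - J.V), J.Θ p 0; 0, J.H]
  | n + 1 => !![J.G - (J.Ω p (n + 1) - J.V), J.Θ p (n + 1);
      -(C (recA p n ^ 2) * J.Θ p n),
      J.G - (J.Ω p n - J.V - (X - C (J.recB p n)) * J.Θ p n)]

/-- The natural coordinate `yₙ`: the zero of the upper right entry (of degree one). -/
def y (n : ℕ) : ℂ := -(J.A p n 0 1).coeff 0 / (J.A p n 0 1).coeff 1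

/-- The natural coordinate `zₙ`: the upper left entry at `x = yₙ` is
`(yₙ - a₁ t)(yₙ - a₂ t) / (q zₙ)`. -/
def z (n : ℕ) : ℂ :=
  (J.y p n - J.a₁ * J.t) * (J.y p n - J.a₂ * J.t) / (J.q * (J.A p n 0 0).eval (J.y p n))

/-- The coordinates `yₙ`, `zₙ` are defined (finite). -/
def HasCoordinates (n : ℕ) : Prop :=
  (J.A p n 0 1).coeff 1 ≠ 0 ∧ (J.A p n 0 0).eval (J.y p n) ≠ 0

/-- `κ₁ = q^{n+σ} a₁ a₃`. -/
def κ₁ (n : ℕ) : ℂ := J.q ^ n * J.q ^ J.σ * J.a₁ * J.a₃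

/-- `κ₂ = a₂ a₄ q^{-n}`. -/
def κ₂ (n : ℕ) : ℂ := J.a₂ * J.a₄ / J.q ^ n

end WeightData

end QOrth

namespace QP6

/-! ### The q-difference sixth Painlevé equation and the shift -/

/-- Parameters of q-P_VI. -/
structure Param where
  q : ℂ
  a₁ : ℂ
  a₂ : ℂ
  a₃ : ℂ
  a₄ : ℂ
  κ₁ : ℂ
  κ₂ : ℂ
  θ₁ : ℂ
  θ₂ : ℂ

namespace Param

variable (D : Param)

def a₅ : ℂ := D.a₁ * D.a₂ / D.θ₁

def a₆ : ℂ := D.a₁ * D.a₂ / D.θ₂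

def a₇ : ℂ := 1 / (D.q * D.κ₁)

def a₈ : ℂ := 1 / D.κ₂

/-- All parameters are non-zero, and
`(a₅ a₆) / (a₇ a₈) = q (a₁ a₂) / (a₃ a₄)`. -/
structure Admissible : Prop where
  hq : D.q ≠ 0
  ha₁ : D.a₁ ≠ 0
  ha₂ : D.a₂ ≠ 0
  ha₃ : D.a₃ ≠ 0
  ha₄ : D.a₄ ≠ 0
  hκ₁ : D.κ₁ ≠ 0
  hκ₂ : D.κ₂ ≠ 0
  hθ₁ : D.θ₁ ≠ 0
  hθ₂ : D.θ₂ ≠ 0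
  rel : D.a₅ * D.a₆ / (D.a₇ * D.a₈) = D.q * (D.a₁ * D.a₂) / (D.a₃ * D.a₄)

/-- The four denominators of q-P_VI do not vanish (`z'` stands for `z(qt)`). -/
def Defined (y z' : ℂ) : Prop := y ≠ D.a₃ ∧ y ≠ D.a₄ ∧ z' ≠ D.a₇ ∧ z' ≠ D.a₈

/-- The q-P_VI equations between `(y, z)` at `t` and `(y', z')` at `q t`. -/
def Equations (t y z y' z' : ℂ) : Prop :=
  z' * z = D.a₇ * D.a₈ * (y - D.a₁ * t) * (y - D.a₂ * t) / ((y - D.a₃) * (y - D.a₄)) ∧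
  y' * y = D.a₃ * D.a₄ * (z' - D.a₅ * t) * (z' - D.a₆ * t) / ((z' - D.a₇) * (z' - D.a₈))

/-- `(y, z)` is a solution of q-P_VI on the set `T`. -/
def IsSolution (T : Set ℂ) (y z : ℂ → ℂ) : Prop :=
  ∀ t ∈ T, D.Equations t (y t) (z t) (y (D.q * t)) (z (D.q * t))

/-- The parameter shift `n → n + 1`: `κ₁ → q κ₁`, `κ₂ → κ₂ / q`. -/
def shift : Param := { D with κ₁ := D.q * D.κ₁, κ₂ := D.κ₂ / D.q }

/-- The auxiliary quantity `ζ`. -/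
def ζ (t y z : ℂ) : ℂ :=
  (D.κ₂ * (y - D.a₁ * t) * (y - D.a₂ * t)
    - D.q ^ 2 * D.κ₁ * D.κ₂ * (y - D.a₃) * (y - D.a₄) * z
    + D.κ₂ * z / (1 - D.κ₂ * z) *
      ((t * D.θ₁ - D.q * D.κ₁ * D.a₃ * D.a₄) * (t * D.θ₂ - D.q * D.κ₁ * D.a₃ * D.a₄) /
        (D.κ₁ * D.a₃ * D.a₄))) / (D.κ₂ - D.q ^ 2 * D.κ₁)

/-- The formula for `z_{n+1}`. -/
def zNext (t y z : ℂ) : ℂ :=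
  D.κ₂ * z * (y * (D.a₁ * t - y) + D.ζ t y z) * (y * (D.a₂ * t - y) + D.ζ t y z) /
    (D.q ^ 2 * D.κ₁ * (D.κ₂ * y * z * (D.a₃ - y) + D.ζ t y z)
      * (D.κ₂ * y * z * (D.a₄ - y) + D.ζ t y z))

/-- The formula for `y_{n+1}`. -/
def yNext (t y z : ℂ) : ℂ :=
  D.κ₂ * y * (1 - D.κ₂ * z) / (D.q ^ 2 * D.κ₁ * (1 - D.q ^ 2 * D.κ₁ * D.zNext t y z)) *
  ((D.ζ t y z - (y - D.a₁ * t) * (y - D.a₂ * t)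
      + z * (D.q * D.θ₁ * t - D.κ₂ * D.a₁ * D.a₂ * t ^ 2) / (1 - D.κ₂ * z)) /
    (D.κ₂ * y * z * (D.a₃ - y) + D.ζ t y z)) *
  ((D.ζ t y z - (y - D.a₁ * t) * (y - D.a₂ * t)
      + z * (D.q * D.θ₂ * t - D.κ₂ * D.a₁ * D.a₂ * t ^ 2) / (1 - D.κ₂ * z)) /
    (D.κ₂ * y * z * (D.a₄ - y) + D.ζ t y z))

/-- The denominators of the formulas for `ζ`, `z_{n+1}`, `y_{n+1}` do not vanish. -/
def ShiftDefined (t y z : ℂ) : Prop :=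
  D.κ₂ ≠ D.q ^ 2 * D.κ₁ ∧ D.κ₂ * z ≠ 1 ∧
  D.κ₂ * y * z * (D.a₃ - y) + D.ζ t y z ≠ 0 ∧
  D.κ₂ * y * z * (D.a₄ - y) + D.ζ t y z ≠ 0 ∧
  D.q ^ 2 * D.κ₁ * D.zNext t y z ≠ 1

end Param

/-! ### The extended affine Weyl group of type `D_5^{(1)}` and its birational action -/

/-- The Cartan matrix of type `D_5^{(1)}`: nodes `0, 1` are attached to `2`, nodes `4, 5` are
attached to `3`, and `2`, `3` are joined. -/
def cartan : Matrix (Fin 6) (Fin 6) ℤ :=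
  !![ 2,  0, -1,  0,  0,  0;
      0,  2, -1,  0,  0,  0;
     -1, -1,  2, -1,  0,  0;
      0,  0, -1,  2, -1, -1;
      0,  0,  0, -1,  2,  0;
      0,  0,  0, -1,  0,  2]

/-- The root lattice, with basis the simple roots. -/
abbrev RootLattice : Type := Fin 6 → ℤ

/-- The simple root `αᵢ`. -/
def simpleRoot (i : Fin 6) : RootLattice := Pi.single i 1

/-- The simple coroot `αᵢ^∨` as a linear form on the root lattice. -/
def simpleCoroot (i : Fin 6) : Module.Dual ℤ RootLattice :=
  Fintype.linearCombination ℤ (fun j => cartan j i)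

theorem simpleCoroot_simpleRoot (i : Fin 6) : simpleCoroot i (simpleRoot i) = 2 := by
  have h : cartan i i = 2 := by fin_cases i <;> rfl
  simp [simpleCoroot, simpleRoot, h]

/-- The simple reflection `sᵢ`. -/
def simpleReflection (i : Fin 6) : RootLattice ≃ₗ[ℤ] RootLattice :=
  Module.reflection (simpleCoroot_simpleRoot i)

/-- The automorphisms of the Dynkin diagram, acting on the root lattice. -/
def diagramAutomorphisms : Set (RootLattice ≃ₗ[ℤ] RootLattice) :=
  {g | ∃ π : Equiv.Perm (Fin 6), (∀ i j, cartan (π i) (π j) = cartan i j) ∧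
    ∀ i, g (simpleRoot i) = simpleRoot (π i)}

/-- The extended affine Weyl group of type `D_5^{(1)}`. -/
def extendedAffineWeylGroup : Subgroup (RootLattice ≃ₗ[ℤ] RootLattice) :=
  Subgroup.closure (Set.range simpleReflection ∪ diagramAutomorphisms)

/-- The null root `δ = α₀ + α₁ + 2α₂ + 2α₃ + α₄ + α₅`; the translations are the elements of the
extended affine Weyl group that move every root by a multiple of `δ`. -/
def nullRoot : RootLattice := ![1, 1, 2, 2, 1, 1]

/-- The Coxeter exponents of type `D_5^{(1)}`. -/
def coxeterExponent (i j : Fin 6) : ℕ :=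
  if i = j then 1 else if cartan i j = 0 then 2 else 3

/-- A point `(y, z)` together with eight parameters, the positions of the base points
`(b₀, 0), (b₁, 0), (b₂, ∞), (b₃, ∞), (0, b₄), (0, b₅), (∞, b₆), (∞, b₇)` of q-P_VI. -/
@[ext]
structure Config where
  b : Fin 8 → ℂ
  y : ℂ
  z : ℂ

/-- The standard birational action of the simple reflections: `s₀, s₁, s₄, s₅` exchange
`b₀ ↔ b₁`, `b₂ ↔ b₃`, `b₄ ↔ b₅`, `b₆ ↔ b₇`; `s₂` and `s₃` are the elementary
transformations at the pairs of base points `b₀, b₂` and `b₄, b₆`. -/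
def act (i : Fin 6) (c : Config) : Config :=
  match i with
  | 0 => ⟨c.b ∘ Equiv.swap 0 1, c.y, c.z⟩
  | 1 => ⟨c.b ∘ Equiv.swap 2 3, c.y, c.z⟩
  | 2 => ⟨![c.b 2, c.b 1, c.b 0, c.b 3, c.b 4 * (c.b 2 / c.b 0), c.b 5 * (c.b 2 / c.b 0),
        c.b 6, c.b 7], c.y, c.z * ((c.y - c.b 2) / (c.y - c.b 0))⟩
  | 3 => ⟨![c.b 0 * (c.b 6 / c.b 4), c.b 1 * (c.b 6 / c.b 4), c.b 2, c.b 3, c.b 6, c.b 5,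
        c.b 4, c.b 7], c.y * ((c.z - c.b 6) / (c.z - c.b 4)), c.z⟩
  | 4 => ⟨c.b ∘ Equiv.swap 4 5, c.y, c.z⟩
  | 5 => ⟨c.b ∘ Equiv.swap 6 7, c.y, c.z⟩

/-- The multiplicative root variable of the simple root `αᵢ`; their product with the multiplicities
of the null root is `q`. -/
def rootVariable (i : Fin 6) (c : Config) : ℂ :=
  ![c.b 1 / c.b 0, c.b 2 / c.b 3, c.b 0 / c.b 2, c.b 6 / c.b 4, c.b 4 / c.b 5, c.b 7 / c.b 6] i

/-- The birational map of the word `[i₁, …, iₖ]`: its first letter is applied first, so that on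
functions (by pull-back) it acts as `s_{i₁} ⋯ s_{iₖ}`. -/
def actWord (word : List (Fin 6)) (c : Config) : Config :=
  word.foldl (fun c i => act i c) c

/-- Rescaling of the coordinates `y → λ y`, `z → μ z` and of the base points. -/
def rescale (l m : ℂ) (c : Config) : Config :=
  ⟨![l * c.b 0, l * c.b 1, l * c.b 2, l * c.b 3, m * c.b 4, m * c.b 5, m * c.b 6, m * c.b 7],
    l * c.y, m * c.z⟩

/-- `Q` holds on a non-empty Zariski open set of configurations. -/
def Generically (Q : Config → Prop) : Prop :=
  ∃ P : MvPolynomial (Fin 8 ⊕ Fin 2) ℂ, P ≠ 0 ∧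
    ∀ c : Config, MvPolynomial.eval (Sum.elim c.b ![c.y, c.z]) P ≠ 0 → Q c

/-- The configuration of a point `(y, z)` at time `t` of q-P_VI; the base points on the line
`y = 0` lie at `z = a₅ t / q`, `a₆ t / q`. -/
def Param.config (D : Param) (t y z : ℂ) : Config :=
  ⟨![D.a₁ * t, D.a₂ * t, D.a₃, D.a₄, D.a₅ * t / D.q, D.a₆ * t / D.q, D.a₇, D.a₈], y, z⟩

end QP6

namespace QOrth.WeightData

/-- The parameters of q-P_VI attached to the `n`-th orthogonal polynomial. -/
def param (J : WeightData) (θ₁ θ₂ : ℂ) (n : ℕ) : QP6.Param :=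
  ⟨J.q, J.a₁, J.a₂, J.a₃, J.a₄, J.κ₁ n, J.κ₂ n, θ₁, θ₂⟩

end QOrth.WeightData

end

/-! Orthogonal polynomials. The weight satisfies `w(qx) H(x) = G(x) w(x)`, and `H` kills the
boundary term of the Jackson sum at each non-zero end point. Hence the functional satisfies
`Pearson`, which says that `G f - H f(qx)` has no negative powers of `x`, so that it equals `U`. As
`W = (1-q) x H`, the operator `W D_q` only compares values at `x` and `qx`, and for `n ≥ 1` the
matrix `A n` is the product of a matrix of values at `qx` (weighted by `G`, `H`, `U`) and a matrix
of values at `x`. The Casorati identity gives `det = G H`, and, at `x = 0` where both arguments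
coincide, trace `G(0) + H(0)`; so the eigenvalues at `0` do not depend on `n`. Substituting `φ = f p
- O(x^{-n-1})` gives `deg Θ ≤ 1` (`natDegree_Θ_le`).

The matrix `A (n+1)` alone contains both points. Its first row defines the new point; its second row
knows the old one, because the lower left entry is a multiple of `Θ n` and the lower right entry
agrees with the upper left entry of `A n` at `y n`. `shift_of_det` solves for the new point: the
determinant relation is divided by `x - y` after introducing two auxiliary zeros `η`, `ξ`. Its
coefficients and its values at `η`, `ξ` and the new `y` give `ζ` and the new `z`; the determinant
and the trace at `0` give the new `y`.

Weyl group and Bäcklund property. With the eight base points as free parameters, the time step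
becomes a birational map `tau` that multiplies the root variable of `α₂` by `q`, divides that of
`α₃` by `q` and fixes the other four. It therefore ought to commute with `s₀, s₁, s₄, s₅` and with
the reflection `sigma` in `α₂ + α₃`; this is checked on formulas in `tau_act_swap` and `tau_sigma`.
By Coxeter relations the word of the shift is a product of exactly such reflections
(`wordEquiv_shift`), so it commutes with `tau` generically. Composing the word explicitly
(`actWord_shiftWord`) gives the shift formulas up to a rescaling by `gOf`, which `tau` respects.
Generic identities are handled by dominance of the maps involved. A generic identity extends by
density and continuity to every point where the denominators do not vanish, which gives the
statement about solutions. -/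

noncomputable section

namespace QOrth

/-! ### Polynomial parts of products with the Stieltjes series. -/

section PolyPart

variable (μ : ℕ → ℂ)

theorem polyPart_zero : polyPart μ 0 = 0 := by simp [polyPart]

theorem polyPart_add (f g : ℂ[X]) : polyPart μ (f + g) = polyPart μ f + polyPart μ g := by
  unfold polyPart
  refine Polynomial.sum_add_index f g _ (fun i => by simp) (fun i b c => ?_)
  rw [← Finset.sum_add_distrib]
  refine Finset.sum_congr rfl fun j _ => ?_
  simp only [add_mul, C_add]

theorem polyPart_C_mul (a : ℂ) (f : ℂ[X]) : polyPart μ (C a * f) = C a * polyPart μ f := by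
  induction f using Polynomial.induction_on' with
  | add f g hf hg => rw [mul_add, polyPart_add, polyPart_add, mul_add, hf, hg]
  | monomial n b =>
    unfold polyPart
    rw [C_mul_monomial, sum_monomial_index _ _ (by simp), sum_monomial_index _ _ (by simp),
      Finset.mul_sum]
    refine Finset.sum_congr rfl fun j _ => ?_
    simp only [C_mul]; ring

/-- `polyPart` as a linear map. -/
def polyPartHom : ℂ[X] →ₗ[ℂ] ℂ[X] where
  toFun := polyPart μ
  map_add' := polyPart_add μ
  map_smul' a f := by simp [smul_eq_C_mul, polyPart_C_mul]

theorem polyPart_sub (f g : ℂ[X]) : polyPart μ (f - g) = polyPart μ f - polyPart μ g :=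
  map_sub (polyPartHom μ) f g

theorem polyPart_X_pow (n : ℕ) :
    polyPart μ (X ^ n) = ∑ j ∈ Finset.range n, C (μ (n - 1 - j)) * X ^ j := by
  unfold polyPart
  rw [X_pow_eq_monomial, sum_monomial_index _ _ (by simp)]
  simp [X_pow_eq_monomial]

/-- Multiplication by `x` moves exactly one coefficient of `f g` from the negative powers into the
polynomial part, the coefficient of `x⁻¹`, which is `Λ g`. -/
theorem polyPart_X_mul (Λ : ℂ[X] →ₗ[ℂ] ℂ) (hΛ : ∀ k, Λ (X ^ k) = μ k) (g : ℂ[X]) :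
    polyPart μ (X * g) = X * polyPart μ g + C (Λ g) := by
  induction g using Polynomial.induction_on' with
  | add f g hf hg => rw [mul_add, polyPart_add, polyPart_add, mul_add, hf, hg, map_add, C_add]; ring
  | monomial n b =>
    rw [← C_mul_X_pow_eq_monomial, mul_left_comm, polyPart_C_mul, polyPart_C_mul, ← pow_succ',
      polyPart_X_pow, polyPart_X_pow, Finset.sum_range_succ', ← smul_eq_C_mul (p := X ^ n),
      map_smul, hΛ, Finset.mul_sum, Finset.mul_sum, smul_eq_mul, mul_add, Finset.mul_sum]
    congr 1
    · refine Finset.sum_congr rfl fun j _ => ?_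
      rw [show n + 1 - 1 - (j + 1) = n - 1 - j by omega]; ring
    · simp

/-- The truncated product `x^N f g` minus its part divisible by `x^N`. -/
def truncRem (N : ℕ) (g : ℂ[X]) : ℂ[X] :=
  polyPart μ (X ^ N) * g - X ^ N * polyPart μ g

theorem coeff_polyPart_X_pow (n j : ℕ) :
    (polyPart μ (X ^ n)).coeff j = if j < n then μ (n - 1 - j) else 0 := by
  rw [polyPart_X_pow, finsetSum_coeff]
  simp only [coeff_C_mul_X_pow]
  rw [Finset.sum_ite_eq]
  simp

/-- `truncRem` is a polynomial stand-in for `x^N (f g - polyPart g)`. From the degree of `g` upwards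
the truncation of `f` is invisible, so its coefficients are those of the negative powers of `f g`,
that is, values of `Λ` on `g` times powers of `x`. Orthogonality and the Pearson relation thus
become degree bounds. -/
theorem coeff_truncRem (Λ : ℂ[X] →ₗ[ℂ] ℂ) (hΛ : ∀ k, Λ (X ^ k) = μ k) (N m : ℕ) (g : ℂ[X])
    (hg : g.natDegree ≤ m) :
    (truncRem μ N g).coeff m = if m < N then Λ (g * X ^ (N - 1 - m)) else 0 := by
  refine induction_with_natDegree_le (fun g : ℂ[X] => (truncRem μ N g).coeff m =
    if m < N then Λ (g * X ^ (N - 1 - m)) else 0) m ?_ ?_ ?_ g hg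
  · simp [truncRem, polyPart_zero]
  · intro n r hr hn
    simp only [truncRem]
    rw [polyPart_C_mul, coeff_sub, mul_left_comm, mul_left_comm (X ^ N), coeff_C_mul, coeff_C_mul,
      coeff_mul_X_pow', coeff_X_pow_mul', if_pos hn, coeff_polyPart_X_pow, coeff_polyPart_X_pow,
      mul_assoc, ← smul_eq_C_mul, map_smul, ← pow_add, hΛ]
    by_cases h : m < N
    · rw [if_pos h, if_pos (show m - n < N by omega), if_neg (show ¬ N ≤ m by omega),
        show N - 1 - (m - n) = n + (N - 1 - m) by omega]
      simp
    · rw [if_neg h, if_pos (show N ≤ m by omega)]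
      by_cases h' : m - n < N
      · rw [if_pos h', if_pos (show m - N < n by omega),
          show N - 1 - (m - n) = n - 1 - (m - N) by omega]
        ring
      · rw [if_neg h', if_neg (show ¬ m - N < n by omega)]
        ring
  · intro f g _ _ hf hg
    have : truncRem μ N (f + g) = truncRem μ N f + truncRem μ N g := by
      simp only [truncRem, polyPart_add]; ring
    rw [this, coeff_add, hf, hg]
    split_ifs
    · rw [add_mul, map_add]
    · ring

end PolyPart

end QOrth
end

/-! ### Orthonormal systems: recurrence relations and the Casorati determinant. -/

noncomputable section

namespace QOrth

namespace WeightData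

variable {J : WeightData} {p : ℕ → ℂ[X]}

theorem IsOrthonormal.leadingCoeff_ne_zero (hp : J.IsOrthonormal p) {Λ : ℂ[X] →ₗ[ℂ] ℂ}
    (hΛ : ∀ g, J.L g = Λ g) (n : ℕ) : (p n).leadingCoeff ≠ 0 := by
  intro h
  have h1 := hp.2 n n
  rw [leadingCoeff_eq_zero.1 h, hΛ, mul_zero, map_zero, if_pos rfl] at h1
  exact zero_ne_one h1

theorem IsOrthonormal.apply_mul (hp : J.IsOrthonormal p) {Λ : ℂ[X] →ₗ[ℂ] ℂ}
    (hΛ : ∀ g, J.L g = Λ g) (i j : ℕ) : Λ (p i * p j) = if i = j then 1 else 0 := by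
  rw [← hΛ, hp.2]

/-- Subtracting a multiple of `p d` lowers the degree. -/
theorem IsOrthonormal.degree_sub_lt (hp : J.IsOrthonormal p) {Λ : ℂ[X] →ₗ[ℂ] ℂ}
    (hΛ : ∀ g, J.L g = Λ g) {d : ℕ} {g : ℂ[X]} (hg : g.degree < (d + 1 : ℕ)) :
    (g - C (g.coeff d / (p d).leadingCoeff) * p d).degree < d := by
  rw [degree_lt_iff_coeff_zero]
  intro m hm
  rw [coeff_sub, coeff_C_mul]
  rcases hm.eq_or_lt with rfl | hm
  · have h : (p d).coeff d = (p d).leadingCoeff := by rw [leadingCoeff, hp.1]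
    rw [h, div_mul_cancel₀ _ (hp.leadingCoeff_ne_zero hΛ d), sub_self]
  · rw [(degree_lt_iff_coeff_zero _ _).1 hg m hm,
      coeff_eq_zero_of_natDegree_lt (p := p d) (by rw [hp.1]; exact hm)]
    simp

/-- The leading term of `g` is removed by a multiple of `p d`, which is itself orthogonal to `p n`
as long as `d < n`. The induction therefore runs over `d` with `n` fixed. -/
theorem IsOrthonormal.apply_mul_eq_zero (hp : J.IsOrthonormal p) {Λ : ℂ[X] →ₗ[ℂ] ℂ}
    (hΛ : ∀ g, J.L g = Λ g) {n : ℕ} {g : ℂ[X]} (hg : g.degree < n) : Λ (p n * g) = 0 := by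
  have key : ∀ d ≤ n, ∀ g : ℂ[X], g.degree < d → Λ (p n * g) = 0 := by
    intro d
    induction d with
    | zero =>
      intro _ g hg
      have : g = 0 := by
        ext m
        exact (degree_lt_iff_coeff_zero _ _).1 hg m (Nat.zero_le m)
      simp [this]
    | succ d ih =>
      intro hd g hg
      have h1 := ih (by omega) _ (hp.degree_sub_lt hΛ hg)
      rw [mul_sub, map_sub, mul_left_comm, ← smul_eq_C_mul, map_smul, hp.apply_mul hΛ,
        if_neg (by omega), smul_zero, sub_zero] at h1
      exact h1
  exact key n le_rfl g hg

/-- Pairing with the highest `p d` isolates the leading coefficient and shows that it vanishes, so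
the degree drops. This non-degeneracy lets polynomial identities be tested against the `p k`. -/
theorem IsOrthonormal.eq_zero_of_apply (hp : J.IsOrthonormal p) {Λ : ℂ[X] →ₗ[ℂ] ℂ}
    (hΛ : ∀ g, J.L g = Λ g) (d : ℕ) (g : ℂ[X]) (hg : g.degree < d)
    (h : ∀ k < d, Λ (g * p k) = 0) : g = 0 := by
  induction d generalizing g with
  | zero =>
    ext m
    exact (degree_lt_iff_coeff_zero _ _).1 hg m (Nat.zero_le m)
  | succ d ih =>
    have h1 := hp.degree_sub_lt hΛ hg
    have h2 := hp.apply_mul_eq_zero hΛ h1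
    rw [mul_comm, sub_mul, map_sub, h d (by omega), mul_assoc, ← smul_eq_C_mul, map_smul,
      hp.apply_mul hΛ, if_pos rfl, smul_eq_mul, mul_one, zero_sub, neg_eq_zero] at h2
    rw [h2, C_0, zero_mul, sub_zero] at h1
    exact ih g h1 fun k hk => h k (by omega)

theorem recA_ne_zero (hp : J.IsOrthonormal p) {Λ : ℂ[X] →ₗ[ℂ] ℂ}
    (hΛ : ∀ g, J.L g = Λ g) (n : ℕ) : recA p n ≠ 0 :=
  div_ne_zero (hp.leadingCoeff_ne_zero hΛ _) (hp.leadingCoeff_ne_zero hΛ _)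

theorem IsOrthonormal.coeff_self (hp : J.IsOrthonormal p) (n : ℕ) :
    (p n).coeff n = (p n).leadingCoeff := by rw [leadingCoeff, hp.1]

/-- The three-term recurrence relation. -/
theorem IsOrthonormal.recurrence (hp : J.IsOrthonormal p) {Λ : ℂ[X] →ₗ[ℂ] ℂ}
    (hΛ : ∀ g, J.L g = Λ g) (n : ℕ) :
    C (recA p n) * p (n + 1) = (X - C (J.recB p n)) * p n - prevP p n := by
  -- `recA p k` is the ratio of leading coefficients that makes `x p_k - recA p k • p_{k+1}` drop to
  -- degree at most `k`.
  have hX : ∀ k, Λ (p (k + 1) * (X * p k)) = recA p k := by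
    intro k
    have hd : (X * p k - C (recA p k) * p (k + 1)).degree < ((k + 1 : ℕ) : WithBot ℕ) := by
      rw [degree_lt_iff_coeff_zero]
      intro m hm
      obtain ⟨m, rfl⟩ : ∃ m', m = m' + 1 := ⟨m - 1, by omega⟩
      rw [coeff_sub, coeff_X_mul, coeff_C_mul]
      rcases (by omega : k ≤ m).eq_or_lt with rfl | h
      · rw [hp.coeff_self, hp.coeff_self, recA,
          div_mul_cancel₀ _ (hp.leadingCoeff_ne_zero hΛ _), sub_self]
      · rw [coeff_eq_zero_of_natDegree_lt (p := p k) (by rw [hp.1]; exact h),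
          coeff_eq_zero_of_natDegree_lt (by rw [hp.1]; omega)]
        simp
    have h := hp.apply_mul_eq_zero hΛ hd
    rw [mul_sub, map_sub, mul_left_comm (p (k + 1)) (C _), ← smul_eq_C_mul, map_smul,
      hp.apply_mul hΛ, if_pos rfl, smul_eq_mul, mul_one, sub_eq_zero] at h
    exact h
  rw [← sub_eq_zero]
  refine hp.eq_zero_of_apply hΛ (n + 1) _ ?_ ?_
  · rw [degree_lt_iff_coeff_zero]
    intro m hm
    obtain ⟨m, rfl⟩ : ∃ m', m = m' + 1 := ⟨m - 1, by omega⟩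
    have hprev : (prevP p n).coeff (m + 1) = 0 := by
      cases n with
      | zero => simp [prevP]
      | succ n =>
        rw [prevP, coeff_C_mul, coeff_eq_zero_of_natDegree_lt (by rw [hp.1]; omega), mul_zero]
    rw [coeff_sub, coeff_sub, sub_mul, coeff_sub, hprev, coeff_X_mul, coeff_C_mul, coeff_C_mul,
      coeff_eq_zero_of_natDegree_lt (p := p n) (n := m + 1) (by rw [hp.1]; omega)]
    rcases (by omega : n ≤ m).eq_or_lt with rfl | h
    · rw [hp.coeff_self, hp.coeff_self, recA,
        div_mul_cancel₀ _ (hp.leadingCoeff_ne_zero hΛ _)]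
      simp
    · rw [coeff_eq_zero_of_natDegree_lt (by rw [hp.1]; omega),
        coeff_eq_zero_of_natDegree_lt (by rw [hp.1]; omega)]
      simp
  -- Testing against `p k`: for `k = n` the definition of `recB` is needed, for `k = n - 1` the
  -- value `hX`, and for smaller `k` the polynomial `x p_k` still has degree below `n`.
  · intro k hk
    have e : (C (recA p n) * p (n + 1) - ((X - C (J.recB p n)) * p n - prevP p n)) * p k =
        recA p n • (p (n + 1) * p k) - p n * (X * p k) + J.recB p n • (p n * p k)
          + prevP p n * p k := by
      simp only [smul_eq_C_mul]; ring
    rw [e, map_add, map_add, map_sub, map_smul, map_smul, hp.apply_mul hΛ, hp.apply_mul hΛ,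
      if_neg (by omega)]
    rcases (by omega : k ≤ n).eq_or_lt with rfl | h
    · have h1 : Λ (prevP p k * p k) = 0 := by
        cases k with
        | zero => simp [prevP]
        | succ k =>
          rw [prevP, mul_assoc, ← smul_eq_C_mul, map_smul, hp.apply_mul hΛ, if_neg (by omega),
            smul_zero]
      rw [h1, recB, hΛ, if_pos rfl, show p k * (X * p k) = X * p k * p k by ring]
      simp
    · obtain ⟨n, rfl⟩ : ∃ n', n = n' + 1 := ⟨n - 1, by omega⟩
      rw [prevP, mul_assoc, ← smul_eq_C_mul, map_smul, hp.apply_mul hΛ, if_neg (by omega)]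
      rcases (by omega : k ≤ n).eq_or_lt with rfl | h'
      · rw [hX, if_pos rfl]
        simp
      · rw [if_neg (by omega), hp.apply_mul_eq_zero hΛ]
        · simp
        · rw [degree_lt_iff_coeff_zero]
          intro m hm
          obtain ⟨m, rfl⟩ : ∃ m', m = m' + 1 := ⟨m - 1, by omega⟩
          rw [coeff_X_mul, coeff_eq_zero_of_natDegree_lt (by rw [hp.1]; omega)]

theorem μ_eq {Λ : ℂ[X] →ₗ[ℂ] ℂ} (hΛ : ∀ g, J.L g = Λ g) (k : ℕ) : Λ (X ^ k) = J.μ k := by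
  rw [μ, hΛ]

theorem IsOrthonormal.apply_zero (hp : J.IsOrthonormal p) {Λ : ℂ[X] →ₗ[ℂ] ℂ}
    (hΛ : ∀ g, J.L g = Λ g) : Λ (p 0) = ((p 0).leadingCoeff)⁻¹ := by
  have h0 : p 0 = C (p 0).leadingCoeff := by
    rw [leadingCoeff, hp.1]
    exact eq_C_of_natDegree_eq_zero (hp.1 0)
  have h1 := hp.apply_mul hΛ 0 0
  rw [if_pos rfl] at h1
  nth_rewrite 1 [h0] at h1
  rw [← smul_eq_C_mul, map_smul, smul_eq_mul] at h1
  exact eq_inv_of_mul_eq_one_right h1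

/-- The recurrence relation for the associated polynomials. -/
theorem IsOrthonormal.recurrence_φ (hp : J.IsOrthonormal p) {Λ : ℂ[X] →ₗ[ℂ] ℂ}
    (hΛ : ∀ g, J.L g = Λ g) (n : ℕ) :
    C (recA p n) * J.φ p (n + 1) = (X - C (J.recB p n)) * J.φ p n - J.prevφ p n := by
  have h := congrArg (polyPart J.μ) (hp.recurrence hΛ n)
  rw [polyPart_C_mul, polyPart_sub, sub_mul, polyPart_sub, polyPart_C_mul,
    polyPart_X_mul J.μ Λ (μ_eq hΛ)] at h
  unfold φ
  rw [h]
  -- The extra constant is `Λ (p n)`: it vanishes for `n > 0` and is the inverse leading coefficient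
  -- for `n = 0`. The convention for `prevφ` at `0` absorbs the latter.
  cases n with
  | zero =>
    rw [hp.apply_zero hΛ]
    simp only [prevP, prevφ, polyPart_zero]
    ring
  | succ n =>
    have h1 := hp.apply_mul_eq_zero hΛ (n := n + 1) (g := 1)
      (by rw [degree_one]; exact_mod_cast Nat.succ_pos n)
    rw [mul_one] at h1
    rw [h1, prevP, prevφ, φ, polyPart_C_mul, C_0]
    ring

/-- The Casorati determinant. -/
theorem IsOrthonormal.casorati (hp : J.IsOrthonormal p) {Λ : ℂ[X] →ₗ[ℂ] ℂ}
    (hΛ : ∀ g, J.L g = Λ g) (n : ℕ) :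
    prevP p n * J.φ p n - J.prevφ p n * p n = 1 := by
  induction n with
  | zero =>
    rw [prevP, prevφ, zero_mul, zero_sub]
    nth_rewrite 2 [eq_C_of_natDegree_eq_zero (hp.1 0)]
    rw [hp.coeff_self, neg_mul, neg_neg, ← C_mul, inv_mul_cancel₀ (hp.leadingCoeff_ne_zero hΛ 0),
      C_1]
  | succ n ih =>
    rw [prevP, prevφ]
    linear_combination ih + p n * hp.recurrence_φ hΛ n - J.φ p n * hp.recurrence hΛ n

end WeightData
end QOrth
end

/-! ### The coefficient matrix: determinant, trace at the origin, degrees. -/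

noncomputable section

namespace QOrth

theorem X_mul_divX_of_coeff_zero {g : ℂ[X]} (h : g.coeff 0 = 0) : X * divX g = g := by
  conv_rhs => rw [← X_mul_divX_add g, h, C_0, add_zero]

theorem X_mul_qDeriv {q : ℂ} (hq : q ≠ 1) (g : ℂ[X]) :
    C (1 - q) * (X * qDeriv q g) = g - g.comp (C q * X) := by
  have h : (g - g.comp (C q * X)).coeff 0 = 0 := by
    rw [coeff_zero_eq_eval_zero, eval_sub, eval_comp]
    simp
  have h1 : (C (1 - q) : ℂ[X]) * C (1 - q)⁻¹ = 1 := by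
    rw [← C_mul, mul_inv_cancel₀ (sub_ne_zero.2 hq.symm), C_1]
  rw [qDeriv, mul_left_comm X, ← mul_assoc, h1, one_mul, X_mul_divX_of_coeff_zero h]

namespace WeightData

variable {J : WeightData} {p : ℕ → ℂ[X]}

theorem W_eq (J : WeightData) : J.W = C (1 - J.q) * X * J.H := by
  simp only [W, H, C_mul]; ring

/-- The factor `x (1-q)` of `W` cancels the denominator of `D_q`. All later identities become
polynomial identities between values at `x` and at `qx`. -/
theorem W_mul_qDeriv (hq : J.q ≠ 1) (g : ℂ[X]) :
    J.W * qDeriv J.q g = J.H * (g - g.comp (C J.q * X)) := by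
  rw [W_eq, ← X_mul_qDeriv hq]; ring

theorem two_V (J : WeightData) : 2 * J.V = J.H - J.G := by
  have h : (2 : ℂ[X]) * C (1 / 2) = 1 := by
    rw [← C_ofNat, ← C_mul]; norm_num
  rw [V, ← mul_assoc, h, one_mul]

theorem Θ_eq (hq : J.q ≠ 1) (n : ℕ) :
    J.Θ p n = J.G * J.φ p n * (p n).comp (C J.q * X) - J.H * p n * (J.φ p n).comp (C J.q * X)
      - J.U * p n * (p n).comp (C J.q * X) := by
  rw [Θ]
  linear_combination p n * W_mul_qDeriv hq (J.φ p n) - J.φ p n * W_mul_qDeriv hq (p n)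
    - J.φ p n * (p n).comp (C J.q * X) * two_V J

/-- The terms without a factor at `qx` add up to `H` minus `H` times the Casorati determinant, and
hence cancel. -/
theorem G_sub_Ω_eq (hp : J.IsOrthonormal p) {Λ : ℂ[X] →ₗ[ℂ] ℂ} (hΛ : ∀ g, J.L g = Λ g)
    (hq : J.q ≠ 1) (n : ℕ) :
    J.G - (J.Ω p n - J.V) = -(J.G * J.prevφ p n * (p n).comp (C J.q * X))
      + J.H * prevP p n * (J.φ p n).comp (C J.q * X)
      + J.U * prevP p n * (p n).comp (C J.q * X) := by
  rw [Ω]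
  linear_combination (-prevP p n) * W_mul_qDeriv hq (J.φ p n)
    + J.prevφ p n * W_mul_qDeriv hq (p n)
    + (J.prevφ p n * (p n).comp (C J.q * X) + 1) * two_V J
    - J.H * hp.casorati hΛ n

theorem A_zero_zero (hp : J.IsOrthonormal p) {Λ : ℂ[X] →ₗ[ℂ] ℂ} (hΛ : ∀ g, J.L g = Λ g)
    (hq : J.q ≠ 1) : J.A p 0 0 0 = J.G := by
  have h0 := hp.casorati hΛ 0
  have h1 : (p 0).comp (C J.q * X) = p 0 := by
    rw [eq_C_of_natDegree_eq_zero (hp.1 0), C_comp]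
  change J.G - (J.Ω p 0 - J.V) = J.G
  rw [G_sub_Ω_eq hp hΛ hq, h1]
  simp only [prevP] at h0 ⊢
  linear_combination J.G * h0

theorem A_apply_zero_zero (J : WeightData) (p : ℕ → ℂ[X]) (n : ℕ) :
    J.A p n 0 0 = J.G - (J.Ω p n - J.V) := by
  cases n <;> rfl

theorem A_apply_zero_one (J : WeightData) (p : ℕ → ℂ[X]) (n : ℕ) :
    J.A p n 0 1 = J.Θ p n := by
  cases n <;> rfl

theorem A_succ_one_zero (J : WeightData) (p : ℕ → ℂ[X]) (n : ℕ) :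
    J.A p (n + 1) 1 0 = -(C (recA p n ^ 2) * J.Θ p n) := rfl

theorem A_succ_one_one (J : WeightData) (p : ℕ → ℂ[X]) (n : ℕ) :
    J.A p (n + 1) 1 1 = J.A p n 0 0 + (X - C (J.recB p n)) * J.Θ p n := by
  rw [A_apply_zero_zero]
  change J.G - (J.Ω p n - J.V - (X - C (J.recB p n)) * J.Θ p n) = _
  ring

/-- The two recurrences collect the terms of index `n` and below at argument `x` into index `n + 1`.
The entry then has the bilinear shape of the others, which is what the determinant and the trace
need. -/
theorem A_succ_one_one_eq (hp : J.IsOrthonormal p) {Λ : ℂ[X] →ₗ[ℂ] ℂ} (hΛ : ∀ g, J.L g = Λ g)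
    (hq : J.q ≠ 1) (n : ℕ) :
    J.A p (n + 1) 1 1 = J.G * J.φ p (n + 1) * (C (recA p n) * (p n).comp (C J.q * X))
      - J.H * p (n + 1) * (C (recA p n) * (J.φ p n).comp (C J.q * X))
      - J.U * p (n + 1) * (C (recA p n) * (p n).comp (C J.q * X)) := by
  rw [A_succ_one_one, A_apply_zero_zero, G_sub_Ω_eq hp hΛ hq, Θ_eq hq]
  linear_combination -J.G * (p n).comp (C J.q * X) * hp.recurrence_φ hΛ n
    + (J.H * (J.φ p n).comp (C J.q * X) + J.U * (p n).comp (C J.q * X)) * hp.recurrence hΛ n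

/-- Write `a, b` for `prevP`, `prevφ`, and a prime for the argument `qx`. The matrix is the product
of the matrix with rows `(G p', H φ' + U p')`, `(G a', H b' + U a')` and the matrix with rows `(-b,
φ)`, `(a, -p)`. The terms in `U` drop out of the first determinant, and both determinants reduce to
Casorati determinants, at `qx` and at `x`. -/
theorem det_A_succ (hp : J.IsOrthonormal p) {Λ : ℂ[X] →ₗ[ℂ] ℂ} (hΛ : ∀ g, J.L g = Λ g)
    (hq : J.q ≠ 1) (n : ℕ) :
    J.A p (n + 1) 0 0 * J.A p (n + 1) 1 1 - J.A p (n + 1) 0 1 * J.A p (n + 1) 1 0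
      = J.G * J.H := by
  have h1 := hp.casorati hΛ (n + 1)
  have h2 := congrArg (fun g : ℂ[X] => g.comp (C J.q * X)) h1
  simp only [sub_comp, mul_comp, one_comp, prevP, prevφ, C_comp] at h1 h2
  rw [A_succ_one_one_eq hp hΛ hq, A_apply_zero_zero, G_sub_Ω_eq hp hΛ hq, A_apply_zero_one,
    A_succ_one_zero, Θ_eq hq, Θ_eq hq]
  simp only [prevP, prevφ, C_pow]
  linear_combination J.G * J.H * ((C (recA p n) * (p n).comp (C J.q * X)
    * (J.φ p (n + 1)).comp (C J.q * X) - C (recA p n) * (J.φ p n).comp (C J.q * X)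
    * (p (n + 1)).comp (C J.q * X)) * h1 + h2)

/-- The first row of the linear `q`-difference equation. -/
theorem A_row (hp : J.IsOrthonormal p) {Λ : ℂ[X] →ₗ[ℂ] ℂ} (hΛ : ∀ g, J.L g = Λ g)
    (hq : J.q ≠ 1) (n : ℕ) :
    J.A p n 0 0 * p n + J.A p n 0 1 * prevP p n = J.G * (p n).comp (C J.q * X) := by
  rw [A_apply_zero_zero, G_sub_Ω_eq hp hΛ hq, A_apply_zero_one, Θ_eq hq]
  linear_combination J.G * (p n).comp (C J.q * X) * hp.casorati hΛ n

/-- At `x = 0` the arguments `x` and `qx` agree, so `G` and `H` each multiply a Casorati determinant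
and the terms in `U` cancel. -/
theorem trace_A_succ_zero (hp : J.IsOrthonormal p) {Λ : ℂ[X] →ₗ[ℂ] ℂ} (hΛ : ∀ g, J.L g = Λ g)
    (hq : J.q ≠ 1) (n : ℕ) :
    (J.A p (n + 1) 0 0).eval 0 + (J.A p (n + 1) 1 1).eval 0 = J.G.eval 0 + J.H.eval 0 := by
  have h1 := congrArg (eval 0) (hp.casorati hΛ (n + 1))
  simp only [prevP, prevφ, eval_mul, eval_sub, eval_C, eval_one] at h1
  rw [A_succ_one_one_eq hp hΛ hq, A_apply_zero_zero, G_sub_Ω_eq hp hΛ hq]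
  simp only [prevP, prevφ, eval_mul, eval_sub, eval_C, eval_add, eval_neg, eval_comp, eval_X,
    mul_zero]
  linear_combination (J.G.eval 0 + J.H.eval 0) * h1

/-! ### The degree of `Θₙ` -/

/-- Formally `W D_q f - 2V f = G f - H f(qx)`, and `H f(qx)` is `H(x/q) f` evaluated at `qx`. As `G`
and `H` are quadratic, only the moments `μ 0`, `μ 1` and the coefficients `ν 0`, `ν 1`, `ν 2` enter.
-/
theorem U_eq (J : WeightData) (hq : J.q ≠ 1) (hq0 : J.q ≠ 0) :
    J.U = polyPart J.μ J.G
      - (polyPart J.μ (J.H.comp (C J.q⁻¹ * X))).comp (C J.q * X) := by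
  have h1q : 1 - J.q ≠ 0 := sub_ne_zero.2 hq.symm
  obtain ⟨a, b, c, hH⟩ : ∃ a b c : ℂ, J.H = C a * X ^ 2 + C b * X ^ 1 + C c * X ^ 0 :=
    ⟨J.a₂ * J.a₄, -(J.a₂ * J.a₄) * (J.a₁ * J.t + J.a₃), J.a₂ * J.a₄ * (J.a₁ * J.t * J.a₃), by
      simp only [H, C_mul, C_add, C_neg]; ring⟩
  have hW : J.W = C (1 - J.q) * (C a * X ^ 3 + C b * X ^ 2 + C c * X ^ 1) := by
    rw [W_eq, hH]; ring
  have hH' : J.H.comp (C J.q⁻¹ * X) =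
      C (a * J.q⁻¹ ^ 2) * X ^ 2 + C (b * J.q⁻¹) * X ^ 1 + C c * X ^ 0 := by
    rw [hH]
    simp only [add_comp, mul_comp, C_comp, X_pow_comp, C_mul, C_pow]
    ring
  have e1 : (1 - J.q) * J.ν 1 = J.μ 0 * (1 - J.q⁻¹) := by
    simp only [ν, zero_add, pow_one]; field_simp
  have e2 : (1 - J.q) * J.ν 2 = J.μ 1 * (1 - J.q⁻¹ ^ 2) := by
    simp only [ν]; norm_num; field_simp
  have e0 : J.ν 0 = 0 := rfl
  rw [U, two_V, polyPart_sub, hH', hW, hH]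
  simp only [polyPart_add, polyPart_C_mul, polyPart_X_pow, Finset.sum_range_succ,
    Finset.sum_range_zero, add_comp, mul_comp, C_comp, X_pow_comp, zero_add, e0, zero_comp,
    Nat.sub_zero, Nat.sub_self]
  have e1' := congrArg (C : ℂ → ℂ[X]) e1
  have e2' := congrArg (C : ℂ → ℂ[X]) e2
  have e3 : (C J.q : ℂ[X]) * C J.q⁻¹ = 1 := by rw [← C_mul, mul_inv_cancel₀ hq0, C_1]
  simp only [C_mul, C_sub, C_pow, C_1] at e1' e2' ⊢
  norm_num
  linear_combination C a * e2' + (C b + C a * X) * e1' + C a * C J.q⁻¹ * C (J.μ 0) * X * e3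

/-- The `q`-Pearson relation for the functional. -/
def Pearson (J : WeightData) (Λ : ℂ[X] →ₗ[ℂ] ℂ) : Prop :=
  ∀ k : ℕ, Λ (J.H.comp (C J.q⁻¹ * X) * X ^ k) = J.q ^ (k + 1) * Λ (J.G * X ^ k)

theorem coeff_comp_C_mul_X (q : ℂ) (g : ℂ[X]) (m : ℕ) :
    (g.comp (C q * X)).coeff m = g.coeff m * q ^ m := comp_C_mul_X_coeff

theorem natDegree_comp_C_mul_X_le (q : ℂ) (g : ℂ[X]) :
    (g.comp (C q * X)).natDegree ≤ g.natDegree := by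
  refine natDegree_comp_le.trans ?_
  calc _ ≤ g.natDegree * 1 := Nat.mul_le_mul_left _
        ((natDegree_C_mul_le q X).trans natDegree_X_le)
    _ = _ := mul_one _

theorem natDegree_quadratic_le (a b c : ℂ) :
    (C a * (X - C b) * (X - C c)).natDegree ≤ 2 := by
  refine natDegree_mul_le_of_le (m := 1) (n := 1) ?_ (natDegree_X_sub_C_le c)
  exact (natDegree_C_mul_le _ _).trans (natDegree_X_sub_C_le b)

theorem natDegree_G_le (J : WeightData) : J.G.natDegree ≤ 2 := natDegree_quadratic_le _ _ _

theorem natDegree_H_le (J : WeightData) : J.H.natDegree ≤ 2 := natDegree_quadratic_le _ _ _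

/-- With `ε = f p - φ`, the terms containing `f` combine to `p(x) p(qx) (G f - H f(qx) - U)`, which
vanishes by the Pearson relation. What remains is `-G ε p(qx) + H p ε(qx)`. Orthogonality gives `ε =
O(x^{-n-1})`, so the degree is at most `2 + n - (n + 1) = 1`. The proof carries this out with
polynomials, after multiplication by `x^N`. -/
theorem natDegree_Θ_le (hp : J.IsOrthonormal p) {Λ : ℂ[X] →ₗ[ℂ] ℂ} (hΛ : ∀ g, J.L g = Λ g)
    (hq : J.q ≠ 1) (hq0 : J.q ≠ 0) (hP : Pearson J Λ) (n : ℕ) : (J.Θ p n).natDegree ≤ 1 := by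
  -- Small enough that every coefficient of `E` above `x^n` pairs `p n` with a power below `x^n`,
  -- and large enough that the truncation error `R p(x) p(qx)`, of degree at most `1 + 2n`, stays
  -- within `N + 1`.
  set N := 2 * n + 1 with hN
  have hqC : (C J.q : ℂ[X]) ≠ 0 := C_ne_zero.2 hq0
  -- the remainder for `p n`
  set E := truncRem J.μ N (p n) with hE
  have hEdeg : E.natDegree ≤ n := by
    rw [natDegree_le_iff_coeff_eq_zero]
    intro m hm
    rw [hE, coeff_truncRem J.μ Λ (μ_eq hΛ) N m _ (by rw [hp.1]; omega)]
    split_ifs with h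
    · refine hp.apply_mul_eq_zero hΛ ?_
      rw [degree_X_pow]
      exact_mod_cast (by omega : N - 1 - m < n)
    · rfl
  -- the remainder for the Riccati equation
  set R := C (J.q ^ N) * truncRem J.μ N J.G
    - (truncRem J.μ N (J.H.comp (C J.q⁻¹ * X))).comp (C J.q * X) with hR
  have hH'deg : (J.H.comp (C J.q⁻¹ * X)).natDegree ≤ 2 :=
    (natDegree_comp_C_mul_X_le _ _).trans (natDegree_H_le J)
  have hRdeg : R.natDegree ≤ 1 := by
    rw [natDegree_le_iff_coeff_eq_zero]
    intro m hm
    rw [hR, coeff_sub, coeff_C_mul, coeff_comp_C_mul_X,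
      coeff_truncRem J.μ Λ (μ_eq hΛ) N m _ ((natDegree_G_le J).trans hm),
      coeff_truncRem J.μ Λ (μ_eq hΛ) N m _ (hH'deg.trans hm)]
    split_ifs with h
    · rw [hP, show N = (N - 1 - m + 1) + m by omega, pow_add,
        show N - 1 - m + 1 + m - 1 - m = N - 1 - m by omega]
      ring
    · ring
  set F := polyPart J.μ (X ^ N) with hF
  have h1 : X ^ N * J.φ p n = F * p n - E := by rw [hE, truncRem, φ]; ring
  have h2 := congrArg (fun g : ℂ[X] => g.comp (C J.q * X)) h1
  simp only [mul_comp, sub_comp, X_pow_comp, mul_pow] at h2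
  have hHH : (J.H.comp (C J.q⁻¹ * X)).comp (C J.q * X) = J.H := by
    rw [comp_assoc]
    simp [← mul_assoc, ← C_mul, inv_mul_cancel₀ hq0]
  have h3 : C J.q ^ N * X ^ N * J.U =
      C J.q ^ N * J.G * F - J.H * F.comp (C J.q * X) - R := by
    rw [hR, truncRem, truncRem, U_eq J hq hq0]
    simp only [sub_comp, mul_comp, X_pow_comp, mul_pow, hHH, C_pow]
    ring
  have key : C (J.q ^ N) * (X ^ N * J.Θ p n) =
      -(C (J.q ^ N) * (J.G * E * (p n).comp (C J.q * X)))
        + J.H * p n * E.comp (C J.q * X) + R * p n * (p n).comp (C J.q * X) := by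
    rw [Θ_eq hq, C_pow]
    linear_combination C J.q ^ N * J.G * (p n).comp (C J.q * X) * h1 - J.H * p n * h2
      - p n * (p n).comp (C J.q * X) * h3
  have hpn : (p n).natDegree ≤ n := (hp.1 n).le
  have hpn' : ((p n).comp (C J.q * X)).natDegree ≤ n :=
    (natDegree_comp_C_mul_X_le _ _).trans hpn
  have hE' : (E.comp (C J.q * X)).natDegree ≤ n := (natDegree_comp_C_mul_X_le _ _).trans hEdeg
  have hdeg : (C (J.q ^ N) * (X ^ N * J.Θ p n)).natDegree ≤ N + 1 := by
    rw [key]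
    refine natDegree_add_le_of_degree_le (natDegree_add_le_of_degree_le ?_ ?_) ?_
    · rw [natDegree_neg]
      refine (natDegree_C_mul_le _ _).trans ?_
      refine (natDegree_mul_le_of_le (natDegree_mul_le_of_le (natDegree_G_le J) hEdeg)
        hpn').trans (by omega)
    · refine (natDegree_mul_le_of_le (natDegree_mul_le_of_le (natDegree_H_le J) hpn)
        hE').trans (by omega)
    · refine (natDegree_mul_le_of_le (natDegree_mul_le_of_le hRdeg hpn)
        hpn').trans (by omega)
  rw [natDegree_le_iff_coeff_eq_zero]
  intro m hm
  have := coeff_eq_zero_of_natDegree_lt (hdeg.trans_lt (by omega : N + 1 < m + N))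
  rw [coeff_C_mul, coeff_X_pow_mul] at this
  exact (mul_eq_zero.1 this).resolve_left (pow_ne_zero _ hq0)

/-- The degree and the leading coefficient of the upper left entry. -/
theorem A_zero_zero_lead (hp : J.IsOrthonormal p) {Λ : ℂ[X] →ₗ[ℂ] ℂ} (hΛ : ∀ g, J.L g = Λ g)
    (hq : J.q ≠ 1) (hq0 : J.q ≠ 0) (hP : Pearson J Λ) (n : ℕ) :
    (J.A p n 0 0).natDegree ≤ 2 ∧ (J.A p n 0 0).coeff 2 = J.κ₁ n := by
  have hrow := hp.leadingCoeff_ne_zero hΛ n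
  -- This term of the row identity is too small to reach degree `n + 2`, so the leading coefficient
  -- of the upper left entry comes from `G p(qx)` alone; the power `q^n` arises from the argument
  -- `qx`.
  have hΘ : (J.A p n 0 1 * prevP p n).natDegree ≤ n := by
    rw [A_apply_zero_one]
    cases n with
    | zero => simp [prevP]
    | succ n =>
      refine (natDegree_mul_le_of_le (natDegree_Θ_le hp hΛ hq hq0 hP _) (n := n) ?_).trans (by omega)
      rw [prevP]
      exact (natDegree_C_mul_le _ _).trans (hp.1 n).le
  have hpn' : ((p n).comp (C J.q * X)).natDegree ≤ n :=
    (natDegree_comp_C_mul_X_le _ _).trans (hp.1 n).le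
  have hprod : J.A p n 0 0 * p n = J.G * (p n).comp (C J.q * X) - J.A p n 0 1 * prevP p n := by
    rw [← A_row hp hΛ hq n]; ring
  have hp0 : p n ≠ 0 := leadingCoeff_ne_zero.1 hrow
  have hdeg : (J.A p n 0 0 * p n).natDegree ≤ n + 2 := by
    rw [hprod]
    rw [sub_eq_add_neg]
    refine natDegree_add_le_of_degree_le ?_ ((natDegree_neg _).le.trans (hΘ.trans (by omega)))
    exact (natDegree_mul_le_of_le (natDegree_G_le J) hpn').trans (by omega)
  have hA : (J.A p n 0 0).natDegree ≤ 2 := by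
    by_cases h0 : J.A p n 0 0 = 0
    · simp [h0]
    · rw [natDegree_mul h0 hp0, hp.1] at hdeg
      omega
  refine ⟨hA, ?_⟩
  have h1 := congrArg (fun g : ℂ[X] => g.coeff (2 + n)) hprod
  simp only [coeff_sub] at h1
  have hG2 : J.G.coeff 2 = J.q ^ J.σ * J.a₁ * J.a₃ := by
    have : J.G = C (J.q ^ J.σ * J.a₁ * J.a₃) * X ^ 2
        + C (-(J.q ^ J.σ * J.a₁ * J.a₃) * (J.a₂ * J.t + J.a₄)) * X
        + C (J.q ^ J.σ * J.a₁ * J.a₃ * (J.a₂ * J.t * J.a₄)) := by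
      simp only [G, C_mul, C_add, C_neg]; ring
    rw [this, coeff_add, coeff_add, coeff_C_mul, coeff_C_mul, coeff_C, coeff_X_pow, coeff_X]
    simp
  rw [coeff_mul_add_eq_of_natDegree_le hA (hp.1 n).le,
    coeff_mul_add_eq_of_natDegree_le (natDegree_G_le J) hpn',
    coeff_eq_zero_of_natDegree_lt (p := J.A p n 0 1 * prevP p n) (by omega), sub_zero,
    coeff_comp_C_mul_X, hp.coeff_self, hG2] at h1
  refine mul_right_cancel₀ hrow ?_
  rw [h1, κ₁]; ring

end WeightData
end QOrth
end

/-! ### The Jackson integral: convergence and the Pearson relation. -/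

noncomputable section

namespace QOrth

theorem multipliable_qPoch {q : ℂ} (hq : ‖q‖ < 1) (a : ℂ) :
    Multipliable fun k : ℕ => 1 - a * q ^ k := by
  have h : Summable fun k : ℕ => ‖-(a * q ^ k)‖ := by
    simp only [norm_neg, norm_mul, norm_pow]
    exact (summable_geometric_of_lt_one (norm_nonneg q) hq).mul_left _
  simpa [sub_eq_add_neg] using multipliable_one_add_of_summable h

theorem qPoch_eq {q : ℂ} (hq : ‖q‖ < 1) (a : ℂ) :
    qPoch q a = (1 - a) * qPoch q (q * a) := by
  unfold qPoch
  have h := (multipliable_qPoch hq (q * a))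
  have e : (fun k : ℕ => 1 - q * a * q ^ k) = fun k : ℕ => 1 - a * q ^ (k + 1) := by
    funext k; ring
  rw [e] at h ⊢
  have h2 := tprod_eq_zero_mul' (f := fun k : ℕ => 1 - a * q ^ k) h
  simpa using h2

namespace WeightData

variable {J : WeightData}

theorem Admissible.q_ne_zero (hJ : J.Admissible) : J.q ≠ 0 := norm_pos_iff.1 hJ.q_pos

theorem Admissible.q_ne_one (hJ : J.Admissible) : J.q ≠ 1 := by
  intro h
  have := hJ.q_lt
  rw [h, norm_one] at this
  exact lt_irrefl _ this

theorem eval_G (J : WeightData) (x : ℂ) :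
    J.G.eval x = J.q ^ J.σ * J.a₁ * J.a₃ * (x - J.a₂ * J.t) * (x - J.a₄) := by
  simp [G]

theorem eval_H (J : WeightData) (x : ℂ) :
    J.H.eval x = J.a₂ * J.a₄ * (x - J.a₁ * J.t) * (x - J.a₃) := by
  simp [H]

/-- The `q`-Pearson equation for the weight. -/
theorem Admissible.w_mul (hJ : J.Admissible) {x : ℂ} (hx : x ≠ 0)
    (h2 : qPoch J.q (x / (J.a₂ * J.t)) ≠ 0) (h4 : qPoch J.q (x / J.a₄) ≠ 0) :
    J.w (J.q * x) * J.H.eval x = J.G.eval x * J.w x := by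
  have ha₁ := hJ.ha₁
  have ha₂ := hJ.ha₂
  have ha₃ := hJ.ha₃
  have ha₄ := hJ.ha₄
  have ht := hJ.ht
  have hE : Complex.exp (J.σ * J.ℓ (J.q * x)) = J.q ^ J.σ * Complex.exp (J.σ * J.ℓ x) := by
    rw [hJ.log_mul x hx, mul_add, Complex.exp_add, Complex.cpow_def_of_ne_zero hJ.q_ne_zero]
    ring_nf
  rw [eval_G, eval_H, w, w, hE]
  simp only [mul_div_assoc J.q x]
  rw [qPoch_eq hJ.q_lt] at h2 h4
  rw [qPoch_eq hJ.q_lt (x / (J.a₂ * J.t)), qPoch_eq hJ.q_lt (x / J.a₄),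
    qPoch_eq hJ.q_lt (x / (J.a₁ * J.t)), qPoch_eq hJ.q_lt (x / J.a₃)]
  obtain ⟨h2a, h2b⟩ := mul_ne_zero_iff.1 h2
  obtain ⟨h4a, h4b⟩ := mul_ne_zero_iff.1 h4
  generalize qPoch J.q (J.q * (x / (J.a₂ * J.t))) = P2 at *
  generalize qPoch J.q (J.q * (x / J.a₄)) = P4 at *
  generalize qPoch J.q (J.q * (x / (J.a₁ * J.t))) = P1
  generalize qPoch J.q (J.q * (x / J.a₃)) = P3
  generalize Complex.exp (J.σ * J.ℓ x) = E
  have e1 : x - J.a₁ * J.t = -(J.a₁ * J.t * (1 - x / (J.a₁ * J.t))) := by field_simp; ring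
  have e2 : x - J.a₂ * J.t = -(J.a₂ * J.t * (1 - x / (J.a₂ * J.t))) := by field_simp; ring
  have e3 : x - J.a₃ = -(J.a₃ * (1 - x / J.a₃)) := by field_simp; ring
  have e4 : x - J.a₄ = -(J.a₄ * (1 - x / J.a₄)) := by field_simp; ring
  rw [e1, e2, e3, e4]
  generalize 1 - x / (J.a₁ * J.t) = d1 at *
  generalize 1 - x / (J.a₂ * J.t) = d2 at *
  generalize 1 - x / J.a₃ = d3 at *
  generalize 1 - x / J.a₄ = d4 at *
  rw [div_mul_eq_mul_div, mul_div_assoc', div_eq_div_iff (mul_ne_zero h2b h4b)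
    (mul_ne_zero h2 h4)]
  ring

/-- `e` is an end point of the Jackson integral. -/
def IsEnd (J : WeightData) (e : ℂ) : Prop :=
  (e = J.q * J.a₁ * J.t ∨ e = J.q * J.a₃) ∧
    ∀ k : ℕ, qPoch J.q (e * J.q ^ k / (J.a₂ * J.t)) ≠ 0 ∧ qPoch J.q (e * J.q ^ k / J.a₄) ≠ 0

theorem IsEnd.ne_zero {e : ℂ} (hJ : J.Admissible) (he : J.IsEnd e) : e ≠ 0 := by
  have := hJ.q_ne_zero
  have := hJ.ha₁
  have := hJ.ha₃
  have := hJ.ht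
  rcases he.1 with h | h <;> rw [h] <;> simp [*]

theorem IsEnd.w_succ {e : ℂ} (hJ : J.Admissible) (he : J.IsEnd e) (k : ℕ) :
    J.w (e * J.q ^ (k + 1)) * J.H.eval (e * J.q ^ k) =
      J.G.eval (e * J.q ^ k) * J.w (e * J.q ^ k) := by
  rw [← hJ.w_mul (mul_ne_zero (he.ne_zero hJ) (pow_ne_zero _ hJ.q_ne_zero)) (he.2 k).1 (he.2 k).2,
    show e * J.q ^ (k + 1) = J.q * (e * J.q ^ k) by ring]

theorem tendsto_mul_pow (hJ : J.Admissible) (e : ℂ) :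
    Filter.Tendsto (fun k : ℕ => e * J.q ^ k) Filter.atTop (nhds 0) := by
  simpa using (tendsto_pow_atTop_nhds_zero_of_norm_lt_one hJ.q_lt).const_mul e

/-- Ratio test: by the Pearson equation consecutive terms have ratio `q G/H` at `e q^k`, which tends
to `q G(0)/H(0) = q^{σ+1}`. As `H(0) ≠ 0`, the division is legitimate for all large `k`. -/
theorem IsEnd.summable_weight {e : ℂ} (hJ : J.Admissible) (he : J.IsEnd e) :
    Summable fun k : ℕ => J.q ^ k * J.w (e * J.q ^ k) := by
  have hx := tendsto_mul_pow hJ e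
  have hH0 : J.H.eval 0 ≠ 0 := by
    rw [eval_H]
    have := hJ.ha₁
    have := hJ.ha₂
    have := hJ.ha₃
    have := hJ.ha₄
    have := hJ.ht
    simp [*]
  have hH : Filter.Tendsto (fun k : ℕ => J.H.eval (e * J.q ^ k)) Filter.atTop
      (nhds (J.H.eval 0)) := (J.H.continuous.tendsto 0).comp hx
  have hG : Filter.Tendsto (fun k : ℕ => J.G.eval (e * J.q ^ k)) Filter.atTop
      (nhds (J.G.eval 0)) := (J.G.continuous.tendsto 0).comp hx
  have hlim : Filter.Tendsto (fun k : ℕ => ‖J.q * (J.G.eval (e * J.q ^ k) /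
      J.H.eval (e * J.q ^ k))‖) Filter.atTop (nhds ‖J.q ^ (J.σ + 1)‖) := by
    have h1 : J.q ^ (J.σ + 1) = J.q * (J.G.eval 0 / J.H.eval 0) := by
      rw [eq_comm, ← mul_div_assoc, div_eq_iff hH0, Complex.cpow_add _ _ hJ.q_ne_zero,
        Complex.cpow_one, eval_G, eval_H]
      ring
    rw [h1]
    exact ((hG.div hH hH0).const_mul J.q).norm
  obtain ⟨r, hr1, hr2⟩ := exists_between hJ.conv
  refine summable_of_ratio_norm_eventually_le hr2 ?_
  filter_upwards [hlim.eventually (eventually_le_nhds hr1), hH.eventually_ne hH0] with k hk hk0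
  have h := he.w_succ hJ k
  have h2 : J.q ^ (k + 1) * J.w (e * J.q ^ (k + 1)) = J.q * (J.G.eval (e * J.q ^ k) /
      J.H.eval (e * J.q ^ k)) * (J.q ^ k * J.w (e * J.q ^ k)) := by
    rw [← eq_div_iff hk0] at h
    rw [h]
    ring
  rw [h2, norm_mul]
  exact mul_le_mul_of_nonneg_right hk (norm_nonneg _)

theorem IsEnd.summable {e : ℂ} (hJ : J.Admissible) (he : J.IsEnd e) (g : ℂ[X]) :
    Summable fun k : ℕ => J.q ^ k * (J.w (e * J.q ^ k) * g.eval (e * J.q ^ k)) := by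
  have hb : Filter.Tendsto (fun k : ℕ => ‖g.eval (e * J.q ^ k)‖) Filter.atTop
      (nhds ‖g.eval 0‖) := ((g.continuous.tendsto 0).comp (tendsto_mul_pow hJ e)).norm
  obtain ⟨B, hB⟩ := hb.bddAbove_range
  refine Summable.of_norm_bounded ((he.summable_weight hJ).norm.mul_right B) fun k => ?_
  rw [← mul_assoc, norm_mul]
  exact mul_le_mul_of_nonneg_left (hB ⟨k, rfl⟩) (norm_nonneg _)

/-- The Jackson integral from `0` to `e` against the weight, as a linear functional. -/
theorem IsEnd.exists_functional {e : ℂ} (hJ : J.Admissible) (he : J.IsEnd e) :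
    ∃ Λ : ℂ[X] →ₗ[ℂ] ℂ, (∀ g : ℂ[X], jackson J.q e (fun x => J.w x * g.eval x) = Λ g) ∧
      Pearson J Λ := by
  refine ⟨{ toFun := fun g => jackson J.q e (fun x => J.w x * g.eval x)
            map_add' := fun f g => ?_
            map_smul' := fun c g => ?_ }, fun g => rfl, fun j => ?_⟩
  · simp only [jackson, eval_add, mul_add]
    rw [(he.summable hJ f).tsum_add (he.summable hJ g), mul_add]
  · simp only [jackson, eval_smul, smul_eq_mul, RingHom.id_apply]
    have : ∀ k : ℕ, J.q ^ k * (J.w (e * J.q ^ k) * (c * g.eval (e * J.q ^ k))) =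
        c * (J.q ^ k * (J.w (e * J.q ^ k) * g.eval (e * J.q ^ k))) := fun k => by ring
    simp only [this]
    rw [tsum_mul_left]
    ring
  · have hq0 := hJ.q_ne_zero
    simp only [LinearMap.coe_mk, AddHom.coe_mk, jackson]
    rw [(he.summable hJ _).tsum_eq_zero_add]
    -- An end point divided by `q` is `a₁ t` or `a₃`, a zero of `H`. The first term of the sum drops
    -- out and an index shift of the remaining terms is the Pearson relation.
    have h0 : J.H.eval (J.q⁻¹ * e) = 0 := by
      rw [eval_H]
      rcases he.1 with h | h <;> rw [h] <;> field_simp <;> simp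
    have h1 : ∀ k : ℕ, J.q ^ (k + 1) * (J.w (e * J.q ^ (k + 1)) *
        (J.H.comp (C J.q⁻¹ * X) * X ^ j).eval (e * J.q ^ (k + 1))) =
        J.q ^ (j + 1) * (J.q ^ k * (J.w (e * J.q ^ k) * (J.G * X ^ j).eval (e * J.q ^ k))) := by
      intro k
      have h := he.w_succ hJ k
      simp only [eval_mul, eval_comp, eval_C, eval_X, eval_pow]
      rw [show J.q⁻¹ * (e * J.q ^ (k + 1)) = e * J.q ^ k by
        field_simp; ring]
      linear_combination J.q ^ (k + 1) * (e * J.q ^ (k + 1)) ^ j * h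
    simp only [h1]
    rw [tsum_mul_left]
    simp only [eval_mul, eval_comp, eval_C, eval_X, pow_zero, mul_one, h0, zero_mul, mul_zero,
      zero_add]
    ring

theorem exists_functional_of_end {e : ℂ} (hJ : J.Admissible)
    (he : e = 0 ∨ e = J.q * J.a₁ * J.t ∨ e = J.q * J.a₃)
    (hpole : ∀ k : ℕ, qPoch J.q (e * J.q ^ k / (J.a₂ * J.t)) ≠ 0 ∧
      qPoch J.q (e * J.q ^ k / J.a₄) ≠ 0) :
    ∃ Λ : ℂ[X] →ₗ[ℂ] ℂ, (∀ g : ℂ[X], jackson J.q e (fun x => J.w x * g.eval x) = Λ g) ∧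
      Pearson J Λ := by
  rcases he with rfl | he
  · exact ⟨0, fun g => by simp [jackson], fun k => by simp⟩
  · exact IsEnd.exists_functional hJ ⟨he, hpole⟩

theorem Admissible.exists_functional (hJ : J.Admissible) :
    ∃ Λ : ℂ[X] →ₗ[ℂ] ℂ, (∀ g : ℂ[X], J.L g = Λ g) ∧ Pearson J Λ := by
  obtain ⟨Λ₁, h1, P1⟩ := exists_functional_of_end hJ hJ.he₁ fun k => hJ.no_pole k _ (Or.inl rfl)
  obtain ⟨Λ₂, h2, P2⟩ := exists_functional_of_end hJ hJ.he₂ fun k => hJ.no_pole k _ (Or.inr rfl)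
  refine ⟨Λ₂ - Λ₁, fun g => by rw [L, h1, h2]; rfl, fun k => ?_⟩
  rw [LinearMap.sub_apply, LinearMap.sub_apply, P1, P2]
  ring

end WeightData
end QOrth
end

/-! ### Solving the determinant relation for the shifted point. -/

noncomputable section

namespace QP6

theorem coeff_eq_zero_of_sub_mul {s₂ s₁ s₀ y : ℂ}
    (h : ∀ x, (x - y) * (s₂ * x ^ 2 + s₁ * x + s₀) = 0) : s₂ = 0 ∧ s₁ = 0 ∧ s₀ = 0 := by
  have h1 : s₂ * (y + 1) ^ 2 + s₁ * (y + 1) + s₀ = 0 := by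
    linear_combination h (y + 1)
  have h2 : s₂ * (y - 1) ^ 2 + s₁ * (y - 1) + s₀ = 0 := by
    linear_combination -h (y - 1)
  have h3 : s₂ * (y + 2) ^ 2 + s₁ * (y + 2) + s₀ = 0 := by
    linear_combination (1 / 2) * h (y + 2)
  have e2 : s₂ = 0 := by linear_combination (1 / 3) * h3 - (1 / 2) * h1 + (1 / 6) * h2
  subst e2
  have e1 : s₁ = 0 := by linear_combination (1 / 2) * h1 - (1 / 2) * h2
  subst e1
  exact ⟨rfl, rfl, by linear_combination h1⟩

namespace Param

variable {D : Param}

/-- The parameter relation in the form in which it matches the determinant of the matrix polynomial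
at `x = 0`. -/
theorem prod_θ (hD : D.Admissible) : D.θ₁ * D.θ₂ = D.κ₁ * D.κ₂ * D.a₁ * D.a₂ * D.a₃ * D.a₄ := by
  obtain ⟨hq, h1, h2, h3, h4, hk1, hk2, ht1, ht2, h⟩ := hD
  simp only [a₅, a₆, a₇, a₈] at h
  field_simp at h
  refine mul_left_cancel₀ (mul_ne_zero (mul_ne_zero hq h1) h2) ?_
  linear_combination -D.q * D.a₁ * D.a₂ * h

/-- The shift formulas for a pair of matrix polynomials in normal form. -/
theorem shift_of_det (hD : D.Admissible) {t y z y' z' c₁ c₀ d₁ d₀ w : ℂ} (hw : w ≠ 0)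
    (hdet : ∀ x, (D.q * D.κ₁ * x ^ 2 + c₁ * x + c₀) * (D.κ₂ / D.q * x ^ 2 + d₁ * x + d₀)
      + w * (x - y) * (x - y') =
        D.κ₁ * D.κ₂ * (x - D.a₁ * t) * (x - D.a₂ * t) * (x - D.a₃) * (x - D.a₄))
    (htr : c₀ + d₀ = (D.θ₁ + D.θ₂) * t)
    (hv : D.κ₂ / D.q * y ^ 2 + d₁ * y + d₀ ≠ 0)
    (hz : z * (D.q * (D.κ₂ / D.q * y ^ 2 + d₁ * y + d₀)) = (y - D.a₁ * t) * (y - D.a₂ * t))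
    (hv' : D.q * D.κ₁ * y' ^ 2 + c₁ * y' + c₀ ≠ 0)
    (hz' : z' * (D.q * (D.q * D.κ₁ * y' ^ 2 + c₁ * y' + c₀)) = (y' - D.a₁ * t) * (y' - D.a₂ * t))
    (hS : D.ShiftDefined t y z) : z' = D.zNext t y z ∧ y' = D.yNext t y z := by
  obtain ⟨hκ, hm, hD3, hD4, hZ1⟩ := hS
  have hθ := prod_θ hD
  obtain ⟨hq, ha1, ha2, ha3, ha4, hk1, hk2, hth1, hth2, -⟩ := hD
  have hκ' : D.κ₂ - D.q ^ 2 * D.κ₁ ≠ 0 := sub_ne_zero.2 hκ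
  have hm' : 1 - D.κ₂ * z ≠ 0 := sub_ne_zero.2 (Ne.symm hm)
  -- For `z = 0` the point `y` would be `a₁ t` or `a₂ t`; then `ζ` vanishes, and with it a
  -- denominator excluded by `hS`.
  have hz0 : z ≠ 0 := by
    rintro rfl
    have h1 : (y - D.a₁ * t) * (y - D.a₂ * t) = 0 := by rw [← hz, zero_mul]
    refine hD3 ?_
    have : D.ζ t y 0 = 0 := by
      simp only [ζ, mul_assoc, h1]
      simp
    rw [this]; ring
  obtain ⟨m, hmdef⟩ : ∃ m, m = D.κ₂ * z := ⟨_, rfl⟩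
  have hm0 : m ≠ 0 := hmdef ▸ mul_ne_zero hk2 hz0
  have hm1 : 1 - m ≠ 0 := hmdef ▸ hm'
  -- `η` is the second zero, besides `y`, of `(x - a₁t)(x - a₂t)` minus `q z` times the lower right
  -- entry, a quadratic with leading coefficient `1 - m`. Likewise `ξ` is the second zero of the
  -- upper left entry divided by `q κ₁`, minus `m (x - a₃)(x - a₄)`.
  obtain ⟨η, hη⟩ : ∃ η, η = (D.q * z * d₁ + (D.a₁ * t + D.a₂ * t)) / (1 - m) - y := ⟨_, rfl⟩
  obtain ⟨ξ, hξ⟩ : ∃ ξ, ξ = -(c₁ / (D.q * D.κ₁) + m * (D.a₃ + D.a₄)) / (1 - m) - y := ⟨_, rfl⟩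
  have hη' : (1 - m) * (η + y) = D.q * z * d₁ + (D.a₁ * t + D.a₂ * t) := by
    rw [hη]; field_simp; ring
  have hξ' : D.q * D.κ₁ * ((1 - m) * (ξ + y)) = -(c₁ + D.q * D.κ₁ * m * (D.a₃ + D.a₄)) := by
    rw [hξ]; field_simp; ring
  have hκq : D.κ₂ / D.q * D.q = D.κ₂ := div_mul_cancel₀ _ hq
  have hB22 : ∀ x, D.q * z * (D.κ₂ / D.q * x ^ 2 + d₁ * x + d₀) =
      (x - D.a₁ * t) * (x - D.a₂ * t) - (1 - m) * (x - y) * (x - η) := by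
    intro x
    linear_combination hz - (x - y) * hη' + z * (x ^ 2 - y ^ 2) * hκq - (x ^ 2 - y ^ 2) * hmdef
  -- At `x = y` the off-diagonal product vanishes, so the determinant determines the upper left
  -- entry from the lower right one.
  have hB11y : D.q * D.κ₁ * y ^ 2 + c₁ * y + c₀ =
      D.q * D.κ₁ * (m * ((y - D.a₃) * (y - D.a₄))) := by
    refine mul_right_cancel₀ hv ?_
    rw [hmdef]
    linear_combination hdet y - D.κ₁ * D.κ₂ * (y - D.a₃) * (y - D.a₄) * hz
  have hB11 : ∀ x, D.q * D.κ₁ * x ^ 2 + c₁ * x + c₀ =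
      D.q * D.κ₁ * (m * ((x - D.a₃) * (x - D.a₄)) + (1 - m) * (x - y) * (x - ξ)) := by
    intro x
    linear_combination hB11y + (x - y) * hξ'
  obtain ⟨K, hK⟩ : ∃ K, K = w * z / (D.κ₁ * (1 - m)) := ⟨_, rfl⟩
  have hK' : K * (D.κ₁ * (1 - m)) = w * z := by rw [hK]; field_simp
  have hK0 : K ≠ 0 := by
    rw [hK]; exact div_ne_zero (mul_ne_zero hw hz0) (mul_ne_zero hk1 hm1)
  -- the cubic identity
  have hcub0 : ∀ x, (x - y) * ((x - D.a₁ * t) * (x - D.a₂ * t) * (x - ξ)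
      - m * ((x - D.a₃) * (x - D.a₄)) * (x - η)
      - (1 - m) * (x - y) * (x - η) * (x - ξ) + K * (x - y')) = 0 := by
    intro x
    have h := hdet x
    have e1 := hB11 x
    have e2 := hB22 x
    refine (mul_eq_zero.1 (?_ : (D.κ₁ * (1 - m)) * _ = 0)).resolve_left (mul_ne_zero hk1 hm1)
    rw [e1] at h
    have h2 : D.q * D.κ₁ * (m * ((x - D.a₃) * (x - D.a₄)) + (1 - m) * (x - y) * (x - ξ)) *
        (D.q * z * (D.κ₂ / D.q * x ^ 2 + d₁ * x + d₀)) + D.q * z * (w * (x - y) * (x - y')) =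
        D.q * z * (D.κ₁ * D.κ₂ * (x - D.a₁ * t) * (x - D.a₂ * t) * (x - D.a₃) * (x - D.a₄)) := by
      linear_combination D.q * z * h
    rw [e2] at h2
    refine mul_left_cancel₀ hq ?_
    linear_combination h2 + D.q * (x - y) * (x - y') * hK'
      - D.q * D.κ₁ * (x - D.a₁ * t) * (x - D.a₂ * t) * (x - D.a₃) * (x - D.a₄) * hmdef
  -- The cubic terms of the cofactor of `x - y` cancel since `1 - m - (1 - m) = 0`. A quadratic that
  -- vanishes off `y` is zero, so the identity holds at `y` as well and may be read coefficientwise.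
  obtain ⟨r2, r1, r0⟩ := coeff_eq_zero_of_sub_mul (y := y)
    (s₂ := -(D.a₁ * t + D.a₂ * t) - ξ + m * (D.a₃ + D.a₄ + η) + (1 - m) * (y + η + ξ))
    (s₁ := D.a₁ * t * (D.a₂ * t) + (D.a₁ * t + D.a₂ * t) * ξ
      - m * (D.a₃ * D.a₄ + (D.a₃ + D.a₄) * η) - (1 - m) * (y * η + y * ξ + η * ξ) + K)
    (s₀ := -(D.a₁ * t * (D.a₂ * t) * ξ) + m * (D.a₃ * D.a₄ * η) + (1 - m) * (y * η * ξ) - K * y')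
    (fun x => by linear_combination hcub0 x)
  have hcub : ∀ x, (x - D.a₁ * t) * (x - D.a₂ * t) * (x - ξ)
      - m * ((x - D.a₃) * (x - D.a₄)) * (x - η)
      - (1 - m) * (x - y) * (x - η) * (x - ξ) + K * (x - y') = 0 := by
    intro x
    linear_combination x ^ 2 * r2 + x * r1 + r0
  -- The coefficient of `x²`. The common value multiplied by `y` turns out to be `ζ`, which turns
  -- every factor of the shift formulas into a factor in `η` or `ξ`.
  have hrel : y + η - (D.a₁ * t + D.a₂ * t) = m * (y + ξ - (D.a₃ + D.a₄)) := by
    linear_combination r2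
  -- the trace
  have hc0 : c₀ = D.q * D.κ₁ * (m * (D.a₃ * D.a₄) + (1 - m) * (y * ξ)) := by
    linear_combination hB11 0
  have hd0 : D.q * z * d₀ = D.a₁ * t * (D.a₂ * t) - (1 - m) * (y * η) := by
    linear_combination hB22 0
  -- `ζ`
  have hζ : D.ζ t y z = y * (y + η - (D.a₁ * t + D.a₂ * t)) := by
    have h1 : (t * D.θ₁ - D.q * D.κ₁ * D.a₃ * D.a₄) * (t * D.θ₂ - D.q * D.κ₁ * D.a₃ * D.a₄) /
        (D.κ₁ * D.a₃ * D.a₄) =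
        D.κ₂ * (D.a₁ * t * (D.a₂ * t)) - D.q * (c₀ + d₀) + D.q ^ 2 * D.κ₁ * (D.a₃ * D.a₄) := by
      rw [div_eq_iff (by simp [hk1, ha3, ha4]), htr]
      linear_combination t ^ 2 * hθ
    have h2 : D.κ₂ * z / (1 - D.κ₂ * z) * (D.κ₂ * (D.a₁ * t * (D.a₂ * t)) - D.q * (c₀ + d₀)
        + D.q ^ 2 * D.κ₁ * (D.a₃ * D.a₄)) =
        -(D.κ₂ * (D.a₁ * t * (D.a₂ * t))) + D.q ^ 2 * D.κ₁ * (m * (D.a₃ * D.a₄))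
          - D.q ^ 2 * D.κ₁ * m * (y * ξ) + D.κ₂ * (y * η) := by
      rw [div_mul_eq_mul_div, div_eq_iff hm', hc0, ← hmdef]
      have : m * D.q * d₀ = D.κ₂ * (D.a₁ * t * (D.a₂ * t) - (1 - m) * (y * η)) := by
        rw [hmdef] at hd0 ⊢
        linear_combination D.κ₂ * hd0
      linear_combination -this
    rw [ζ, h1, h2, div_eq_iff hκ']
    linear_combination D.q ^ 2 * D.κ₁ * y * hrel
      + D.q ^ 2 * D.κ₁ * (y - D.a₃) * (y - D.a₄) * hmdef
  have hζ2 : D.ζ t y z = y * (m * (y + ξ - (D.a₃ + D.a₄))) := by rw [hζ, hrel]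
  have eD3 : D.κ₂ * y * z * (D.a₃ - y) + D.ζ t y z = m * y * (ξ - D.a₄) := by
    rw [hζ2, hmdef]; ring
  have eD4 : D.κ₂ * y * z * (D.a₄ - y) + D.ζ t y z = m * y * (ξ - D.a₃) := by
    rw [hζ2, hmdef]; ring
  have eN1 : y * (D.a₁ * t - y) + D.ζ t y z = y * (η - D.a₂ * t) := by rw [hζ]; ring
  have eN2 : y * (D.a₂ * t - y) + D.ζ t y z = y * (η - D.a₁ * t) := by rw [hζ]; ring
  rw [eD3] at hD3
  rw [eD4] at hD4
  have hy0 : y ≠ 0 := right_ne_zero_of_mul (left_ne_zero_of_mul hD3)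
  have hξ4 : ξ - D.a₄ ≠ 0 := right_ne_zero_of_mul hD3
  have hξ3 : ξ - D.a₃ ≠ 0 := right_ne_zero_of_mul hD4
  have hzN : D.zNext t y z = (η - D.a₁ * t) * (η - D.a₂ * t) /
      (D.q ^ 2 * D.κ₁ * m * ((ξ - D.a₃) * (ξ - D.a₄))) := by
    rw [zNext, eD3, eD4, eN1, eN2, hmdef]
    rw [hmdef] at hm0
    field_simp
  have hQ34 : (ξ - D.a₃) * (ξ - D.a₄) ≠ 0 := mul_ne_zero hξ3 hξ4
  -- evaluation of the cubic identity
  have hcη := hcub η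
  have hcξ := hcub ξ
  have hcy := hcub y'
  -- For `η ≠ ξ` the difference of the identities at `η` and `ξ` can be divided by `η - ξ`. For `η =
  -- ξ` they only give `y' = η`, and the linear coefficient is used instead, obtained from the
  -- values at `η ± 1`.
  have hKval : K = m * ((ξ - D.a₃) * (ξ - D.a₄)) - (η - D.a₁ * t) * (η - D.a₂ * t) := by
    by_cases hηξ : η = ξ
    · subst hηξ
      have hy' : y' = η := by
        have : K * (η - y') = 0 := by linear_combination hcη
        exact (sub_eq_zero.1 ((mul_eq_zero.1 this).resolve_left hK0)).symm
      have h1 := hcub (η + 1)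
      have h2 := hcub (η - 1)
      rw [hy'] at h1 h2
      linear_combination (1 / 2) * h1 - (1 / 2) * h2
    · have : (η - ξ) * (K - (m * ((ξ - D.a₃) * (ξ - D.a₄)) - (η - D.a₁ * t) * (η - D.a₂ * t)))
          = 0 := by
        linear_combination hcη - hcξ
      exact sub_eq_zero.1 ((mul_eq_zero.1 this).resolve_left (sub_ne_zero.2 hηξ))
  have hA' : (D.q * D.κ₁ * y' ^ 2 + c₁ * y' + c₀) * (y' - η) =
      D.q * D.κ₁ * ((y' - D.a₁ * t) * (y' - D.a₂ * t) * (y' - ξ)) := by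
    rw [hB11]
    linear_combination -D.q * D.κ₁ * hcy
  have hzz : z' * (D.q ^ 2 * D.κ₁ * m * ((ξ - D.a₃) * (ξ - D.a₄))) =
      (η - D.a₁ * t) * (η - D.a₂ * t) := by
    by_cases hηξ : η = ξ
    · have hy' : y' = η := by
        have : K * (η - y') = 0 := by rw [← hηξ] at hcη; linear_combination hcη
        exact (sub_eq_zero.1 ((mul_eq_zero.1 this).resolve_left hK0)).symm
      have h1 := hz'
      rw [hB11, hy', ← hηξ] at h1
      rw [← hηξ]
      linear_combination h1
    -- Eliminating `K` between the values at `η` and `ξ` gives the ratio of `y' - η` to `y' - ξ`;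
    -- the value at `y'`, with the definition of `z'`, gives the same ratio as `q² κ₁ z'`. If `y' =
    -- η`, both sides of the goal vanish instead.
    · have hyξ : y' - ξ ≠ 0 := by
        intro h
        have h1 : m * ((ξ - D.a₃) * (ξ - D.a₄)) * (ξ - η) = 0 := by
          linear_combination -hcξ - K * h
        exact (mul_ne_zero (mul_ne_zero hm0 hQ34) (sub_ne_zero.2 (Ne.symm hηξ))) h1
      have h1 : m * ((ξ - D.a₃) * (ξ - D.a₄)) * (y' - η) =
          (η - D.a₁ * t) * (η - D.a₂ * t) * (y' - ξ) := by
        refine mul_left_cancel₀ (sub_ne_zero.2 hηξ) ?_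
        linear_combination (ξ - y') * hcη - (η - y') * hcξ
      by_cases hyη : y' - η = 0
      · have h2 : (η - D.a₁ * t) * (η - D.a₂ * t) = 0 := by
          have : (η - D.a₁ * t) * (η - D.a₂ * t) * (y' - ξ) = 0 := by rw [← h1, hyη, mul_zero]
          exact (mul_eq_zero.1 this).resolve_right hyξ
        have h3 : z' = 0 := by
          have h4 : z' * (D.q * (D.q * D.κ₁ * y' ^ 2 + c₁ * y' + c₀)) = 0 := by
            rw [hz', sub_eq_zero.1 hyη, h2]
          exact (mul_eq_zero.1 h4).resolve_right (mul_ne_zero hq hv')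
        rw [h3, h2, zero_mul]
      · have h5 : z' * (D.q ^ 2 * D.κ₁) * (y' - ξ) = y' - η := by
          refine mul_left_cancel₀ hv' ?_
          have hne : D.q * D.κ₁ * ((y' - D.a₁ * t) * (y' - D.a₂ * t) * (y' - ξ)) ≠ 0 := by
            rw [← hA']; exact mul_ne_zero hv' hyη
          linear_combination D.q * D.κ₁ * (y' - ξ) * hz' - hA'
        refine mul_right_cancel₀ hyξ ?_
        linear_combination m * ((ξ - D.a₃) * (ξ - D.a₄)) * h5 + h1
  have hzfin : z' = D.zNext t y z := by
    rw [hzN, eq_div_iff (mul_ne_zero (mul_ne_zero (mul_ne_zero (pow_ne_zero 2 hq) hk1) hm0) hQ34),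
      hzz]
  refine ⟨hzfin, ?_⟩
  rw [← hzfin] at hZ1
  have hZ1' : 1 - D.q ^ 2 * D.κ₁ * z' ≠ 0 := sub_ne_zero.2 (Ne.symm hZ1)
  have hK2 : K = m * ((ξ - D.a₃) * (ξ - D.a₄)) * (1 - D.q ^ 2 * D.κ₁ * z') := by
    linear_combination hKval + hzz
  -- the factors of `yNext`
  have hF : ∀ θ : ℂ, D.ζ t y z - (y - D.a₁ * t) * (y - D.a₂ * t)
      + z * (D.q * θ * t - D.κ₂ * D.a₁ * D.a₂ * t ^ 2) / (1 - D.κ₂ * z) =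
      D.q * z * (θ * t - d₀) / (1 - m) := by
    intro θ
    rw [hζ, ← hmdef, eq_div_iff hm1, add_mul, div_mul_cancel₀ _ hm1]
    linear_combination hd0 + D.a₁ * t * (D.a₂ * t) * hmdef
  -- The determinant and the trace at `x = 0`: the characteristic polynomial evaluated at the
  -- diagonal entry `d₀` is the off-diagonal product. This is the only place where the value of `y'`
  -- is extracted.
  have hFF : (D.θ₁ * t - d₀) * (D.θ₂ * t - d₀) = w * y * y' := by
    linear_combination t ^ 2 * hθ - hdet 0 + d₀ * htr
  rw [yNext, ← hzfin, eD3, eD4, hF, hF]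
  have hw' : w = K * (D.κ₁ * (1 - m)) / z := by rw [hK', mul_div_cancel_right₀ _ hz0]
  have e : D.κ₂ * y * (1 - D.κ₂ * z) / (D.q ^ 2 * D.κ₁ * (1 - D.q ^ 2 * D.κ₁ * z')) *
      (D.q * z * (D.θ₁ * t - d₀) / (1 - m) / (m * y * (ξ - D.a₄))) *
      (D.q * z * (D.θ₂ * t - d₀) / (1 - m) / (m * y * (ξ - D.a₃))) =
      D.κ₂ * y * (1 - D.κ₂ * z) * (D.q * z) ^ 2 * ((D.θ₁ * t - d₀) * (D.θ₂ * t - d₀)) /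
      ((D.q ^ 2 * D.κ₁ * (1 - D.q ^ 2 * D.κ₁ * z')) * (1 - m) ^ 2 * (m * y) ^ 2 *
        ((ξ - D.a₃) * (ξ - D.a₄))) := by
    field_simp
  rw [e, hFF, hw', hK2, ← hmdef, eq_div_iff]
  · rw [hmdef] at hm1 ⊢
    field_simp
  · simp [hq, hk1, hZ1', hm1, hm0, hy0, hξ3, hξ4]

end Param
end QP6
end

/-! ### The shift of the natural coordinates and of the parameters. -/

noncomputable section

namespace QOrth.WeightData

variable {J : WeightData} {p : ℕ → ℂ[X]}

theorem eval_eq_quadratic {g : ℂ[X]} (hg : g.natDegree ≤ 2) (x : ℂ) :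
    g.eval x = g.coeff 2 * x ^ 2 + g.coeff 1 * x + g.coeff 0 := by
  rw [eval_eq_sum_range' (n := 3) (by omega)]
  simp only [Finset.sum_range_succ, Finset.sum_range_zero]
  ring

theorem eval_eq_linear {g : ℂ[X]} (hg : g.natDegree ≤ 1) (x : ℂ) :
    g.eval x = g.coeff 1 * x + g.coeff 0 := by
  rw [eval_eq_sum_range' (n := 2) (by omega)]
  simp only [Finset.sum_range_succ, Finset.sum_range_zero]
  ring

theorem charpoly_A_zero (hp : J.IsOrthonormal p) {Λ : ℂ[X] →ₗ[ℂ] ℂ} (hΛ : ∀ g, J.L g = Λ g)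
    (hq : J.q ≠ 1) (n : ℕ) : ((J.A p n).map (Polynomial.eval 0)).charpoly =
      (X - C (J.G.eval 0)) * (X - C (J.H.eval 0)) := by
  have htr : (J.A p n 0 0).eval 0 + (J.A p n 1 1).eval 0 = J.G.eval 0 + J.H.eval 0 := by
    cases n with
    | zero => rw [A_zero_zero hp hΛ hq]; rfl
    | succ n => exact trace_A_succ_zero hp hΛ hq n
  have hdet : (J.A p n 0 0).eval 0 * (J.A p n 1 1).eval 0
      - (J.A p n 0 1).eval 0 * (J.A p n 1 0).eval 0 = J.G.eval 0 * J.H.eval 0 := by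
    cases n with
    | zero =>
      rw [A_zero_zero hp hΛ hq]
      change J.G.eval 0 * J.H.eval 0 - _ * (0 : ℂ[X]).eval 0 = _
      simp
    | succ n => rw [← eval_mul, ← eval_mul, ← eval_sub, det_A_succ hp hΛ hq n, eval_mul]
  rw [Matrix.charpoly_fin_two, Matrix.trace_fin_two, Matrix.det_fin_two]
  simp only [Matrix.map_apply]
  rw [htr, hdet]
  simp only [C_add, C_mul]
  ring

theorem Admissible.cpow_ne_zero (hJ : J.Admissible) : J.q ^ J.σ ≠ 0 := by
  rw [Complex.cpow_def_of_ne_zero hJ.q_ne_zero]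
  exact Complex.exp_ne_zero _

theorem Admissible.param_admissible (hJ : J.Admissible) (n : ℕ) :
    (J.param (J.q ^ J.σ * J.a₁ * J.a₂ * J.a₃ * J.a₄) (J.a₁ * J.a₂ * J.a₃ * J.a₄) n).Admissible := by
  have hq := hJ.q_ne_zero
  have hc := hJ.cpow_ne_zero
  have ha₁ := hJ.ha₁
  have ha₂ := hJ.ha₂
  have ha₃ := hJ.ha₃
  have ha₄ := hJ.ha₄
  have hn : J.q ^ n ≠ 0 := pow_ne_zero _ hq
  refine ⟨hq, ha₁, ha₂, ha₃, ha₄, ?_, ?_, ?_, ?_, ?_⟩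
  · simp [param, κ₁, *]
  · simp [param, κ₂, *]
  · simp [param, *]
  · simp [param, *]
  · simp only [QP6.Param.a₅, QP6.Param.a₆, QP6.Param.a₇, QP6.Param.a₈, param, κ₁, κ₂]
    generalize J.q ^ n = Q at *
    generalize J.q ^ J.σ = S at *
    field_simp

theorem param_succ (hq : J.q ≠ 0) (θ₁ θ₂ : ℂ) (n : ℕ) :
    J.param θ₁ θ₂ (n + 1) = (J.param θ₁ θ₂ n).shift := by
  have h1 : J.κ₁ (n + 1) = J.q * J.κ₁ n := by simp only [κ₁]; ring
  have h2 : J.κ₂ (n + 1) = J.κ₂ n / J.q := by simp only [κ₂, pow_succ]; field_simp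
  simp only [param, QP6.Param.shift, h1, h2]

theorem κ₁_mul_κ₂ (hq : J.q ≠ 0) (n : ℕ) :
    J.κ₁ n * J.κ₂ n = J.q ^ J.σ * J.a₁ * J.a₂ * J.a₃ * J.a₄ := by
  have hn : J.q ^ n ≠ 0 := pow_ne_zero _ hq
  simp only [κ₁, κ₂]
  field_simp

/-- The shift `n → n + 1` of the natural coordinates. -/
theorem shift_coordinates (hJ : J.Admissible) (hp : J.IsOrthonormal p) (n : ℕ)
    (hn : J.HasCoordinates p n) (hn1 : J.HasCoordinates p (n + 1))
    (hS : (J.param (J.q ^ J.σ * J.a₁ * J.a₂ * J.a₃ * J.a₄) (J.a₁ * J.a₂ * J.a₃ * J.a₄)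
      n).ShiftDefined J.t (J.y p n) (J.z p n)) :
    J.z p (n + 1) = (J.param (J.q ^ J.σ * J.a₁ * J.a₂ * J.a₃ * J.a₄)
      (J.a₁ * J.a₂ * J.a₃ * J.a₄) n).zNext J.t (J.y p n) (J.z p n) ∧
    J.y p (n + 1) = (J.param (J.q ^ J.σ * J.a₁ * J.a₂ * J.a₃ * J.a₄)
      (J.a₁ * J.a₂ * J.a₃ * J.a₄) n).yNext J.t (J.y p n) (J.z p n) := by
  obtain ⟨Λ, hΛ, hP⟩ := hJ.exists_functional
  have hq := hJ.q_ne_zero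
  have hq1 := hJ.q_ne_one
  obtain ⟨hw, hv⟩ := hn
  obtain ⟨hw', hv'⟩ := hn1
  have ha := recA_ne_zero hp hΛ n
  have hΘ := natDegree_Θ_le hp hΛ hq1 hq hP n
  have hΘ' := natDegree_Θ_le hp hΛ hq1 hq hP (n + 1)
  obtain ⟨hd1, hl1⟩ := A_zero_zero_lead hp hΛ hq1 hq hP (n + 1)
  obtain ⟨hd0, hl0⟩ := A_zero_zero_lead hp hΛ hq1 hq hP n
  have hd2 : (J.A p (n + 1) 1 1).natDegree ≤ 2 := by
    rw [A_succ_one_one]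
    refine natDegree_add_le_of_degree_le hd0 ?_
    exact natDegree_mul_le_of_le (natDegree_X_sub_C_le _) hΘ
  have hκ1 : J.κ₁ (n + 1) = J.q * J.κ₁ n := by simp only [κ₁]; ring
  have hκ1ne : J.κ₁ n ≠ 0 := (hJ.param_admissible n).hκ₁
  have hy : ∀ x, (J.Θ p n).eval x = (J.A p n 0 1).coeff 1 * (x - J.y p n) := by
    intro x
    rw [y, eval_eq_linear hΘ, ← A_apply_zero_one]
    field_simp
    ring
  have hy' : ∀ x, (J.Θ p (n + 1)).eval x =
      (J.A p (n + 1) 0 1).coeff 1 * (x - J.y p (n + 1)) := by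
    intro x
    rw [y, eval_eq_linear hΘ', ← A_apply_zero_one]
    field_simp
    ring
  have hdet : ∀ x, (J.A p (n + 1) 0 0).eval x * (J.A p (n + 1) 1 1).eval x
      + recA p n ^ 2 * (J.A p n 0 1).coeff 1 * (J.A p (n + 1) 0 1).coeff 1 *
        (x - J.y p n) * (x - J.y p (n + 1)) = J.κ₁ n * J.κ₂ n *
        (x - J.a₁ * J.t) * (x - J.a₂ * J.t) * (x - J.a₃) * (x - J.a₄) := by
    intro x
    have h := congrArg (eval x) (det_A_succ hp hΛ hq1 n)
    rw [A_apply_zero_one, A_succ_one_zero] at h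
    simp only [eval_sub, eval_mul, eval_neg, eval_C, hy, hy', eval_G, eval_H] at h
    rw [κ₁_mul_κ₂ hq]
    linear_combination h
  -- Read off from the coefficient of `x⁴` in the determinant, to which the off-diagonal product, of
  -- degree at most two, does not contribute.
  have hl2 : (J.A p (n + 1) 1 1).coeff 2 = J.κ₂ n / J.q := by
    have h := congrArg (fun g : ℂ[X] => g.coeff (2 + 2)) (det_A_succ hp hΛ hq1 n)
    have h1 : (J.A p (n + 1) 0 1 * J.A p (n + 1) 1 0).coeff (2 + 2) = 0 := by
      rw [A_apply_zero_one, A_succ_one_zero]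
      refine coeff_eq_zero_of_natDegree_lt ?_
      refine (natDegree_mul_le_of_le hΘ' (n := 1) ?_).trans_lt (by norm_num)
      rw [natDegree_neg]
      exact (natDegree_C_mul_le _ _).trans hΘ
    have hquad : ∀ a b c : ℂ, (C a * (X - C b) * (X - C c) : ℂ[X]).coeff 2 = a := by
      intro a b c
      have : (C a * (X - C b) * (X - C c) : ℂ[X]) =
          C a * X ^ 2 + C (-a * (b + c)) * X + C (a * b * c) := by
        simp only [C_mul, C_add, C_neg]; ring
      rw [this, coeff_add, coeff_add, coeff_C_mul, coeff_C_mul, coeff_C, coeff_X_pow, coeff_X]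
      simp
    simp only [coeff_sub, h1, coeff_mul_add_eq_of_natDegree_le hd1 hd2,
      coeff_mul_add_eq_of_natDegree_le (natDegree_G_le J) (natDegree_H_le J)] at h
    rw [G, H, hquad, hquad, hl1, hκ1] at h
    rw [eq_div_iff hq]
    refine mul_left_cancel₀ hκ1ne ?_
    rw [κ₁_mul_κ₂ hq]
    linear_combination h
  -- The two entries differ by a multiple of `Θ n`, which vanishes at `y n`. This links the second
  -- row of `A (n+1)` to the coordinate `z n`.
  have h22y : (J.A p (n + 1) 1 1).eval (J.y p n) = (J.A p n 0 0).eval (J.y p n) := by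
    rw [A_succ_one_one, eval_add, eval_mul, hy, sub_self]
    ring
  refine QP6.Param.shift_of_det (hJ.param_admissible n) (t := J.t)
    (c₁ := (J.A p (n + 1) 0 0).coeff 1) (c₀ := (J.A p (n + 1) 0 0).coeff 0)
    (d₁ := (J.A p (n + 1) 1 1).coeff 1) (d₀ := (J.A p (n + 1) 1 1).coeff 0)
    (w := recA p n ^ 2 * (J.A p n 0 1).coeff 1 * (J.A p (n + 1) 0 1).coeff 1)
    (mul_ne_zero (mul_ne_zero (pow_ne_zero 2 ha) hw) hw') ?_ ?_ ?_ ?_ ?_ ?_ hS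
  · intro x
    have h := hdet x
    rw [eval_eq_quadratic hd1, eval_eq_quadratic hd2, hl1, hl2, hκ1] at h
    exact h
  · have h := trace_A_succ_zero hp hΛ hq1 n
    rw [← coeff_zero_eq_eval_zero, ← coeff_zero_eq_eval_zero, eval_G, eval_H] at h
    rw [h]
    simp only [param]
    ring
  · have h := eval_eq_quadratic hd2 (J.y p n)
    rw [h22y, hl2] at h
    simp only [param]
    rw [← h]
    exact hv
  · have h := eval_eq_quadratic hd2 (J.y p n)
    rw [h22y, hl2] at h
    simp only [param]
    rw [← h, z, div_mul_cancel₀ _ (mul_ne_zero hq hv)]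
  · have h := eval_eq_quadratic hd1 (J.y p (n + 1))
    rw [hl1, hκ1] at h
    simp only [param]
    rw [← h]
    exact hv'
  · have h := eval_eq_quadratic hd1 (J.y p (n + 1))
    rw [hl1, hκ1] at h
    simp only [param]
    rw [← h, z, div_mul_cancel₀ _ (mul_ne_zero hq hv')]

theorem orthogonal_polynomial_shift (hJ : J.Admissible) (hp : J.IsOrthonormal p) :
    ∃ θ₁ θ₂ : ℂ,
      (∀ n : ℕ, ((J.A p n).map (Polynomial.eval 0)).charpoly =
        (X - C (θ₁ * J.t)) * (X - C (θ₂ * J.t))) ∧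
      ∀ n : ℕ, (J.param θ₁ θ₂ n).Admissible ∧
        J.param θ₁ θ₂ (n + 1) = (J.param θ₁ θ₂ n).shift ∧
        (J.HasCoordinates p n → J.HasCoordinates p (n + 1) →
          (J.param θ₁ θ₂ n).ShiftDefined J.t (J.y p n) (J.z p n) →
            J.z p (n + 1) = (J.param θ₁ θ₂ n).zNext J.t (J.y p n) (J.z p n) ∧
            J.y p (n + 1) = (J.param θ₁ θ₂ n).yNext J.t (J.y p n) (J.z p n)) := by
  obtain ⟨Λ, hΛ, -⟩ := hJ.exists_functional
  -- The eigenvalues are `G(0)` and `H(0)`; these are their values divided by `t`.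
  refine ⟨J.q ^ J.σ * J.a₁ * J.a₂ * J.a₃ * J.a₄, J.a₁ * J.a₂ * J.a₃ * J.a₄, fun n => ?_,
    fun n => ⟨hJ.param_admissible n, param_succ hJ.q_ne_zero _ _ n, shift_coordinates hJ hp n⟩⟩
  rw [charpoly_A_zero hp hΛ hJ.q_ne_one, eval_G, eval_H]
  congr 3 <;> ring

end QOrth.WeightData

namespace QP6.Param

theorem Admissible.shift {D : Param} (hD : D.Admissible) : D.shift.Admissible := by
  have hθ := prod_θ hD
  obtain ⟨hq, h1, h2, h3, h4, hk1, hk2, ht1, ht2, h⟩ := hD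
  refine ⟨hq, h1, h2, h3, h4, mul_ne_zero hq hk1, div_ne_zero hk2 hq, ht1, ht2, ?_⟩
  refine Eq.trans ?_ h
  simp only [a₅, a₆, a₇, a₈, Param.shift]
  field_simp

theorem shift_a₇ (D : Param) : D.shift.a₇ = D.a₇ / D.q := by
  simp only [a₇, Param.shift]
  rw [div_div]
  ring_nf

theorem shift_a₈ (D : Param) : D.shift.a₈ = D.q * D.a₈ := by
  simp only [a₈, Param.shift]
  rw [one_div_div]
  ring

end QP6.Param
end

/-! ### The simple reflections as birational maps at points in general position. -/

noncomputable section

namespace QP6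

theorem rootVariable_act (i j : Fin 6) (c : Config) (hb : ∀ k, c.b k ≠ 0) :
    rootVariable j (act i c) = rootVariable j c * rootVariable i c ^ (-cartan j i) := by
  have h0 := hb 0
  have h1 := hb 1
  have h2 := hb 2
  have h3 := hb 3
  have h4 := hb 4
  have h5 := hb 5
  have h6 := hb 6
  have h7 := hb 7
  fin_cases i <;> fin_cases j <;>
    simp [rootVariable, act, cartan, Equiv.swap_apply_def, zpow_ofNat, zpow_neg] <;> field_simp

/-! ### Generic properties -/

/-- The coordinates of a configuration. -/
def Config.coords (c : Config) : Fin 8 ⊕ Fin 2 → ℂ := Sum.elim c.b ![c.y, c.z]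

theorem Generically.mono {Q R : Config → Prop} (h : Generically Q) (hQR : ∀ c, Q c → R c) :
    Generically R := by
  obtain ⟨P, hP, h⟩ := h
  exact ⟨P, hP, fun c hc => hQR c (h c hc)⟩

theorem Generically.and {Q R : Config → Prop} (hQ : Generically Q) (hR : Generically R) :
    Generically fun c => Q c ∧ R c := by
  obtain ⟨P, hP, hQ⟩ := hQ
  obtain ⟨P', hP', hR⟩ := hR
  refine ⟨P * P', mul_ne_zero hP hP', fun c hc => ?_⟩
  rw [map_mul] at hc
  exact ⟨hQ c (left_ne_zero_of_mul hc), hR c (right_ne_zero_of_mul hc)⟩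

/-- A polynomial expression that is non-zero at one configuration is generically non-zero. -/
theorem generically_ne_zero {f : Config → ℂ} (P : MvPolynomial (Fin 8 ⊕ Fin 2) ℂ)
    (hf : ∀ c : Config, MvPolynomial.eval c.coords P = f c) (c₀ : Config) (h₀ : f c₀ ≠ 0) :
    Generically fun c => f c ≠ 0 := by
  refine ⟨P, fun h => h₀ ?_, fun c hc => ?_⟩
  · rw [← hf, h, map_zero]
  · change f c ≠ 0
    rw [← hf]
    exact hc

/-- The base points and the point `(y, z)` are in general position. -/
structure Config.Nice (c : Config) : Prop where
  hb : ∀ k, c.b k ≠ 0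
  hy : ∀ k, c.y - c.b k ≠ 0
  hz : ∀ k, c.z - c.b k ≠ 0
  hy0 : c.y ≠ 0
  hz0 : c.z ≠ 0
  hN : c.y * (c.z - c.b 6) - c.b 2 * (c.z - c.b 4) ≠ 0
  hD : c.b 4 * c.y * (c.z - c.b 6) - c.b 0 * c.b 6 * (c.z - c.b 4) ≠ 0
  hN' : c.z * (c.y - c.b 2) - c.b 6 * (c.y - c.b 0) ≠ 0
  hD' : c.b 0 * c.z * (c.y - c.b 2) - c.b 4 * c.b 2 * (c.y - c.b 0) ≠ 0

theorem generically_forall {ι : Type*} [Fintype ι] {Q : ι → Config → Prop}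
    (h : ∀ i, Generically (Q i)) : Generically fun c => ∀ i, Q i c := by
  choose P hP hQ using h
  refine ⟨∏ i, P i, Finset.prod_ne_zero_iff.2 fun i _ => hP i, fun c hc i => hQ i c ?_⟩
  rw [map_prod] at hc
  exact Finset.prod_ne_zero_iff.1 hc i (Finset.mem_univ i)

/-- The polynomial giving the parameter `b k`. -/
abbrev polyB (k : Fin 8) : MvPolynomial (Fin 8 ⊕ Fin 2) ℂ := MvPolynomial.X (Sum.inl k)

/-- The polynomial giving the coordinate `y`. -/
abbrev polyY : MvPolynomial (Fin 8 ⊕ Fin 2) ℂ := MvPolynomial.X (Sum.inr 0)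

/-- The polynomial giving the coordinate `z`. -/
abbrev polyZ : MvPolynomial (Fin 8 ⊕ Fin 2) ℂ := MvPolynomial.X (Sum.inr 1)

/-- A configuration in general position. -/
def samplePoint : Config := ⟨![1, 2, 3, 5, 7, 11, 13, 17], 19, 23⟩

theorem generically_nice : Generically Config.Nice := by
  have hb : Generically fun c => ∀ k, c.b k ≠ 0 := generically_forall fun k =>
    generically_ne_zero (polyB k) (fun c => by simp [Config.coords]) samplePoint
      (by fin_cases k <;> simp [samplePoint])
  have hy : Generically fun c => ∀ k, c.y - c.b k ≠ 0 := generically_forall fun k =>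
    generically_ne_zero (polyY - polyB k) (fun c => by simp [Config.coords]) samplePoint
      (by fin_cases k <;> norm_num [samplePoint])
  have hz : Generically fun c => ∀ k, c.z - c.b k ≠ 0 := generically_forall fun k =>
    generically_ne_zero (polyZ - polyB k) (fun c => by simp [Config.coords]) samplePoint
      (by fin_cases k <;> norm_num [samplePoint])
  have hy0 : Generically fun c => c.y ≠ 0 :=
    generically_ne_zero polyY (fun c => by simp [Config.coords]) samplePoint
      (by norm_num [samplePoint])
  have hz0 : Generically fun c => c.z ≠ 0 :=
    generically_ne_zero polyZ (fun c => by simp [Config.coords]) samplePoint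
      (by norm_num [samplePoint])
  have hN : Generically fun c => c.y * (c.z - c.b 6) - c.b 2 * (c.z - c.b 4) ≠ 0 :=
    generically_ne_zero (polyY * (polyZ - polyB 6) - polyB 2 * (polyZ - polyB 4))
      (fun c => by simp [Config.coords]) samplePoint (by simp [samplePoint]; norm_num)
  have hD : Generically fun c =>
      c.b 4 * c.y * (c.z - c.b 6) - c.b 0 * c.b 6 * (c.z - c.b 4) ≠ 0 :=
    generically_ne_zero
      (polyB 4 * polyY * (polyZ - polyB 6) - polyB 0 * polyB 6 * (polyZ - polyB 4))
      (fun c => by simp [Config.coords]) samplePoint (by simp [samplePoint]; norm_num)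
  have hN' : Generically fun c => c.z * (c.y - c.b 2) - c.b 6 * (c.y - c.b 0) ≠ 0 :=
    generically_ne_zero (polyZ * (polyY - polyB 2) - polyB 6 * (polyY - polyB 0))
      (fun c => by simp [Config.coords]) samplePoint (by simp [samplePoint]; norm_num)
  have hD' : Generically fun c =>
      c.b 0 * c.z * (c.y - c.b 2) - c.b 4 * c.b 2 * (c.y - c.b 0) ≠ 0 :=
    generically_ne_zero
      (polyB 0 * polyZ * (polyY - polyB 2) - polyB 4 * polyB 2 * (polyY - polyB 0))
      (fun c => by simp [Config.coords]) samplePoint (by simp [samplePoint]; norm_num)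
  refine (hb.and (hy.and (hz.and (hy0.and (hz0.and (hN.and (hD.and (hN'.and hD')))))))).mono ?_
  rintro c ⟨h1, h2, h3, h4, h5, h6, h7, h8, h9⟩
  exact ⟨h1, h2, h3, h4, h5, h6, h7, h8, h9⟩

theorem act_two_act_two {c : Config} (h0 : c.b 0 ≠ 0) (h2 : c.b 2 ≠ 0) (y0 : c.y - c.b 0 ≠ 0)
    (y2 : c.y - c.b 2 ≠ 0) : act 2 (act 2 c) = c := by
  obtain ⟨b, y, z⟩ := c
  dsimp only at *
  refine Config.ext (funext fun k => ?_) ?_ ?_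
  · fin_cases k <;> simp [act] <;> field_simp
  · simp [act]
  · simp [act]
    field_simp

theorem act_three_act_three {c : Config} (h4 : c.b 4 ≠ 0) (h6 : c.b 6 ≠ 0)
    (z4 : c.z - c.b 4 ≠ 0) (z6 : c.z - c.b 6 ≠ 0) : act 3 (act 3 c) = c := by
  obtain ⟨b, y, z⟩ := c
  dsimp only at *
  refine Config.ext (funext fun k => ?_) ?_ ?_
  · fin_cases k <;> simp [act] <;> field_simp
  · simp [act]
    field_simp
  · simp [act]

theorem act_swap_act_swap {i : Fin 6} (h2 : i ≠ 2) (h3 : i ≠ 3) (c : Config) :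
    act i (act i c) = c := by
  refine Config.ext (funext fun k => ?_) ?_ ?_ <;> fin_cases i <;> simp_all [act]

theorem Config.Nice.act_act {c : Config} (hc : c.Nice) (i : Fin 6) : act i (act i c) = c := by
  by_cases h2 : i = 2
  · subst h2
    exact act_two_act_two (hc.hb 0) (hc.hb 2) (hc.hy 0) (hc.hy 2)
  by_cases h3 : i = 3
  · subst h3
    exact act_three_act_three (hc.hb 4) (hc.hb 6) (hc.hz 4) (hc.hz 6)
  exact act_swap_act_swap h2 h3 c

/-- The reflection in the root `α₂ + α₃`. -/
def sigma (c : Config) : Config :=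
  ⟨![c.b 0, c.b 1 * (c.b 0 * c.b 6 / (c.b 2 * c.b 4)), c.b 0 * c.b 6 / c.b 4, c.b 3, c.b 4,
      c.b 5 * (c.b 2 * c.b 4 / (c.b 0 * c.b 6)), c.b 2 * c.b 4 / c.b 0, c.b 7],
    c.y * (c.b 0 * (c.z * (c.y - c.b 2) - c.b 6 * (c.y - c.b 0)) /
      (c.b 0 * c.z * (c.y - c.b 2) - c.b 4 * c.b 2 * (c.y - c.b 0))),
    c.z * (c.b 4 * (c.y * (c.z - c.b 6) - c.b 2 * (c.z - c.b 4)) /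
      (c.b 4 * c.y * (c.z - c.b 6) - c.b 0 * c.b 6 * (c.z - c.b 4)))⟩

/-- The differences that the next `s₂` divides and multiplies by, in factored form. The factors are
among those assumed non-zero in `Config.Nice`, so compositions can be simplified without expanding
them. The next three lemmas play the same role for the other partial compositions. -/
theorem act_three_sub {c : Config} (hc : c.Nice) :
    (act 3 c).y - (act 3 c).b 0 =
      (c.b 4 * c.y * (c.z - c.b 6) - c.b 0 * c.b 6 * (c.z - c.b 4)) /
        (c.b 4 * (c.z - c.b 4)) ∧
    (act 3 c).y - (act 3 c).b 2 =
      (c.y * (c.z - c.b 6) - c.b 2 * (c.z - c.b 4)) / (c.z - c.b 4) := by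
  obtain ⟨b, y, z⟩ := c
  obtain ⟨hb, hy, hz, hy0, hz0, hN, hD, hN', hD'⟩ := hc
  have h4 := hb 4
  have z4 := hz 4
  dsimp only at *
  constructor
  · simp [act]
    field_simp
  · simp [act]
    field_simp

theorem act_two_sub {c : Config} (hc : c.Nice) :
    (act 2 c).z - (act 2 c).b 4 =
      (c.b 0 * c.z * (c.y - c.b 2) - c.b 4 * c.b 2 * (c.y - c.b 0)) /
        (c.b 0 * (c.y - c.b 0)) ∧
    (act 2 c).z - (act 2 c).b 6 =
      (c.z * (c.y - c.b 2) - c.b 6 * (c.y - c.b 0)) / (c.y - c.b 0) := by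
  obtain ⟨b, y, z⟩ := c
  obtain ⟨hb, hy, hz, hy0, hz0, hN, hD, hN', hD'⟩ := hc
  have h0 := hb 0
  have y0 := hy 0
  dsimp only at *
  constructor
  · simp [act]
    field_simp
  · simp [act]
    field_simp

theorem act_two_act_three_sub {c : Config} (hc : c.Nice) :
    (act 2 (act 3 c)).z - (act 2 (act 3 c)).b 4 =
      c.b 4 * (c.z - c.b 6) * (c.b 0 * c.z * (c.y - c.b 2) - c.b 4 * c.b 2 * (c.y - c.b 0)) /
        (c.b 0 * (c.b 4 * c.y * (c.z - c.b 6) - c.b 0 * c.b 6 * (c.z - c.b 4))) ∧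
    (act 2 (act 3 c)).z - (act 2 (act 3 c)).b 6 =
      c.b 4 * (c.z - c.b 4) * (c.z * (c.y - c.b 2) - c.b 6 * (c.y - c.b 0)) /
        (c.b 4 * c.y * (c.z - c.b 6) - c.b 0 * c.b 6 * (c.z - c.b 4)) := by
  obtain ⟨e1, e2⟩ := act_three_sub hc
  have hz1 : (act 2 (act 3 c)).z = c.z * (((act 3 c).y - (act 3 c).b 2) /
      ((act 3 c).y - (act 3 c).b 0)) := rfl
  have hb4 : (act 2 (act 3 c)).b 4 = c.b 6 * (c.b 2 / (c.b 0 * (c.b 6 / c.b 4))) := rfl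
  have hb6 : (act 2 (act 3 c)).b 6 = c.b 4 := rfl
  rw [hz1, hb4, hb6, e1, e2]
  obtain ⟨b, y, z⟩ := c
  obtain ⟨hb, hy, hz, hy0, hz0, hN, hD, hN', hD'⟩ := hc
  have h0 := hb 0
  have h4 := hb 4
  have h6 := hb 6
  have z4 := hz 4
  dsimp only at *
  generalize hDe : b 4 * y * (z - b 6) - b 0 * b 6 * (z - b 4) = D at *
  generalize hDe' : b 0 * z * (y - b 2) - b 4 * b 2 * (y - b 0) = D' at *
  constructor
  · field_simp
    rw [← hDe, ← hDe']
    ring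
  · field_simp
    rw [← hDe]
    ring

theorem act_three_act_two_sub {c : Config} (hc : c.Nice) :
    (act 3 (act 2 c)).y - (act 3 (act 2 c)).b 0 =
      c.b 0 * (c.y - c.b 2) * (c.b 4 * c.y * (c.z - c.b 6) - c.b 0 * c.b 6 * (c.z - c.b 4)) /
        (c.b 4 * (c.b 0 * c.z * (c.y - c.b 2) - c.b 4 * c.b 2 * (c.y - c.b 0))) ∧
    (act 3 (act 2 c)).y - (act 3 (act 2 c)).b 2 =
      c.b 0 * (c.y - c.b 0) * (c.y * (c.z - c.b 6) - c.b 2 * (c.z - c.b 4)) /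
        (c.b 0 * c.z * (c.y - c.b 2) - c.b 4 * c.b 2 * (c.y - c.b 0)) := by
  obtain ⟨e1, e2⟩ := act_two_sub hc
  have hy1 : (act 3 (act 2 c)).y = c.y * (((act 2 c).z - (act 2 c).b 6) /
      ((act 2 c).z - (act 2 c).b 4)) := rfl
  have hb0 : (act 3 (act 2 c)).b 0 = c.b 2 * (c.b 6 / (c.b 4 * (c.b 2 / c.b 0))) := rfl
  have hb2 : (act 3 (act 2 c)).b 2 = c.b 0 := rfl
  rw [hy1, hb0, hb2, e1, e2]
  obtain ⟨b, y, z⟩ := c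
  obtain ⟨hb, hy, hz, hy0, hz0, hN, hD, hN', hD'⟩ := hc
  have h0 := hb 0
  have h2 := hb 2
  have h4 := hb 4
  have y0 := hy 0
  dsimp only at *
  generalize hDe : b 4 * y * (z - b 6) - b 0 * b 6 * (z - b 4) = D at *
  generalize hDe' : b 0 * z * (y - b 2) - b 4 * b 2 * (y - b 0) = D' at *
  constructor
  · field_simp
    rw [← hDe, ← hDe']
    ring
  · field_simp
    rw [← hDe']
    ring

/-- Both sides of the braid relation between `s₂` and `s₃` are compared with the explicit map
`sigma`, whose closed form is needed again for the commutation with the time step. -/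
theorem act_three_two_three {c : Config} (hc : c.Nice) : act 3 (act 2 (act 3 c)) = sigma c := by
  obtain ⟨e1, e2⟩ := act_three_sub hc
  obtain ⟨e3, e4⟩ := act_two_act_three_sub hc
  have hz1 : (act 3 (act 2 (act 3 c))).z = c.z * (((act 3 c).y - (act 3 c).b 2) /
      ((act 3 c).y - (act 3 c).b 0)) := rfl
  have hy1 : (act 3 (act 2 (act 3 c))).y = c.y * ((c.z - c.b 6) / (c.z - c.b 4)) *
      (((act 2 (act 3 c)).z - (act 2 (act 3 c)).b 6) /
      ((act 2 (act 3 c)).z - (act 2 (act 3 c)).b 4)) := rfl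
  rw [e1, e2] at hz1
  rw [e3, e4] at hy1
  obtain ⟨b, y, z⟩ := c
  obtain ⟨hb, hy, hz, hy0, hz0, hN, hD, hN', hD'⟩ := hc
  have h0 := hb 0
  have h2 := hb 2
  have h4 := hb 4
  have h5 := hb 5
  have h6 := hb 6
  have z4 := hz 4
  have z6 := hz 6
  dsimp only at *
  refine Config.ext (funext fun k => ?_) ?_ ?_
  · fin_cases k <;> simp [act, sigma] <;> field_simp; simp
  · rw [hy1, sigma]
    dsimp only
    generalize hDe : b 4 * y * (z - b 6) - b 0 * b 6 * (z - b 4) = D at *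
    generalize hDe' : b 0 * z * (y - b 2) - b 4 * b 2 * (y - b 0) = D' at *
    field_simp
  · rw [hz1, sigma]
    dsimp only
    generalize hDe : b 4 * y * (z - b 6) - b 0 * b 6 * (z - b 4) = D at *
    generalize hDe' : b 0 * z * (y - b 2) - b 4 * b 2 * (y - b 0) = D' at *
    field_simp

theorem act_two_three_two {c : Config} (hc : c.Nice) : act 2 (act 3 (act 2 c)) = sigma c := by
  obtain ⟨e1, e2⟩ := act_two_sub hc
  obtain ⟨e3, e4⟩ := act_three_act_two_sub hc
  have hy1 : (act 2 (act 3 (act 2 c))).y = c.y * (((act 2 c).z - (act 2 c).b 6) /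
      ((act 2 c).z - (act 2 c).b 4)) := rfl
  have hz1 : (act 2 (act 3 (act 2 c))).z = c.z * ((c.y - c.b 2) / (c.y - c.b 0)) *
      (((act 3 (act 2 c)).y - (act 3 (act 2 c)).b 2) /
      ((act 3 (act 2 c)).y - (act 3 (act 2 c)).b 0)) := rfl
  rw [e1, e2] at hy1
  rw [e3, e4] at hz1
  obtain ⟨b, y, z⟩ := c
  obtain ⟨hb, hy, hz, hy0, hz0, hN, hD, hN', hD'⟩ := hc
  have h0 := hb 0
  have h2 := hb 2
  have h4 := hb 4
  have h1 := hb 1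
  have h6 := hb 6
  have y0 := hy 0
  have y2 := hy 2
  dsimp only at *
  refine Config.ext (funext fun k => ?_) ?_ ?_
  · fin_cases k <;> simp [act, sigma] <;> field_simp; simp
  · rw [hy1, sigma]
    dsimp only
    generalize hDe : b 4 * y * (z - b 6) - b 0 * b 6 * (z - b 4) = D at *
    generalize hDe' : b 0 * z * (y - b 2) - b 4 * b 2 * (y - b 0) = D' at *
    field_simp
  · rw [hz1, sigma]
    dsimp only
    generalize hDe : b 4 * y * (z - b 6) - b 0 * b 6 * (z - b 4) = D at *
    generalize hDe' : b 0 * z * (y - b 2) - b 4 * b 2 * (y - b 0) = D' at *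
    field_simp

theorem act_comm {i j : Fin 6} (hij : cartan i j = 0) (c : Config) :
    act j (act i c) = act i (act j c) := by
  have h : ∀ {k l m : Fin 8}, m ≠ k → m ≠ l → Equiv.swap k l m = m := fun hk hl =>
    Equiv.swap_apply_of_ne_of_ne hk hl
  fin_cases i <;> fin_cases j <;> first
    | (exfalso; revert hij; decide)
    | (refine Config.ext (funext fun k => ?_) ?_ ?_ <;> [skip; simp [act, h]; simp [act, h]]
       fin_cases k <;> simp [act, Equiv.swap_apply_def])

theorem act_braid_zero_two {c : Config} (hc : c.Nice) :
    act 0 (act 2 (act 0 c)) = act 2 (act 0 (act 2 c)) := by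
  obtain ⟨b, y, z⟩ := c
  obtain ⟨hb, hy, hz, -, -, -, -, -, -⟩ := hc
  have h0 := hb 0
  have x0 := hy 0
  have h1 := hb 1
  have x1 := hy 1
  have h2 := hb 2
  have x2 := hy 2
  have h3 := hb 3
  have x3 := hy 3
  dsimp only at *
  refine Config.ext (funext fun k => ?_) ?_ ?_
  · fin_cases k <;> simp [act, Equiv.swap_apply_def] <;> field_simp
  · simp [act, Equiv.swap_apply_def]
  · simp [act, Equiv.swap_apply_def]
    field_simp

theorem act_braid_one_two {c : Config} (hc : c.Nice) :
    act 1 (act 2 (act 1 c)) = act 2 (act 1 (act 2 c)) := by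
  obtain ⟨b, y, z⟩ := c
  obtain ⟨hb, hy, hz, -, -, -, -, -, -⟩ := hc
  have h0 := hb 0
  have x0 := hy 0
  have h1 := hb 1
  have x1 := hy 1
  have h2 := hb 2
  have x2 := hy 2
  have h3 := hb 3
  have x3 := hy 3
  dsimp only at *
  refine Config.ext (funext fun k => ?_) ?_ ?_
  · fin_cases k <;> simp [act, Equiv.swap_apply_def] <;> field_simp
  · simp [act, Equiv.swap_apply_def]
  · simp [act, Equiv.swap_apply_def]
    field_simp

theorem act_braid_four_three {c : Config} (hc : c.Nice) :
    act 4 (act 3 (act 4 c)) = act 3 (act 4 (act 3 c)) := by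
  obtain ⟨b, y, z⟩ := c
  obtain ⟨hb, hy, hz, -, -, -, -, -, -⟩ := hc
  have h4 := hb 4
  have x4 := hz 4
  have h5 := hb 5
  have x5 := hz 5
  have h6 := hb 6
  have x6 := hz 6
  have h7 := hb 7
  have x7 := hz 7
  dsimp only at *
  refine Config.ext (funext fun k => ?_) ?_ ?_
  · fin_cases k <;> simp [act, Equiv.swap_apply_def] <;> field_simp
  · simp [act, Equiv.swap_apply_def]
    field_simp
  · simp [act, Equiv.swap_apply_def]

theorem act_braid_five_three {c : Config} (hc : c.Nice) :
    act 5 (act 3 (act 5 c)) = act 3 (act 5 (act 3 c)) := by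
  obtain ⟨b, y, z⟩ := c
  obtain ⟨hb, hy, hz, -, -, -, -, -, -⟩ := hc
  have h4 := hb 4
  have x4 := hz 4
  have h5 := hb 5
  have x5 := hz 5
  have h6 := hb 6
  have x6 := hz 6
  have h7 := hb 7
  have x7 := hz 7
  dsimp only at *
  refine Config.ext (funext fun k => ?_) ?_ ?_
  · fin_cases k <;> simp [act, Equiv.swap_apply_def] <;> field_simp
  · simp [act, Equiv.swap_apply_def]
    field_simp
  · simp [act, Equiv.swap_apply_def]

end QP6

end

noncomputable section

namespace QP6

/-! ### Pull-back of generic properties under birational maps -/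

theorem Config.exists_coords_eq (v : Fin 8 ⊕ Fin 2 → ℂ) : ∃ c : Config, c.coords = v := by
  refine ⟨⟨fun k => v (Sum.inl k), v (Sum.inr 0), v (Sum.inr 1)⟩, funext fun s => ?_⟩
  rcases s with k | k
  · rfl
  · fin_cases k <;> rfl

theorem exists_eval_ne_zero {P : MvPolynomial (Fin 8 ⊕ Fin 2) ℂ} (hP : P ≠ 0) :
    ∃ c : Config, MvPolynomial.eval c.coords P ≠ 0 := by
  by_contra! h
  refine hP (MvPolynomial.funext fun v => ?_)
  obtain ⟨c, rfl⟩ := Config.exists_coords_eq v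
  rw [h, map_zero]

/-- `f` is a rational function whose denominator is a power of `R`. -/
def IsRat (R : MvPolynomial (Fin 8 ⊕ Fin 2) ℂ) (f : Config → ℂ) : Prop :=
  ∃ (N : MvPolynomial (Fin 8 ⊕ Fin 2) ℂ) (n : ℕ), ∀ c : Config,
    MvPolynomial.eval c.coords R ≠ 0 →
      f c * MvPolynomial.eval c.coords R ^ n = MvPolynomial.eval c.coords N

namespace IsRat

variable {R : MvPolynomial (Fin 8 ⊕ Fin 2) ℂ} {f g : Config → ℂ}

theorem const (a : ℂ) : IsRat R fun _ => a :=
  ⟨MvPolynomial.C a, 0, fun c _ => by simp⟩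

theorem b (k : Fin 8) : IsRat R fun c => c.b k :=
  ⟨polyB k, 0, fun c _ => by simp [Config.coords]⟩

theorem y : IsRat R Config.y :=
  ⟨polyY, 0, fun c _ => by simp [Config.coords]⟩

theorem z : IsRat R Config.z :=
  ⟨polyZ, 0, fun c _ => by simp [Config.coords]⟩

theorem add (hf : IsRat R f) (hg : IsRat R g) : IsRat R fun c => f c + g c := by
  obtain ⟨N, n, hN⟩ := hf
  obtain ⟨M, m, hM⟩ := hg
  refine ⟨N * R ^ m + M * R ^ n, n + m, fun c hc => ?_⟩
  simp only [map_add, map_mul, map_pow, ← hN c hc, ← hM c hc]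
  ring

theorem mul (hf : IsRat R f) (hg : IsRat R g) : IsRat R fun c => f c * g c := by
  obtain ⟨N, n, hN⟩ := hf
  obtain ⟨M, m, hM⟩ := hg
  refine ⟨N * M, n + m, fun c hc => ?_⟩
  simp only [map_mul, ← hN c hc, ← hM c hc]
  ring

theorem sub (hf : IsRat R f) (hg : IsRat R g) : IsRat R fun c => f c - g c := by
  simpa [sub_eq_add_neg] using hf.add ((const (-1)).mul hg)

theorem inv (H : MvPolynomial (Fin 8 ⊕ Fin 2) ℂ)
    (h : ∀ c : Config, MvPolynomial.eval c.coords R = f c * MvPolynomial.eval c.coords H) :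
    IsRat R fun c => (f c)⁻¹ := by
  refine ⟨H, 1, fun c hc => ?_⟩
  have hf : f c ≠ 0 := left_ne_zero_of_mul (h c ▸ hc)
  rw [pow_one, h, inv_mul_cancel_left₀ hf]

theorem div (hf : IsRat R f) (H : MvPolynomial (Fin 8 ⊕ Fin 2) ℂ)
    (h : ∀ c : Config, MvPolynomial.eval c.coords R = g c * MvPolynomial.eval c.coords H) :
    IsRat R fun c => f c / g c := by
  simpa only [div_eq_mul_inv] using hf.mul (inv H h)

/-- The pull-back of a polynomial along a rational map is a polynomial numerator over a power of
`R`; this numerator describes the open set in the pull-back of a generic property. -/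
theorem eval {F : Config → Config} (hb : ∀ k, IsRat R fun c => (F c).b k)
    (hy : IsRat R fun c => (F c).y) (hz : IsRat R fun c => (F c).z)
    (P : MvPolynomial (Fin 8 ⊕ Fin 2) ℂ) :
    IsRat R fun c => MvPolynomial.eval (F c).coords P := by
  induction P using MvPolynomial.induction_on with
  | C a => simpa using const a
  | add P Q hP hQ => simpa using hP.add hQ
  | mul_X P s hP =>
    have : IsRat R fun c => (F c).coords s := by
      rcases s with k | k
      · exact hb k
      · fin_cases k
        · exact hy
        · exact hz
    simpa using hP.mul this

end IsRat

/-- Generic properties remain generic under composition with `F`. -/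
def IsDominant (F : Config → Config) : Prop :=
  ∀ Q : Config → Prop, Generically Q → Generically fun c => Q (F c)

theorem IsDominant.comp {F G : Config → Config} (hF : IsDominant F) (hG : IsDominant G) :
    IsDominant fun c => F (G c) :=
  fun Q hQ => hG _ (hF Q hQ)

/-- A rational map with a right inverse is dominant. -/
theorem isDominant_of_rightInverse {R : MvPolynomial (Fin 8 ⊕ Fin 2) ℂ} {F : Config → Config}
    (G : Config → Config) (hb : ∀ k, IsRat R fun c => (F c).b k)
    (hy : IsRat R fun c => (F c).y) (hz : IsRat R fun c => (F c).z)
    (hG : Generically fun d => MvPolynomial.eval (G d).coords R ≠ 0 ∧ F (G d) = d) :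
    IsDominant F := by
  rintro Q ⟨P, hP, hQ⟩
  obtain ⟨S, hS, hG⟩ := hG
  obtain ⟨N, n, hN⟩ := IsRat.eval hb hy hz P
  have hR0 : R ≠ 0 := by
    rintro rfl
    obtain ⟨d, hd⟩ := exists_eval_ne_zero hS
    exact (hG d hd).1 (map_zero _)
  have hN0 : N ≠ 0 := by
    rintro rfl
    -- If the numerator were zero, `P` would vanish on the image of `F`, which contains every point
    -- where `S ≠ 0`. Then `P * S` would vanish identically.
    refine mul_ne_zero hP hS (MvPolynomial.funext fun v => ?_)
    obtain ⟨d, rfl⟩ := Config.exists_coords_eq v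
    rw [map_mul, map_zero]
    by_cases hd : MvPolynomial.eval d.coords S = 0
    · rw [hd, mul_zero]
    obtain ⟨h1, h2⟩ := hG d hd
    have h3 := hN _ h1
    simp only [h2, map_zero] at h3
    rw [(mul_eq_zero.1 h3).resolve_right (pow_ne_zero _ h1), zero_mul]
  refine ⟨N * R, mul_ne_zero hN0 hR0, fun c hc => hQ _ ?_⟩
  change MvPolynomial.eval c.coords (N * R) ≠ 0 at hc
  rw [map_mul] at hc
  have := hN c (right_ne_zero_of_mul hc)
  rw [← this] at hc
  exact left_ne_zero_of_mul (left_ne_zero_of_mul hc)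

theorem isDominant_swap {i : Fin 6} (h2 : i ≠ 2) (h3 : i ≠ 3) : IsDominant (act i) := by
  refine isDominant_of_rightInverse (R := 1) (act i) (fun k => ?_) ?_ ?_
    ⟨1, one_ne_zero, fun d _ => ⟨by simp, act_swap_act_swap h2 h3 d⟩⟩
  · fin_cases i <;> first | exact IsRat.b _ | exact absurd rfl h2 | exact absurd rfl h3
  · fin_cases i <;> first | exact IsRat.y | exact absurd rfl h2 | exact absurd rfl h3
  · fin_cases i <;> first | exact IsRat.z | exact absurd rfl h2

theorem isDominant_act_two : IsDominant (act 2) := by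
  have h1 : ∀ c : Config, MvPolynomial.eval c.coords (polyB 0 * (polyY - polyB 0)) =
      c.b 0 * MvPolynomial.eval c.coords (polyY - polyB 0) := fun c => by simp [Config.coords]
  have h2 : ∀ c : Config, MvPolynomial.eval c.coords (polyB 0 * (polyY - polyB 0)) =
      (c.y - c.b 0) * MvPolynomial.eval c.coords (polyB 0) := fun c => by
    simp [Config.coords, mul_comm]
  have hr : IsRat (polyB 0 * (polyY - polyB 0)) fun c => c.b 2 / c.b 0 := (IsRat.b 2).div _ h1
  refine isDominant_of_rightInverse (R := polyB 0 * (polyY - polyB 0)) (act 2) (fun k => ?_)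
    IsRat.y (IsRat.z.mul ((IsRat.y.sub (IsRat.b 2)).div _ h2)) (generically_nice.mono fun d hd => ?_)
  · fin_cases k
    · exact IsRat.b 2
    · exact IsRat.b 1
    · exact IsRat.b 0
    · exact IsRat.b 3
    · exact (IsRat.b 4).mul hr
    · exact (IsRat.b 5).mul hr
    · exact IsRat.b 6
    · exact IsRat.b 7
  · refine ⟨?_, hd.act_act 2⟩
    have := mul_ne_zero (hd.hb 2) (hd.hy 2)
    simpa [Config.coords, act] using this

theorem isDominant_act_three : IsDominant (act 3) := by
  have h1 : ∀ c : Config, MvPolynomial.eval c.coords (polyB 4 * (polyZ - polyB 4)) =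
      c.b 4 * MvPolynomial.eval c.coords (polyZ - polyB 4) := fun c => by simp [Config.coords]
  have h2 : ∀ c : Config, MvPolynomial.eval c.coords (polyB 4 * (polyZ - polyB 4)) =
      (c.z - c.b 4) * MvPolynomial.eval c.coords (polyB 4) := fun c => by
    simp [Config.coords, mul_comm]
  have hr : IsRat (polyB 4 * (polyZ - polyB 4)) fun c => c.b 6 / c.b 4 := (IsRat.b 6).div _ h1
  refine isDominant_of_rightInverse (R := polyB 4 * (polyZ - polyB 4)) (act 3) (fun k => ?_)
    (IsRat.y.mul ((IsRat.z.sub (IsRat.b 6)).div _ h2)) IsRat.z (generically_nice.mono fun d hd => ?_)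
  · fin_cases k
    · exact (IsRat.b 0).mul hr
    · exact (IsRat.b 1).mul hr
    · exact IsRat.b 2
    · exact IsRat.b 3
    · exact IsRat.b 6
    · exact IsRat.b 5
    · exact IsRat.b 4
    · exact IsRat.b 7
  · refine ⟨?_, hd.act_act 3⟩
    have := mul_ne_zero (hd.hb 6) (hd.hz 6)
    simpa [Config.coords, act] using this

theorem isDominant_act (i : Fin 6) : IsDominant (act i) := by
  by_cases h2 : i = 2
  · subst h2
    exact isDominant_act_two
  by_cases h3 : i = 3
  · subst h3
    exact isDominant_act_three
  exact isDominant_swap h2 h3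

theorem actWord_append (v w : List (Fin 6)) (c : Config) :
    actWord (v ++ w) c = actWord w (actWord v c) :=
  List.foldl_append

theorem isDominant_actWord (w : List (Fin 6)) : IsDominant (actWord w) := by
  induction w with
  | nil => exact fun Q hQ => hQ
  | cons i w ih => exact ih.comp (isDominant_act i)

/-! ### Coxeter relations between words -/

/-- Two words have generically the same birational action. -/
def WordEquiv (v w : List (Fin 6)) : Prop := Generically fun c => actWord v c = actWord w c

namespace WordEquiv

theorem refl (w : List (Fin 6)) : WordEquiv w w := ⟨1, one_ne_zero, fun _ _ => rfl⟩

theorem trans {u v w : List (Fin 6)} (h : WordEquiv u v) (h' : WordEquiv v w) : WordEquiv u w :=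
  (Generically.and h h').mono fun _ hc => hc.1.trans hc.2

theorem append_left {v w : List (Fin 6)} (u : List (Fin 6)) (h : WordEquiv v w) :
    WordEquiv (u ++ v) (u ++ w) :=
  (isDominant_actWord u _ h).mono fun c hc => by
    rw [actWord_append, actWord_append, hc]

theorem append_right {v w : List (Fin 6)} (h : WordEquiv v w) (u : List (Fin 6)) :
    WordEquiv (v ++ u) (w ++ u) :=
  Generically.mono h fun c hc => by rw [actWord_append, actWord_append, hc]

theorem infix_congr {v w : List (Fin 6)} (h : WordEquiv v w) (u u' : List (Fin 6)) :
    WordEquiv (u ++ v ++ u') (u ++ w ++ u') :=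
  (h.append_left u).append_right u'

end WordEquiv

theorem wordEquiv_square (i : Fin 6) : WordEquiv [i, i] [] :=
  generically_nice.mono fun _ hc => hc.act_act i

theorem wordEquiv_comm {i j : Fin 6} (hij : cartan i j = 0) : WordEquiv [i, j] [j, i] :=
  generically_nice.mono fun c _ => act_comm hij c

theorem wordEquiv_braid {i j : Fin 6} (h : i ≠ j) (hij : cartan i j ≠ 0) :
    WordEquiv [i, j, i] [j, i, j] := by
  refine generically_nice.mono fun c hc => ?_
  change act i (act j (act i c)) = act j (act i (act j c))
  have h23 := (act_two_three_two hc).trans (act_three_two_three hc).symm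
  fin_cases i <;> fin_cases j <;> first
    | exact absurd rfl h
    | exact absurd rfl hij
    | exact act_braid_zero_two hc
    | exact (act_braid_zero_two hc).symm
    | exact act_braid_one_two hc
    | exact (act_braid_one_two hc).symm
    | exact act_braid_four_three hc
    | exact (act_braid_four_three hc).symm
    | exact act_braid_five_three hc
    | exact (act_braid_five_three hc).symm
    | exact h23
    | exact h23.symm

/-- The Coxeter relations. -/
theorem coxeter_relation (i j : Fin 6) : Generically fun c =>
    (fun c => act j (act i c))^[coxeterExponent i j] c = c := by
  unfold coxeterExponent
  split_ifs with h hij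
  · subst h
    exact wordEquiv_square i
  · have h1 : WordEquiv [i, j, i, j] [] :=
      ((wordEquiv_comm hij).append_right [i, j]).trans
        (((wordEquiv_square i).infix_congr [j] [j]).trans (wordEquiv_square j))
    exact h1
  · have h1 : WordEquiv [i, j, i, j, i, j] [] :=
      ((wordEquiv_braid h hij).append_right [j, i, j]).trans
        (((wordEquiv_square j).infix_congr [j, i] [i, j]).trans
          (((wordEquiv_square i).infix_congr [j] [j]).trans (wordEquiv_square j)))
    exact h1

/-- The first word is `5 · 323 · 014 · 323 · 014 · 323`, built from reflections that commute with
the time step. The second is shorter and splits into blocks with simple closed forms. The chain uses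
braid and commutation relations, and one cancellation of a square accounts for the difference of two
letters. -/
theorem wordEquiv_shift :
    WordEquiv [5, 3, 2, 3, 0, 1, 4, 3, 2, 3, 0, 1, 4, 3, 2, 3]
      [5, 3, 2, 1, 0, 2, 3, 4, 3, 2, 0, 1, 2, 3] := by
  refine WordEquiv.trans (v := [5, 3, 2, 3, 0, 1, 4, 2, 3, 2, 0, 1, 4, 3, 2, 3])
    ((wordEquiv_braid (i := 3) (j := 2) (by decide) (by decide)).infix_congr [5, 3, 2, 3, 0, 1, 4]
      [0, 1, 4, 3, 2, 3]) ?_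
  refine WordEquiv.trans (v := [5, 3, 2, 0, 3, 1, 4, 2, 3, 2, 0, 1, 4, 3, 2, 3])
    ((wordEquiv_comm (i := 3) (j := 0) (by decide)).infix_congr [5, 3, 2]
      [1, 4, 2, 3, 2, 0, 1, 4, 3, 2, 3]) ?_
  refine WordEquiv.trans (v := [5, 3, 2, 0, 1, 3, 4, 2, 3, 2, 0, 1, 4, 3, 2, 3])
    ((wordEquiv_comm (i := 3) (j := 1) (by decide)).infix_congr [5, 3, 2, 0]
      [4, 2, 3, 2, 0, 1, 4, 3, 2, 3]) ?_
  refine WordEquiv.trans (v := [5, 3, 2, 0, 1, 3, 4, 2, 3, 2, 0, 4, 1, 3, 2, 3])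
    ((wordEquiv_comm (i := 1) (j := 4) (by decide)).infix_congr [5, 3, 2, 0, 1, 3, 4, 2, 3, 2, 0]
      [3, 2, 3]) ?_
  refine WordEquiv.trans (v := [5, 3, 2, 0, 1, 3, 4, 2, 3, 2, 4, 0, 1, 3, 2, 3])
    ((wordEquiv_comm (i := 0) (j := 4) (by decide)).infix_congr [5, 3, 2, 0, 1, 3, 4, 2, 3, 2]
      [1, 3, 2, 3]) ?_
  refine WordEquiv.trans (v := [5, 3, 2, 0, 1, 3, 4, 2, 3, 2, 4, 0, 3, 1, 2, 3])
    ((wordEquiv_comm (i := 1) (j := 3) (by decide)).infix_congr [5, 3, 2, 0, 1, 3, 4, 2, 3, 2, 4, 0]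
      [2, 3]) ?_
  refine WordEquiv.trans (v := [5, 3, 2, 0, 1, 3, 4, 2, 3, 2, 4, 3, 0, 1, 2, 3])
    ((wordEquiv_comm (i := 0) (j := 3) (by decide)).infix_congr [5, 3, 2, 0, 1, 3, 4, 2, 3, 2, 4]
      [1, 2, 3]) ?_
  refine WordEquiv.trans (v := [5, 3, 2, 0, 1, 3, 4, 2, 3, 4, 2, 3, 0, 1, 2, 3])
    ((wordEquiv_comm (i := 2) (j := 4) (by decide)).infix_congr [5, 3, 2, 0, 1, 3, 4, 2, 3]
      [3, 0, 1, 2, 3]) ?_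
  refine WordEquiv.trans (v := [5, 3, 2, 0, 1, 3, 2, 4, 3, 4, 2, 3, 0, 1, 2, 3])
    ((wordEquiv_comm (i := 4) (j := 2) (by decide)).infix_congr [5, 3, 2, 0, 1, 3]
      [3, 4, 2, 3, 0, 1, 2, 3]) ?_
  refine WordEquiv.trans (v := [5, 3, 2, 0, 1, 3, 2, 3, 4, 3, 2, 3, 0, 1, 2, 3])
    ((wordEquiv_braid (i := 4) (j := 3) (by decide) (by decide)).infix_congr [5, 3, 2, 0, 1, 3, 2]
      [2, 3, 0, 1, 2, 3]) ?_
  refine WordEquiv.trans (v := [5, 3, 2, 0, 1, 2, 3, 2, 4, 3, 2, 3, 0, 1, 2, 3])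
    ((wordEquiv_braid (i := 3) (j := 2) (by decide) (by decide)).infix_congr [5, 3, 2, 0, 1]
      [4, 3, 2, 3, 0, 1, 2, 3]) ?_
  refine WordEquiv.trans (v := [5, 3, 2, 0, 1, 2, 3, 2, 4, 2, 3, 2, 0, 1, 2, 3])
    ((wordEquiv_braid (i := 3) (j := 2) (by decide) (by decide)).infix_congr [5, 3, 2, 0, 1, 2, 3, 2, 4]
      [0, 1, 2, 3]) ?_
  refine WordEquiv.trans (v := [5, 3, 2, 0, 1, 2, 3, 4, 2, 2, 3, 2, 0, 1, 2, 3])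
    ((wordEquiv_comm (i := 2) (j := 4) (by decide)).infix_congr [5, 3, 2, 0, 1, 2, 3]
      [2, 3, 2, 0, 1, 2, 3]) ?_
  refine WordEquiv.trans (v := [5, 3, 2, 0, 1, 2, 3, 4, 3, 2, 0, 1, 2, 3])
    ((wordEquiv_square 2).infix_congr [5, 3, 2, 0, 1, 2, 3, 4]
      [3, 2, 0, 1, 2, 3]) ?_
  refine WordEquiv.trans (v := [5, 3, 2, 1, 0, 2, 3, 4, 3, 2, 0, 1, 2, 3])
    ((wordEquiv_comm (i := 0) (j := 1) (by decide)).infix_congr [5, 3, 2]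
      [2, 3, 4, 3, 2, 0, 1, 2, 3]) ?_
  exact WordEquiv.refl _

end QP6

end

noncomputable section

namespace QP6

/-! ### The time evolution of q-P_VI as a birational map -/

/-- The step `q` of q-P_VI, the value of the null root. -/
def qOf (c : Config) : ℂ :=
  c.b 0 * c.b 1 * c.b 6 * c.b 7 / (c.b 2 * c.b 3 * c.b 4 * c.b 5)

/-- The first half step of q-P_VI. -/
def tauZ (c : Config) : Config :=
  ⟨c.b, c.y, c.b 6 * c.b 7 * (c.y - c.b 0) * (c.y - c.b 1) /
    ((c.y - c.b 2) * (c.y - c.b 3) * c.z)⟩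

/-- The second half step of q-P_VI. -/
def tauY (c : Config) : Config :=
  ⟨c.b, c.b 2 * c.b 3 * (c.z - qOf c * c.b 4) * (c.z - qOf c * c.b 5) /
    ((c.z - c.b 6) * (c.z - c.b 7) * c.y), c.z⟩

/-- The effect of the time step on the base points. -/
def tauB (c : Config) : Config :=
  ⟨![qOf c * c.b 0, qOf c * c.b 1, c.b 2, c.b 3, qOf c * c.b 4, qOf c * c.b 5, c.b 6, c.b 7],
    c.y, c.z⟩

/-- The time evolution of q-P_VI. -/
def tau (c : Config) : Config := tauB (tauY (tauZ c))

theorem qOf_ne_zero {c : Config} (hc : c.Nice) : qOf c ≠ 0 := by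
  simp [qOf, hc.hb]

/-- The numerator of the second half step must not vanish, since applying that half step twice puts
it in a denominator. -/
theorem generically_sub_qOf :
    Generically fun c => c.z - qOf c * c.b 4 ≠ 0 ∧ c.z - qOf c * c.b 5 ≠ 0 := by
  have h4 : Generically fun c => c.b 2 * c.b 3 * c.b 5 * c.z - c.b 0 * c.b 1 * c.b 6 * c.b 7 ≠ 0 :=
    generically_ne_zero
      (polyB 2 * polyB 3 * polyB 5 * polyZ - polyB 0 * polyB 1 * polyB 6 * polyB 7)
      (fun c => by simp [Config.coords]) samplePoint (by simp [samplePoint]; norm_num)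
  have h5 : Generically fun c => c.b 2 * c.b 3 * c.b 4 * c.z - c.b 0 * c.b 1 * c.b 6 * c.b 7 ≠ 0 :=
    generically_ne_zero
      (polyB 2 * polyB 3 * polyB 4 * polyZ - polyB 0 * polyB 1 * polyB 6 * polyB 7)
      (fun c => by simp [Config.coords]) samplePoint (by simp [samplePoint]; norm_num)
  refine (generically_nice.and (h4.and h5)).mono ?_
  rintro c ⟨hc, h4, h5⟩
  have k2 := hc.hb 2
  have k3 := hc.hb 3
  have k4 := hc.hb 4
  have k5 := hc.hb 5
  constructor
  · intro h
    refine h4 ?_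
    rw [qOf] at h
    field_simp at h
    linear_combination h
  · intro h
    refine h5 ?_
    rw [qOf] at h
    field_simp at h
    linear_combination h

/-- The equation fixes the product of the old and the new `z`, so the half step is an involution and
serves as its own right inverse. The same holds for `tauY`. -/
theorem isDominant_tauZ : IsDominant tauZ := by
  refine isDominant_of_rightInverse (R := (polyY - polyB 2) * (polyY - polyB 3) * polyZ) tauZ
    (fun k => IsRat.b k) IsRat.y
    (IsRat.div ((((IsRat.b 6).mul (IsRat.b 7)).mul (IsRat.y.sub (IsRat.b 0))).mul
      (IsRat.y.sub (IsRat.b 1))) 1 fun c => by simp [Config.coords])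
    (generically_nice.mono fun d hd => ?_)
  have h6 := hd.hb 6
  have h7 := hd.hb 7
  have y0 := hd.hy 0
  have y1 := hd.hy 1
  have y2 := hd.hy 2
  have y3 := hd.hy 3
  have z0 := hd.hz0
  constructor
  · simp [Config.coords, tauZ, *]
  · refine Config.ext rfl rfl ?_
    simp only [tauZ]
    field_simp

theorem isRat_qOf {R : MvPolynomial (Fin 8 ⊕ Fin 2) ℂ} (H : MvPolynomial (Fin 8 ⊕ Fin 2) ℂ)
    (h : R = polyB 2 * polyB 3 * polyB 4 * polyB 5 * H) : IsRat R qOf :=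
  IsRat.div ((((IsRat.b 0).mul (IsRat.b 1)).mul (IsRat.b 6)).mul (IsRat.b 7)) H
    fun c => by simp [h, Config.coords]

theorem isDominant_tauY : IsDominant tauY := by
  have hq : IsRat (polyB 2 * polyB 3 * polyB 4 * polyB 5 *
      ((polyZ - polyB 6) * (polyZ - polyB 7) * polyY)) qOf := isRat_qOf _ rfl
  refine isDominant_of_rightInverse (R := polyB 2 * polyB 3 * polyB 4 * polyB 5 *
      ((polyZ - polyB 6) * (polyZ - polyB 7) * polyY)) tauY
    (fun k => IsRat.b k)
    (IsRat.div ((((IsRat.b 2).mul (IsRat.b 3)).mul (IsRat.z.sub (hq.mul (IsRat.b 4)))).mul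
      (IsRat.z.sub (hq.mul (IsRat.b 5)))) (polyB 2 * polyB 3 * polyB 4 * polyB 5) fun c => by
        simp [Config.coords, mul_comm])
    IsRat.z
    ((generically_nice.and generically_sub_qOf).mono ?_)
  rintro d ⟨hd, h4, h5⟩
  have k2 := hd.hb 2
  have k3 := hd.hb 3
  have k4 := hd.hb 4
  have k5 := hd.hb 5
  have y0 := hd.hy0
  have z6 := hd.hz 6
  have z7 := hd.hz 7
  have hq : qOf (tauY d) = qOf d := rfl
  constructor
  · simp [Config.coords, tauY, *]
  · refine Config.ext rfl ?_ rfl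
    simp only [tauY, hq] at *
    field_simp

theorem isDominant_tauB : IsDominant tauB := by
  have hq : IsRat (polyB 2 * polyB 3 * polyB 4 * polyB 5 * 1) qOf := isRat_qOf 1 rfl
  refine isDominant_of_rightInverse (R := polyB 2 * polyB 3 * polyB 4 * polyB 5 * 1)
    (fun c => ⟨![c.b 0 / qOf c, c.b 1 / qOf c, c.b 2, c.b 3, c.b 4 / qOf c, c.b 5 / qOf c,
      c.b 6, c.b 7], c.y, c.z⟩) (fun k => ?_) IsRat.y IsRat.z (generically_nice.mono fun d hd => ?_)
  · fin_cases k
    · exact hq.mul (IsRat.b 0)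
    · exact hq.mul (IsRat.b 1)
    · exact IsRat.b 2
    · exact IsRat.b 3
    · exact hq.mul (IsRat.b 4)
    · exact hq.mul (IsRat.b 5)
    · exact IsRat.b 6
    · exact IsRat.b 7
  · have hq := qOf_ne_zero hd
    constructor
    · simp [Config.coords, hd.hb, hq]
    · have h0 := hd.hb 0
      have h1 := hd.hb 1
      have h2 := hd.hb 2
      have h3 := hd.hb 3
      have h4 := hd.hb 4
      have h5 := hd.hb 5
      have h6 := hd.hb 6
      have h7 := hd.hb 7
      have e : ∀ y z, qOf ⟨![d.b 0 / qOf d, d.b 1 / qOf d, d.b 2, d.b 3, d.b 4 / qOf d,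
          d.b 5 / qOf d, d.b 6, d.b 7], y, z⟩ = qOf d := by
        intro y z
        conv_lhs => rw [qOf]
        conv_rhs => rw [qOf]
        simp
        field_simp
      refine Config.ext (funext fun k => ?_) rfl rfl
      simp only [tauB, e]
      fin_cases k <;> simp <;> field_simp

theorem isDominant_tau : IsDominant tau :=
  isDominant_tauB.comp (isDominant_tauY.comp isDominant_tauZ)

theorem tau_b (c : Config) : (tau c).b =
    ![qOf c * c.b 0, qOf c * c.b 1, c.b 2, c.b 3, qOf c * c.b 4, qOf c * c.b 5, c.b 6, c.b 7] :=
  rfl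

theorem tau_y (c : Config) : (tau c).y =
    c.b 2 * c.b 3 * ((tau c).z - qOf c * c.b 4) * ((tau c).z - qOf c * c.b 5) /
      (((tau c).z - c.b 6) * ((tau c).z - c.b 7) * c.y) :=
  rfl

theorem tau_z (c : Config) : (tau c).z =
    c.b 6 * c.b 7 * (c.y - c.b 0) * (c.y - c.b 1) / ((c.y - c.b 2) * (c.y - c.b 3) * c.z) :=
  rfl

/-- The equations are symmetric in each of the four pairs of base points, and the time step scales
both members of a pair alike. -/
theorem tau_act_swap {i : Fin 6} (h2 : i ≠ 2) (h3 : i ≠ 3) (c : Config) :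
    tau (act i c) = act i (tau c) := by
  have hq : qOf (act i c) = qOf c := by
    fin_cases i <;> first | exact absurd rfl h2 | exact absurd rfl h3 | skip
    all_goals simp [qOf, act, Equiv.swap_apply_def]
    all_goals ring
  have hz : (tau (act i c)).z = (tau c).z := by
    rw [tau_z, tau_z]
    fin_cases i <;> first | exact absurd rfl h2 | exact absurd rfl h3 | skip
    all_goals simp [act, Equiv.swap_apply_def]
    all_goals ring
  have hz' : (act i (tau c)).z = (tau c).z := by
    fin_cases i <;> first | rfl | exact absurd rfl h2
  have hy' : (act i (tau c)).y = (tau c).y := by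
    fin_cases i <;> first | rfl | exact absurd rfl h3
  refine Config.ext (funext fun k => ?_) ?_ (hz.trans hz'.symm)
  · rw [tau_b, hq]
    fin_cases i <;> first | exact absurd rfl h2 | exact absurd rfl h3 | skip
    all_goals
      fin_cases k <;> simp [act, Equiv.swap_apply_def, tau_b]
  · rw [hy', tau_y, hq, hz, tau_y c]
    generalize (tau c).z = Z
    fin_cases i <;> first | exact absurd rfl h2 | exact absurd rfl h3 | skip
    all_goals simp [act, Equiv.swap_apply_def]
    all_goals ring

/-- The image of `y` under `sigma` minus a base point of `sigma c` factors into the expressions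
occurring in `sigma` itself; these factors cancel when `tau` is applied next. -/
theorem sigma_y_sub {b0 b2 b4 b6 y z : ℂ} (h4 : b4 ≠ 0)
    (hD' : b0 * z * (y - b2) - b4 * b2 * (y - b0) ≠ 0) :
    y * (b0 * (z * (y - b2) - b6 * (y - b0)) / (b0 * z * (y - b2) - b4 * b2 * (y - b0))) - b0 =
      b0 * (y - b0) * (y * (z - b6) - b2 * (z - b4)) /
        (b0 * z * (y - b2) - b4 * b2 * (y - b0)) ∧
    y * (b0 * (z * (y - b2) - b6 * (y - b0)) / (b0 * z * (y - b2) - b4 * b2 * (y - b0)))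
        - b0 * b6 / b4 =
      b0 * (y - b2) * (b4 * y * (z - b6) - b0 * b6 * (z - b4)) /
        (b4 * (b0 * z * (y - b2) - b4 * b2 * (y - b0))) := by
  generalize hD : b0 * z * (y - b2) - b4 * b2 * (y - b0) = D at *
  constructor
  · field_simp
    rw [← hD]
    ring
  · field_simp
    rw [← hD]
    ring

/-- The value of `z` at the image of a point under the reflection and the time step. -/
theorem tau_sigma_z_aux {b0 b1 b2 b3 b4 b5 b6 b7 q y z Y Z : ℂ}
    (h6 : b6 ≠ 0) (h7 : b7 ≠ 0) (y1 : y - b1 ≠ 0) (y2 : y - b2 ≠ 0) (y3 : y - b3 ≠ 0) (hy0 : y ≠ 0) (hz0 : z ≠ 0)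
    (hZ7 : Z - b7 ≠ 0)
    (hq : q * (b2 * b3 * b4 * b5) = b0 * b1 * b6 * b7)
    (hZ : Z * ((y - b2) * (y - b3) * z) = b6 * b7 * (y - b0) * (y - b1))
    (hY : Y * ((Z - b6) * (Z - b7) * y) = b2 * b3 * (Z - q * b4) * (Z - q * b5))
    (hD : q * b4 * Y * (Z - b6) - q * b0 * b6 * (Z - q * b4) ≠ 0) :
    b2 * b3 * b4 * (Z - q * b5) - b0 * b6 * y * (Z - b7) ≠ 0 ∧
    b0 * z * (y - b2) * (y - b3) - (y - b0) * (b0 * b6 * y - b2 * b3 * b4) ≠ 0 ∧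
    Z * (q * b4 * (Y * (Z - b6) - b2 * (Z - q * b4)) /
        (q * b4 * Y * (Z - b6) - q * b0 * b6 * (Z - q * b4))) =
      Z * (b2 * b4 * (b3 * (Z - q * b5) - y * (Z - b7))) /
        (b2 * b3 * b4 * (Z - q * b5) - b0 * b6 * y * (Z - b7)) ∧
    Z * (b2 * b4 * (b3 * (Z - q * b5) - y * (Z - b7))) /
        (b2 * b3 * b4 * (Z - q * b5) - b0 * b6 * y * (Z - b7)) =
      b7 * (y - b0) * (z * (y - b2) * (b2 * b4 * y - b0 * b6 * b1)
          - b2 * b4 * b6 * (y - b0) * (y - b1)) /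
        ((y - b2) * (b0 * z * (y - b2) * (y - b3) - (y - b0) * (b0 * b6 * y - b2 * b3 * b4)) *
          z) := by
  -- Multiplication by `y (Z - b7)` allows the equation for `Y` to eliminate it; the common factor
  -- `Z - q b4` then leaves the quotient.
  have e1 : (Y * (Z - b6) - b2 * (Z - q * b4)) * (y * (Z - b7)) =
      b2 * (Z - q * b4) * (b3 * (Z - q * b5) - y * (Z - b7)) := by
    linear_combination hY
  have e2 : (q * b4 * Y * (Z - b6) - q * b0 * b6 * (Z - q * b4)) * (y * (Z - b7)) =
      q * (Z - q * b4) * (b2 * b3 * b4 * (Z - q * b5) - b0 * b6 * y * (Z - b7)) := by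
    linear_combination q * b4 * hY
  have hd : b2 * b3 * b4 * (Z - q * b5) - b0 * b6 * y * (Z - b7) ≠ 0 := by
    intro h
    rw [h, mul_zero] at e2
    exact mul_ne_zero hD (mul_ne_zero hy0 hZ7) e2
  have e3 : (b3 * (Z - q * b5) - y * (Z - b7)) * ((y - b2) * z * (b2 * b4)) =
      b7 * (z * (y - b2) * (b2 * b4 * y - b0 * b6 * b1)
        - b2 * b4 * b6 * (y - b0) * (y - b1)) := by
    linear_combination (-(b2 * b4)) * hZ - (y - b2) * z * hq
  have e4 : (b2 * b3 * b4 * (Z - q * b5) - b0 * b6 * y * (Z - b7)) *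
      ((y - b2) * (y - b3) * z) = b6 * b7 * (y - b1) *
      (b0 * z * (y - b2) * (y - b3) - (y - b0) * (b0 * b6 * y - b2 * b3 * b4)) := by
    linear_combination (b2 * b3 * b4 - b0 * b6 * y) * hZ - (y - b2) * (y - b3) * z * hq
  have he : b0 * z * (y - b2) * (y - b3) - (y - b0) * (b0 * b6 * y - b2 * b3 * b4) ≠ 0 := by
    intro h
    rw [h, mul_zero] at e4
    exact mul_ne_zero hd (mul_ne_zero (mul_ne_zero y2 y3) hz0) e4
  refine ⟨hd, he, ?_, ?_⟩
  · generalize Y * (Z - b6) - b2 * (Z - q * b4) = N at *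
    generalize q * b4 * Y * (Z - b6) - q * b0 * b6 * (Z - q * b4) = D at *
    generalize b2 * b3 * b4 * (Z - q * b5) - b0 * b6 * y * (Z - b7) = d at *
    generalize b3 * (Z - q * b5) - y * (Z - b7) = n at *
    rw [mul_div_assoc Z (b2 * b4 * n) d]
    congr 1
    rw [div_eq_div_iff hD hd]
    have : y * (Z - b7) ≠ 0 := mul_ne_zero hy0 hZ7
    apply mul_right_cancel₀ this
    linear_combination q * b4 * d * e1 - b2 * b4 * n * e2
  · generalize z * (y - b2) * (b2 * b4 * y - b0 * b6 * b1)
      - b2 * b4 * b6 * (y - b0) * (y - b1) = E at *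
    generalize b0 * z * (y - b2) * (y - b3) - (y - b0) * (b0 * b6 * y - b2 * b3 * b4) = F at *
    generalize b2 * b3 * b4 * (Z - q * b5) - b0 * b6 * y * (Z - b7) = d at *
    generalize b3 * (Z - q * b5) - y * (Z - b7) = n at *
    rw [div_eq_div_iff hd (mul_ne_zero (mul_ne_zero y2 he) hz0)]
    have : b7 * (y - b1) * b6 ≠ 0 := by simp [*]
    apply mul_right_cancel₀ this
    linear_combination b7 * (y - b1) * b6 * Z * F * e3 - Z * b7 * E * e4 + b7 * E * d * hZ

theorem sigma_z_sub {b0 b2 b4 b6 y z : ℂ} (h0 : b0 ≠ 0)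
    (hD : b4 * y * (z - b6) - b0 * b6 * (z - b4) ≠ 0) :
    z * (b4 * (y * (z - b6) - b2 * (z - b4)) / (b4 * y * (z - b6) - b0 * b6 * (z - b4))) - b4 =
      b4 * (z - b4) * (z * (y - b2) - b6 * (y - b0)) /
        (b4 * y * (z - b6) - b0 * b6 * (z - b4)) ∧
    z * (b4 * (y * (z - b6) - b2 * (z - b4)) / (b4 * y * (z - b6) - b0 * b6 * (z - b4)))
        - b2 * b4 / b0 =
      b4 * (z - b6) * (b0 * z * (y - b2) - b4 * b2 * (y - b0)) /
        (b0 * (b4 * y * (z - b6) - b0 * b6 * (z - b4))) := by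
  generalize hE : b4 * y * (z - b6) - b0 * b6 * (z - b4) = D at *
  constructor
  · field_simp
    rw [← hE]
    ring
  · field_simp
    rw [← hE]
    ring

/-- The other order of composition, brought to the same rational function of the original `y` and
`z` as in `tau_sigma_z_aux`. -/
theorem sigma_tau_z_aux {b0 b1 b2 b3 b4 b6 b7 y z : ℂ}
    (h0 : b0 ≠ 0) (h2 : b2 ≠ 0) (h4 : b4 ≠ 0) (y2 : y - b2 ≠ 0) (hz0 : z ≠ 0)
    (hN : y * (z - b6) - b2 * (z - b4) ≠ 0)
    (hD : b4 * y * (z - b6) - b0 * b6 * (z - b4) ≠ 0)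
    (hD' : b0 * z * (y - b2) - b4 * b2 * (y - b0) ≠ 0)
    (hF : b0 * z * (y - b2) * (y - b3) - (y - b0) * (b0 * b6 * y - b2 * b3 * b4) ≠ 0)
    {Y : ℂ} (hY : Y = y * (b0 * (z * (y - b2) - b6 * (y - b0)) /
      (b0 * z * (y - b2) - b4 * b2 * (y - b0)))) :
    b2 * b4 / b0 * b7 * (Y - b0) * (Y - b1 * (b0 * b6 / (b2 * b4))) /
        ((Y - b0 * b6 / b4) * (Y - b3) * (z * (b4 * (y * (z - b6) - b2 * (z - b4)) /
          (b4 * y * (z - b6) - b0 * b6 * (z - b4))))) =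
      b7 * (y - b0) * (z * (y - b2) * (b2 * b4 * y - b0 * b6 * b1)
          - b2 * b4 * b6 * (y - b0) * (y - b1)) /
        ((y - b2) * (b0 * z * (y - b2) * (y - b3) - (y - b0) * (b0 * b6 * y - b2 * b3 * b4)) *
          z) := by
  obtain ⟨s1, s2⟩ := sigma_y_sub (b6 := b6) h4 hD'
  rw [← hY] at s1 s2
  have s3 : Y - b1 * (b0 * b6 / (b2 * b4)) = b0 * (z * (y - b2) * (b2 * b4 * y - b0 * b6 * b1)
      - b2 * b4 * b6 * (y - b0) * (y - b1)) /
      (b2 * b4 * (b0 * z * (y - b2) - b4 * b2 * (y - b0))) := by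
    rw [hY]
    generalize hE : b0 * z * (y - b2) - b4 * b2 * (y - b0) = D' at *
    field_simp
    rw [← hE]
    ring
  have s4 : Y - b3 = (b0 * z * (y - b2) * (y - b3) - (y - b0) * (b0 * b6 * y - b2 * b3 * b4)) /
      (b0 * z * (y - b2) - b4 * b2 * (y - b0)) := by
    rw [hY]
    generalize hE : b0 * z * (y - b2) - b4 * b2 * (y - b0) = D' at *
    field_simp
    rw [← hE]
    ring
  rw [s1, s2, s3, s4]
  generalize b0 * z * (y - b2) * (y - b3) - (y - b0) * (b0 * b6 * y - b2 * b3 * b4) = F at *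
  generalize z * (y - b2) * (b2 * b4 * y - b0 * b6 * b1)
    - b2 * b4 * b6 * (y - b0) * (y - b1) = E at *
  generalize y * (z - b6) - b2 * (z - b4) = N at *
  generalize b4 * y * (z - b6) - b0 * b6 * (z - b4) = D at *
  generalize b0 * z * (y - b2) - b4 * b2 * (y - b0) = D' at *
  field_simp

/-- The factor of the second equation that contains `b5` has no counterpart among the factors of
`sigma`. This relation trades it for factors at the point `tau c`, so that the remaining comparison
is plain cancellation. -/
theorem tau_sigma_y_aux {b0 b1 b2 b3 b4 b5 b6 b7 q y z Z S : ℂ}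
    (hD' : b0 * z * (y - b2) - b4 * b2 * (y - b0) ≠ 0)
    (hd : b2 * b3 * b4 * (Z - q * b5) - b0 * b6 * y * (Z - b7) ≠ 0)
    (hq : q * (b2 * b3 * b4 * b5) = b0 * b1 * b6 * b7)
    (hZ : Z * ((y - b2) * (y - b3) * z) = b6 * b7 * (y - b0) * (y - b1))
    (hS : S = Z * (b2 * b4 * (b3 * (Z - q * b5) - y * (Z - b7))) /
        (b2 * b3 * b4 * (Z - q * b5) - b0 * b6 * y * (Z - b7))) :
    (b0 * b6 * S - q * b5 * (b2 * b4)) * (Z - b7) * y = b2 * b4 * (Z - q * b5) * (S - b7) *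
      (y * (b0 * (z * (y - b2) - b6 * (y - b0)) /
        (b0 * z * (y - b2) - b4 * b2 * (y - b0)))) := by
  rw [eq_div_iff hd] at hS
  have e : (b0 * b6 * b3 * Z - q * b5 * (b2 * b3 * b4) - b0 * b6 * y * (Z - b7)) *
      (b0 * z * (y - b2) - b4 * b2 * (y - b0)) =
      b0 * (z * (y - b2) - b6 * (y - b0)) *
        (b2 * b3 * b4 * (Z - q * b5) - y * (b2 * b4 * Z - b7 * b0 * b6)) := by
    linear_combination (-(b0 * b6 - b2 * b4) * b0) * hZ - (y - b0) * (b0 * b6 - b2 * b4) * hq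
  generalize hDe : b0 * z * (y - b2) - b4 * b2 * (y - b0) = D' at *
  generalize hNe : z * (y - b2) - b6 * (y - b0) = N' at *
  rw [← mul_div_assoc, ← mul_div_assoc, eq_div_iff hD']
  apply mul_right_cancel₀ hd
  linear_combination b2 * b4 * (Z - q * b5) * (Z - b7) * y * e
    + (b0 * b6 * (Z - b7) * y * D' - b2 * b4 * (Z - q * b5) * y * b0 * N') * hS

theorem qOf_mul {c : Config} (hb : ∀ k, c.b k ≠ 0) :
    qOf c * (c.b 2 * c.b 3 * c.b 4 * c.b 5) = c.b 0 * c.b 1 * c.b 6 * c.b 7 :=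
  div_mul_cancel₀ _ (by simp [hb])

theorem qOf_sigma {c : Config} (hb : ∀ k, c.b k ≠ 0) : qOf (sigma c) = qOf c := by
  have h0 := hb 0
  have h1 := hb 1
  have h2 := hb 2
  have h3 := hb 3
  have h4 := hb 4
  have h5 := hb 5
  have h6 := hb 6
  have h7 := hb 7
  simp [qOf, sigma]
  field_simp

/-- The time step preserves the product of the root variables of `α₂` and `α₃`, so the two maps
agree on base points. The `z`-coordinates are compared first; their common value then enters both
expressions for `y`. -/
theorem tau_sigma {c : Config} (hc : c.Nice) (ht : (tau c).Nice)
    (h7 : (tau (sigma c)).z - c.b 7 ≠ 0) : tau (sigma c) = sigma (tau c) := by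
  have hqs := qOf_sigma hc.hb
  have hq := qOf_mul hc.hb
  have hq0 := qOf_ne_zero hc
  have k0 := hc.hb 0
  have k2 := hc.hb 2
  have k4 := hc.hb 4
  have k6 := hc.hb 6
  have y2 := hc.hy 2
  have y3 := hc.hy 3
  have y0 := hc.hy0
  have z0 := hc.hz0
  have htD : qOf c * c.b 4 * (tau c).y * ((tau c).z - c.b 6)
      - qOf c * c.b 0 * c.b 6 * ((tau c).z - qOf c * c.b 4) ≠ 0 := ht.hD
  have htD' : qOf c * c.b 0 * (tau c).z * ((tau c).y - c.b 2)
      - qOf c * c.b 4 * c.b 2 * ((tau c).y - qOf c * c.b 0) ≠ 0 := ht.hD'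
  have htz4 : (tau c).z - qOf c * c.b 4 ≠ 0 := ht.hz 4
  have htz6 : (tau c).z - c.b 6 ≠ 0 := ht.hz 6
  have htz7 : (tau c).z - c.b 7 ≠ 0 := ht.hz 7
  have hZ : (tau c).z * ((c.y - c.b 2) * (c.y - c.b 3) * c.z) =
      c.b 6 * c.b 7 * (c.y - c.b 0) * (c.y - c.b 1) :=
    div_mul_cancel₀ _ (mul_ne_zero (mul_ne_zero y2 y3) z0)
  have hY : (tau c).y * (((tau c).z - c.b 6) * ((tau c).z - c.b 7) * c.y) =
      c.b 2 * c.b 3 * ((tau c).z - qOf c * c.b 4) * ((tau c).z - qOf c * c.b 5) :=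
    div_mul_cancel₀ _ (mul_ne_zero (mul_ne_zero htz6 htz7) y0)
  have hys : (sigma c).y = c.y * (c.b 0 * (c.z * (c.y - c.b 2) - c.b 6 * (c.y - c.b 0)) /
      (c.b 0 * c.z * (c.y - c.b 2) - c.b 4 * c.b 2 * (c.y - c.b 0))) := rfl
  have hys0 : (sigma c).y ≠ 0 :=
    mul_ne_zero y0 (div_ne_zero (mul_ne_zero k0 hc.hN') hc.hD')
  obtain ⟨hd, hF, r1, r2⟩ := tau_sigma_z_aux k6 (hc.hb 7) (hc.hy 1) y2 y3 y0 z0 htz7 hq hZ hY htD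
  have hz : (tau (sigma c)).z = (sigma (tau c)).z :=
    (sigma_tau_z_aux k0 k2 k4 y2 z0 hc.hN hc.hD hc.hD' hF hys).trans (r1.trans r2).symm
  have hbs : (tau (sigma c)).b = (sigma (tau c)).b := by
    rw [tau_b, hqs, sigma, sigma, tau_b]
    funext k
    fin_cases k <;> simp <;> field_simp
  refine Config.ext hbs ?_ hz
  have hS := hz.trans r1
  have K := tau_sigma_y_aux hc.hD' hd hq hZ hS
  rw [← hys] at K
  have z1 : (sigma (tau c)).z - qOf c * c.b 4 = _ :=
    (sigma_z_sub (b2 := c.b 2) (mul_ne_zero hq0 k0) htD).1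
  have z2 : (sigma (tau c)).z - c.b 2 * (qOf c * c.b 4) / (qOf c * c.b 0) = _ :=
    (sigma_z_sub (b2 := c.b 2) (mul_ne_zero hq0 k0) htD).2
  rw [← hz] at z1 z2
  have hsy : (sigma (tau c)).y = (tau c).y * (qOf c * c.b 0 * ((tau c).z * ((tau c).y - c.b 2)
      - c.b 6 * ((tau c).y - qOf c * c.b 0)) / (qOf c * c.b 0 * (tau c).z * ((tau c).y - c.b 2)
      - qOf c * c.b 4 * c.b 2 * ((tau c).y - qOf c * c.b 0))) := rfl
  have sy : (tau (sigma c)).y = c.b 0 * c.b 6 / c.b 4 * c.b 3 *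
      ((tau (sigma c)).z - qOf (sigma c) * c.b 4) * ((tau (sigma c)).z - qOf (sigma c) *
        (c.b 5 * (c.b 2 * c.b 4 / (c.b 0 * c.b 6)))) /
      (((tau (sigma c)).z - c.b 2 * c.b 4 / c.b 0) * ((tau (sigma c)).z - c.b 7) * (sigma c).y) :=
    rfl
  have e5 : (tau (sigma c)).z - qOf c * (c.b 5 * (c.b 2 * c.b 4 / (c.b 0 * c.b 6))) =
      c.b 2 * c.b 4 * ((tau c).z - qOf c * c.b 5) * ((tau (sigma c)).z - c.b 7) * (sigma c).y /
        (c.b 0 * c.b 6 * ((tau c).z - c.b 7) * c.y) := by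
    rw [eq_div_iff (by simp [*])]
    have : c.b 5 * (c.b 2 * c.b 4 / (c.b 0 * c.b 6)) * (c.b 0 * c.b 6) =
        c.b 5 * (c.b 2 * c.b 4) := by field_simp
    linear_combination K - qOf c * ((tau c).z - c.b 7) * c.y * this
  have e2 : c.b 2 * c.b 4 / c.b 0 = c.b 2 * (qOf c * c.b 4) / (qOf c * c.b 0) := by
    field_simp
  rw [sy, hqs, e5, z1, e2, z2, hsy]
  clear K z1 z2 e5 sy hsy hS hZ hY hys r1 r2 hqs hq hbs hz
  generalize (tau (sigma c)).z - c.b 7 = S7 at *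
  generalize (sigma c).y = ys at *
  generalize (tau c).z * ((tau c).y - c.b 2) - c.b 6 * ((tau c).y - qOf c * c.b 0) = N' at *
  generalize qOf c * c.b 4 * (tau c).y * ((tau c).z - c.b 6)
      - qOf c * c.b 0 * c.b 6 * ((tau c).z - qOf c * c.b 4) = D at *
  generalize qOf c * c.b 0 * (tau c).z * ((tau c).y - c.b 2)
      - qOf c * c.b 4 * c.b 2 * ((tau c).y - qOf c * c.b 0) = D' at *
  rw [tau_y c]
  field_simp

/-! ### The time evolution commutes with the shift -/

/-- The birational map of the word `w` generically commutes with the time evolution. -/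
def CommutesWithTau (w : List (Fin 6)) : Prop :=
  Generically fun c => tau (actWord w c) = actWord w (tau c)

namespace CommutesWithTau

theorem swap {i : Fin 6} (h2 : i ≠ 2) (h3 : i ≠ 3) : CommutesWithTau [i] :=
  generically_nice.mono fun c _ => tau_act_swap h2 h3 c

theorem reflection : CommutesWithTau [3, 2, 3] := by
  have h := isDominant_tau _ generically_nice
  have h' : Generically fun c => (tau (actWord [3, 2, 3] c)).Nice :=
    isDominant_actWord [3, 2, 3] _ h
  refine (generically_nice.and (h.and h')).mono ?_
  rintro c ⟨hc, ht, h7⟩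
  have e1 : actWord [3, 2, 3] c = sigma c := act_three_two_three hc
  have e2 : actWord [3, 2, 3] (tau c) = sigma (tau c) := act_three_two_three ht
  rw [e1] at h7 ⊢
  rw [e2]
  exact tau_sigma hc ht (h7.hz 7)

theorem append {v w : List (Fin 6)} (hv : CommutesWithTau v) (hw : CommutesWithTau w) :
    CommutesWithTau (v ++ w) := by
  refine (Generically.and hv (isDominant_actWord v _ hw)).mono ?_
  rintro c ⟨h1, h2⟩
  rw [actWord_append, actWord_append, h2, h1]

theorem congr {v w : List (Fin 6)} (h : WordEquiv v w) (hv : CommutesWithTau v) :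
    CommutesWithTau w := by
  refine (Generically.and hv (Generically.and h (isDominant_tau _ h))).mono ?_
  rintro c ⟨h1, h2, h3⟩
  rw [← h2, h1, h3]

end CommutesWithTau

/-- The word of the shift. -/
abbrev shiftWord : List (Fin 6) := [5, 3, 2, 1, 0, 2, 3, 4, 3, 2, 0, 1, 2, 3]

theorem commutesWithTau_shiftWord : CommutesWithTau shiftWord := by
  have h0 := CommutesWithTau.swap (i := 0) (by decide) (by decide)
  have h1 := CommutesWithTau.swap (i := 1) (by decide) (by decide)
  have h4 := CommutesWithTau.swap (i := 4) (by decide) (by decide)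
  have h5 := CommutesWithTau.swap (i := 5) (by decide) (by decide)
  have hr := CommutesWithTau.reflection
  have h014 : CommutesWithTau [0, 1, 4] := h0.append (h1.append h4)
  -- Neither `s₂` nor `s₃` is used on its own: every factor fixes the translation direction of the
  -- time step.
  exact (h5.append (hr.append (h014.append (hr.append (h014.append hr))))).congr wordEquiv_shift

end QP6

end

noncomputable section

namespace QP6

/-! ### The birational action of the shift -/

/-- The block applies the elementary transformation to both pairs of base points at once, so the
factor of `z` becomes symmetric in each pair. -/
theorem actWord_two_one_zero_two (c : Config) : actWord [2, 1, 0, 2] c =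
    ⟨![c.b 3, c.b 2, c.b 1, c.b 0, c.b 4 * (c.b 2 * c.b 3 / (c.b 0 * c.b 1)),
        c.b 5 * (c.b 2 * c.b 3 / (c.b 0 * c.b 1)), c.b 6, c.b 7], c.y,
      c.z * ((c.y - c.b 2) * (c.y - c.b 3) / ((c.y - c.b 0) * (c.y - c.b 1)))⟩ := by
  refine Config.ext (funext fun k => ?_) ?_ ?_
  · fin_cases k <;> simp [actWord, act, Equiv.swap_apply_def] <;> ring
  · simp [actWord, act]
  · simp [actWord, act, Equiv.swap_apply_def]
    rw [mul_assoc, div_mul_div_comm]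

theorem actWord_two_zero_one_two (c : Config) :
    actWord [2, 0, 1, 2] c = actWord [2, 1, 0, 2] c :=
  congrArg (act 2) (act_comm (by decide) (act 2 c))

theorem actWord_three_four_three {c : Config} (h4 : c.b 4 ≠ 0) (z4 : c.z - c.b 4 ≠ 0) :
    actWord [3, 4, 3] c =
      ⟨![c.b 0 * (c.b 6 / c.b 5), c.b 1 * (c.b 6 / c.b 5), c.b 2, c.b 3, c.b 4, c.b 6, c.b 5,
        c.b 7], c.y * ((c.z - c.b 6) / (c.z - c.b 5)), c.z⟩ := by
  obtain ⟨b, y, z⟩ := c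
  dsimp only at *
  refine Config.ext (funext fun k => ?_) ?_ ?_
  · fin_cases k <;> simp [actWord, act, Equiv.swap_apply_def] <;> field_simp
  · simp [actWord, act, Equiv.swap_apply_def]
    field_simp
  · simp [actWord, act]

theorem actWord_five_three (c : Config) : actWord [5, 3] c =
    ⟨![c.b 0 * (c.b 7 / c.b 4), c.b 1 * (c.b 7 / c.b 4), c.b 2, c.b 3, c.b 7, c.b 5, c.b 4,
      c.b 6], c.y * ((c.z - c.b 7) / (c.z - c.b 4)), c.z⟩ := by
  refine Config.ext (funext fun k => ?_) ?_ ?_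
  · fin_cases k <;> simp [actWord, act, Equiv.swap_apply_def]
  · simp [actWord, act, Equiv.swap_apply_def]
  · simp [actWord, act]

/-- The scaling factor of the shift. -/
def gOf (c : Config) : ℂ := c.b 0 * c.b 1 * c.b 7 ^ 2 / (c.b 2 * c.b 3 * c.b 4 * c.b 5)

section Algebra

variable {b0 b1 b2 b3 k m r s y g ζ η ξ : ℂ}

/-- The equation of `ζ`, in terms of `ξ`. -/
theorem shift_relation (hg : b0 * b1 * k ^ 2 * r = g * (b2 * b3) * s)
    (hξ : ξ * (y * m) = ζ - m * y ^ 2 + (b2 + b3) * (y * m))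
    (hζ : (1 - g) * ζ * (1 - m) * (k * r) ^ 2 = (k * r) ^ 2 * (1 - m) *
      ((y - b0) * (y - b1) - g * m * ((y - b2) * (y - b3)))
        + m * g * (b2 * b3) * (s - k * r) * (r - k * r)) :
    (1 - g) * (m * (k * r)) * (y * (m * (k * r) - k * r)) * ξ + (y * (m * (k * r) - k * r)) ^ 2
      - (y * (m * (k * r) - k * r)) * (m * (k * r) * (b2 + b3) - k * r * (b0 + b1))
      + (m * (k * r) - r) * g * (b2 * b3) * (m * (k * r) - s) = 0 := by
  linear_combination (1 - g) * (k * r) * (m * (k * r) - k * r) * hξ - hζ + (m - 1) * r * hg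

/-- The first factor of the second coordinate. -/
theorem shift_numerator (hr : r ≠ 0) (hk : k ≠ 0)
    (hg : b0 * b1 * k ^ 2 * r = g * (b2 * b3) * s)
    (hη : η * y = ζ - y ^ 2 + (b0 + b1) * y)
    (hξ : ξ * (y * m) = ζ - m * y ^ 2 + (b2 + b3) * (y * m))
    (hT : (1 - g) * (m * (k * r)) * (y * (m * (k * r) - k * r)) * ξ
      + (y * (m * (k * r) - k * r)) ^ 2
      - (y * (m * (k * r) - k * r)) * (m * (k * r) * (b2 + b3) - k * r * (b0 + b1))
      + (m * (k * r) - r) * g * (b2 * b3) * (m * (k * r) - s) = 0) :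
    y * (m * (k * r) - k * r) * η - k * (m * (k * r) - r) * (b0 * b1) =
      g * m * (y * (m * (k * r) - k * r) * ξ - (m * (k * r) - r) * (b2 * b3)) := by
  apply mul_left_cancel₀ (mul_ne_zero hk hr)
  linear_combination hT + (k * r) * (m * (k * r) - k * r) * (hη - hξ)
    - (m * (k * r) - r) * hg

theorem shift_denominator (hy : y ≠ 0)
    (hη : η * y = ζ - y ^ 2 + (b0 + b1) * y)
    (hξ : ξ * (y * m) = ζ - m * y ^ 2 + (b2 + b3) * (y * m)) :
    y * (m * (k * r) - k * r) + k * (m * (k * r) - r) * (η - (b0 + b1)) =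
      k * m * (y * (m * (k * r) - k * r) + (m * (k * r) - r) * (ξ - (b2 + b3))) := by
  apply mul_right_cancel₀ hy
  linear_combination k * (m * (k * r) - r) * (hη - hξ)

/-- After the blocks `5 3` and `2 1 0 2`, the relation `hT` for `ξ` makes both `z1 - r` and `g z1 -
r` factor, with the common factor `(1 - g) m k r`. It cancels in the multiplier of the block `3 4
3`, and the new `y` is fractional linear in `ξ`. -/
theorem shift_y_intermediate {y1 z1 Y w : ℂ} (hr : r ≠ 0) (hk : k ≠ 0) (hm : m ≠ 0)
    (hg0 : g ≠ 0) (hw0 : w ≠ 0)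
    (hw : w = m * (k * r) - r) (hY : Y = y * (m * (k * r) - k * r))
    (hg : b0 * b1 * k ^ 2 * r = g * (b2 * b3) * s)
    (hT : (1 - g) * (m * (k * r)) * (y * (m * (k * r) - k * r)) * ξ
      + (y * (m * (k * r) - k * r)) ^ 2
      - (y * (m * (k * r) - k * r)) * (m * (k * r) * (b2 + b3) - k * r * (b0 + b1))
      + (m * (k * r) - r) * g * (b2 * b3) * (m * (k * r) - s) = 0)
    (hy1 : y1 = Y / w) (h0 : y1 - b0 * k ≠ 0) (h1 : y1 - b1 * k ≠ 0)
    (hz1 : z1 = m * (k * r) * ((y1 - b2) * (y1 - b3) / ((y1 - b0 * k) * (y1 - b1 * k))))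
    (hz1g : z1 - r / g ≠ 0) :
    Y - b0 * k * w ≠ 0 ∧ Y - b1 * k * w ≠ 0 ∧
    z1 = m * (k * r) * ((Y - b2 * w) * (Y - b3 * w)) / ((Y - b0 * k * w) * (Y - b1 * k * w)) ∧
    Y + w * (ξ - (b2 + b3)) ≠ 0 ∧
    y1 * ((z1 - r) / (z1 - r / g)) =
      g * (Y * ξ - w * (b2 * b3)) / (Y + w * (ξ - (b2 + b3))) := by
  have e : ∀ x, y1 - x = (Y - x * w) / w := fun x => by
    rw [hy1]
    field_simp
  rw [← hw, ← hY] at hT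
  rw [e] at h0 h1
  have h0' : Y - b0 * k * w ≠ 0 := fun h => h0 (by rw [h, zero_div])
  have h1' : Y - b1 * k * w ≠ 0 := fun h => h1 (by rw [h, zero_div])
  have hz1' : z1 = m * (k * r) * ((Y - b2 * w) * (Y - b3 * w)) /
      ((Y - b0 * k * w) * (Y - b1 * k * w)) := by
    rw [hz1, e, e, e, e]
    field_simp
  have hP : (Y - b0 * k * w) * (Y - b1 * k * w) ≠ 0 := mul_ne_zero h0' h1'
  have hz1P := hz1'
  rw [eq_div_iff hP] at hz1P
  have e1 : (z1 - r) * ((Y - b0 * k * w) * (Y - b1 * k * w)) =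
      -((1 - g) * (m * (k * r)) * w * (Y * ξ - w * (b2 * b3))) := by
    subst hw
    linear_combination hz1P + (m * (k * r) - r) * hT - (m * (k * r) - r) ^ 2 * hg
  have e2 : g * (z1 - r / g) * ((Y - b0 * k * w) * (Y - b1 * k * w)) =
      -((1 - g) * (m * (k * r)) * Y * (Y + w * (ξ - (b2 + b3)))) := by
    have : g * (z1 - r / g) = g * z1 - r := by field_simp
    rw [this]
    subst hw
    linear_combination g * hz1P + (m * (k * r) - r) * hT - (m * (k * r) - r) ^ 2 * hg
  have hK : Y + w * (ξ - (b2 + b3)) ≠ 0 := by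
    intro h
    rw [h, mul_zero, neg_zero] at e2
    exact mul_ne_zero (mul_ne_zero hg0 hz1g) hP e2
  refine ⟨h0', h1', hz1', hK, ?_⟩
  rw [hy1, div_mul_div_comm, div_eq_div_iff (mul_ne_zero hw0 hz1g) hK]
  apply mul_right_cancel₀ hP
  linear_combination Y * (Y + w * (ξ - (b2 + b3))) * e1 - (Y * ξ - w * (b2 * b3)) * w * e2

/-- `hN` and `hD` rewrite the numerator and denominator of `y3` in terms of `η`. Hence `y3` minus a
base point factors through `ξ - b2`, `ξ - b3`, or through `η - b0`, `η - b1`, and the other factors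
cancel against those of `z1`. -/
theorem shift_z_final {y3 z1 Y w : ℂ} (hk : k ≠ 0) (hm : m ≠ 0) (hg0 : g ≠ 0)
    (hN : Y * η - k * w * (b0 * b1) = g * m * (Y * ξ - w * (b2 * b3)))
    (hD : Y + k * w * (η - (b0 + b1)) = k * m * (Y + w * (ξ - (b2 + b3))))
    (h0 : Y - b0 * k * w ≠ 0) (h1 : Y - b1 * k * w ≠ 0)
    (hz1 : z1 =
      m * (k * r) * ((Y - b2 * w) * (Y - b3 * w)) / ((Y - b0 * k * w) * (Y - b1 * k * w)))
    (hK : Y + w * (ξ - (b2 + b3)) ≠ 0)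
    (hy3 : y3 = g * (Y * ξ - w * (b2 * b3)) / (Y + w * (ξ - (b2 + b3))))
    (h2 : y3 - g * b2 ≠ 0) (h3 : y3 - g * b3 ≠ 0) :
    ξ - b2 ≠ 0 ∧ ξ - b3 ≠ 0 ∧
    z1 * ((y3 - b1 * k) * (y3 - b0 * k) / ((y3 - g * b3) * (y3 - g * b2))) =
      m * (k * r) * ((η - b0) * (η - b1)) / (m ^ 2 * g ^ 2 * ((ξ - b2) * (ξ - b3))) := by
  have e2 : y3 - g * b2 = g * ((ξ - b2) * (Y - b2 * w)) / (Y + w * (ξ - (b2 + b3))) := by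
    rw [hy3, eq_div_iff hK, sub_mul, div_mul_cancel₀ _ hK]
    ring
  have e3 : y3 - g * b3 = g * ((ξ - b3) * (Y - b3 * w)) / (Y + w * (ξ - (b2 + b3))) := by
    rw [hy3, eq_div_iff hK, sub_mul, div_mul_cancel₀ _ hK]
    ring
  have e0 : y3 - b0 * k = (η - b0) * (Y - b0 * k * w) / (m * (Y + w * (ξ - (b2 + b3)))) := by
    rw [hy3, eq_div_iff (mul_ne_zero hm hK), sub_mul]
    rw [mul_comm m, ← mul_assoc, div_mul_cancel₀ _ hK]
    linear_combination b0 * hD - hN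
  have e1 : y3 - b1 * k = (η - b1) * (Y - b1 * k * w) / (m * (Y + w * (ξ - (b2 + b3)))) := by
    rw [hy3, eq_div_iff (mul_ne_zero hm hK), sub_mul]
    rw [mul_comm m, ← mul_assoc, div_mul_cancel₀ _ hK]
    linear_combination b1 * hD - hN
  rw [e2] at h2
  rw [e3] at h3
  have h2' := right_ne_zero_of_mul (div_ne_zero_iff.1 h2).1
  have h3' := right_ne_zero_of_mul (div_ne_zero_iff.1 h3).1
  have x2 := left_ne_zero_of_mul h2'
  have x3 := left_ne_zero_of_mul h3'
  have w2 := right_ne_zero_of_mul h2'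
  have w3 := right_ne_zero_of_mul h3'
  refine ⟨x2, x3, ?_⟩
  rw [e0, e1, e2, e3, hz1]
  generalize Y + w * (ξ - (b2 + b3)) = K at *
  generalize Y - b0 * k * w = W0 at *
  generalize Y - b1 * k * w = W1 at *
  generalize Y - b2 * w = W2 at *
  generalize Y - b3 * w = W3 at *
  field_simp

/-- The two factors of `yNext` have different origins: `F₁` is the numerator of the `y`-coordinate
before the last letter, and `F₂` comes from the difference `z2 - r / g` in the last `s₃`. -/
theorem shift_y_final {z2 Y w F₁ F₂ : ℂ} (hr : r ≠ 0) (hk : k ≠ 0) (hm : m ≠ 0) (hm1 : 1 - m ≠ 0)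
    (hs : s ≠ 0) (hg0 : g ≠ 0) (hw0 : w ≠ 0) (hy : y ≠ 0)
    (hw : w = m * (k * r) - r) (hY : Y = y * (m * (k * r) - k * r))
    (hg : b0 * b1 * k ^ 2 * r = g * (b2 * b3) * s)
    (hη : η * y = ζ - y ^ 2 + (b0 + b1) * y)
    (hN : Y * η - k * w * (b0 * b1) = g * m * (Y * ξ - w * (b2 * b3)))
    (hD : Y + k * w * (η - (b0 + b1)) = k * m * (Y + w * (ξ - (b2 + b3))))
    (hK : Y + w * (ξ - (b2 + b3)) ≠ 0) (x2 : ξ - b2 ≠ 0) (x3 : ξ - b3 ≠ 0)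
    (hF₁ : F₁ = ζ - (y - b0) * (y - b1) +
      m * (k * r) * (b0 * b1 / r - b0 * b1 / (k * r)) / (1 - m))
    (hF₂ : F₂ = ζ - (y - b0) * (y - b1) +
      m * (k * r) * (b0 * b1 / s - b0 * b1 / (k * r)) / (1 - m))
    (hz2 : z2 = m * (k * r) * ((η - b0) * (η - b1)) / (m ^ 2 * g ^ 2 * ((ξ - b2) * (ξ - b3))))
    (hz2g : z2 - k * r / g ^ 2 ≠ 0) :
    g * (Y * ξ - w * (b2 * b3)) / (Y + w * (ξ - (b2 + b3))) *
        ((z2 - r / g) / (z2 - k * r / g ^ 2)) =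
      g * (1 / (k * r) * y * (1 - m) / (g / (k * r) * (1 - g / (k * r) * (g * z2))) *
        (F₁ / (m * y * (ξ - b3))) * (F₂ / (m * y * (ξ - b2)))) := by
  have f1 : (m * (k * r) - k * r) * F₁ = g * m * (Y * ξ - w * (b2 * b3)) := by
    rw [← hN, hF₁, hY, hw]
    field_simp
    linear_combination (1 - m) ^ 2 * hη
  have f2' : w * F₂ = y * (m * (k * r) * η - g * m * r * ξ) := by
    have : m * (k * r) - k * r ≠ 0 := by
      rw [show m * (k * r) - k * r = -((1 - m) * (k * r)) by ring]
      exact neg_ne_zero.2 (mul_ne_zero hm1 (mul_ne_zero hk hr))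
    have g1 : (m * (k * r) - k * r) * F₂ * s =
        (m * (k * r) - k * r) * (ζ - (y - b0) * (y - b1)) * s
          - m * (k * r) * (b0 * b1) * (k * r - s) := by
      rw [hF₂]
      field_simp
      ring
    apply mul_left_cancel₀ this
    apply mul_right_cancel₀ hs
    subst hY hw
    linear_combination (m * (k * r) - r) * g1
      - (m * (k * r) - r) * (m * (k * r) - k * r) * s * hη - r * s * hN
      - m * r * (m * (k * r) - r) * hg
  have f2 : (Y + w * (ξ - (b2 + b3))) * F₂ =
      y * (k * r * ((η - b0) * (η - b1)) - g * m * r * ((ξ - b2) * (ξ - b3))) := by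
    apply mul_left_cancel₀ hw0
    linear_combination (Y + w * (ξ - (b2 + b3))) * f2' + y * r * hN - y * r * η * hD
  have f3 : z2 - r / g = m * (Y + w * (ξ - (b2 + b3))) * F₂ /
      (y * (m ^ 2 * g ^ 2 * ((ξ - b2) * (ξ - b3)))) := by
    rw [mul_assoc, f2, hz2]
    field_simp
  have f4 : 1 - g / (k * r) * (g * z2) = -(g ^ 2 / (k * r) * (z2 - k * r / g ^ 2)) := by
    field_simp
    ring
  have f5 : g * (Y * ξ - w * (b2 * b3)) = (m * (k * r) - k * r) * F₁ / m := by
    rw [f1]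
    field_simp
  rw [f3, f4, f5]
  clear hz2 f1 f2 f2' f3 f4 f5 hN hD hF₁ hF₂ hg
  generalize z2 - k * r / g ^ 2 = Z at *
  generalize Y + w * (ξ - (b2 + b3)) = K at *
  field_simp
  ring

end Algebra

end QP6

end

/-! ### Comparison of the composed word with the shift formulas. -/

noncomputable section

namespace QP6

/-- The parameters of q-P_VI, at time `1`, of a configuration. -/
def ofConfig (c : Config) : Param :=
  ⟨qOf c, c.b 0, c.b 1, c.b 2, c.b 3, 1 / (qOf c * c.b 6), 1 / c.b 7,
    c.b 0 * c.b 1 / (qOf c * c.b 4), c.b 0 * c.b 1 / (qOf c * c.b 5)⟩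

/-- The shift as a map of configurations. -/
def shiftConfig (c : Config) : Config :=
  ⟨![c.b 0, c.b 1, c.b 2, c.b 3, c.b 4, c.b 5, c.b 6 / qOf c, qOf c * c.b 7],
    (ofConfig c).yNext 1 c.y c.z, (ofConfig c).zNext 1 c.y c.z⟩

theorem gOf_eq {c : Config} (h6 : c.b 6 ≠ 0) : gOf c = qOf c * c.b 7 / c.b 6 := by
  rw [gOf, qOf]
  field_simp

theorem ofConfig_κ {c : Config} (hc : c.Nice) :
    (ofConfig c).q ^ 2 * (ofConfig c).κ₁ = gOf c / c.b 7 := by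
  have h6 := hc.hb 6
  have h7 := hc.hb 7
  have hq := qOf_ne_zero hc
  rw [gOf_eq h6]
  simp only [ofConfig]
  field_simp

/-- Here `q² κ₁ / κ₂` is `gOf c`. The definition of `qOf` rewrites `θ₁`, `θ₂` without `b 0` and `b
1`, and the product over the eigenvalues becomes one of differences from `b 7`. -/
theorem ofConfig_ζ {c : Config} (hc : c.Nice) (hg : gOf c ≠ 1) :
    (1 - gOf c) * (ofConfig c).ζ 1 c.y c.z * (1 - c.z / c.b 7) * c.b 7 ^ 2 =
      c.b 7 ^ 2 * (1 - c.z / c.b 7) * ((c.y - c.b 0) * (c.y - c.b 1)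
          - gOf c * (c.z / c.b 7) * ((c.y - c.b 2) * (c.y - c.b 3)))
        + c.z / c.b 7 * gOf c * (c.b 2 * c.b 3) * (c.b 5 - c.b 7) * (c.b 4 - c.b 7) := by
  have h2 := hc.hb 2
  have h3 := hc.hb 3
  have h4 := hc.hb 4
  have h5 := hc.hb 5
  have h6 := hc.hb 6
  have h7 := hc.hb 7
  have hz := hc.hz 7
  have hq0 := qOf_ne_zero hc
  have hq := qOf_mul hc.hb
  have hκ := ofConfig_κ hc
  have t4 : c.b 0 * c.b 1 / (qOf c * c.b 4) = c.b 2 * c.b 3 * c.b 5 / (c.b 6 * c.b 7) := by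
    rw [div_eq_div_iff (mul_ne_zero hq0 h4) (mul_ne_zero h6 h7)]
    linear_combination -hq
  have t5 : c.b 0 * c.b 1 / (qOf c * c.b 5) = c.b 2 * c.b 3 * c.b 4 / (c.b 6 * c.b 7) := by
    rw [div_eq_div_iff (mul_ne_zero hq0 h5) (mul_ne_zero h6 h7)]
    linear_combination -hq
  have hg' : 1 - gOf c ≠ 0 := sub_ne_zero.2 hg.symm
  have hm : 1 - c.z / c.b 7 ≠ 0 := by
    rw [one_sub_div h7]
    refine div_ne_zero (fun h => hz ?_) h7
    linear_combination -h
  have hd : (ofConfig c).κ₂ - (ofConfig c).q ^ 2 * (ofConfig c).κ₁ = (1 - gOf c) / c.b 7 := by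
    rw [hκ, sub_div]
    rfl
  have hE : (1 * (ofConfig c).θ₁ - (ofConfig c).q * (ofConfig c).κ₁ * (ofConfig c).a₃ *
      (ofConfig c).a₄) * (1 * (ofConfig c).θ₂ - (ofConfig c).q * (ofConfig c).κ₁ *
      (ofConfig c).a₃ * (ofConfig c).a₄) /
      ((ofConfig c).κ₁ * (ofConfig c).a₃ * (ofConfig c).a₄) =
      gOf c * (c.b 2 * c.b 3) * (c.b 5 - c.b 7) * (c.b 4 - c.b 7) / c.b 7 ^ 3 := by
    rw [gOf_eq h6]
    simp only [ofConfig]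
    rw [t4, t5]
    field_simp
  rw [Param.ζ, hd, hκ, hE]
  have hm' : 1 - 1 / c.b 7 * c.z ≠ 0 := by rwa [one_div_mul_eq_div]
  simp only [ofConfig]
  have hm'' : c.b 7 - c.z ≠ 0 := sub_ne_zero.2 (sub_ne_zero.1 hz).symm
  field_simp

theorem ofConfig_zNext {c : Config} (hc : c.Nice) {ζ η ξ m : ℂ} (hζ : (ofConfig c).ζ 1 c.y c.z = ζ)
    (hm : m = c.z / c.b 7)
    (hη : η * c.y = ζ - c.y ^ 2 + (c.b 0 + c.b 1) * c.y)
    (hξ : ξ * (c.y * m) = ζ - m * c.y ^ 2 + (c.b 2 + c.b 3) * (c.y * m))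
    (hg0 : gOf c ≠ 0) (x2 : ξ - c.b 2 ≠ 0) (x3 : ξ - c.b 3 ≠ 0) :
    (ofConfig c).zNext 1 c.y c.z = gOf c * (c.z * ((η - c.b 0) * (η - c.b 1)) /
      (m ^ 2 * gOf c ^ 2 * ((ξ - c.b 2) * (ξ - c.b 3)))) := by
  have hy := hc.hy0
  have h7 := hc.hb 7
  have hm0 : m ≠ 0 := hm ▸ div_ne_zero hc.hz0 h7
  have n0 : c.y * (c.b 0 * 1 - c.y) + ζ = c.y * (η - c.b 1) := by linear_combination -hη
  have n1 : c.y * (c.b 1 * 1 - c.y) + ζ = c.y * (η - c.b 0) := by linear_combination -hη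
  have d2 : 1 / c.b 7 * c.y * c.z * (c.b 2 - c.y) + ζ = m * c.y * (ξ - c.b 3) := by
    have : 1 / c.b 7 * c.y * c.z = m * c.y := by rw [hm]; ring
    rw [this]
    linear_combination -hξ
  have d3 : 1 / c.b 7 * c.y * c.z * (c.b 3 - c.y) + ζ = m * c.y * (ξ - c.b 2) := by
    have : 1 / c.b 7 * c.y * c.z = m * c.y := by rw [hm]; ring
    rw [this]
    linear_combination -hξ
  rw [Param.zNext, hζ, ofConfig_κ hc]
  simp only [ofConfig]
  rw [n0, n1, d2, d3]
  field_simp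

theorem ofConfig_yNext {c : Config} (hc : c.Nice) {ζ ξ m : ℂ}
    (hζ : (ofConfig c).ζ 1 c.y c.z = ζ) (hm : m = c.z / c.b 7)
    (hξ : ξ * (c.y * m) = ζ - m * c.y ^ 2 + (c.b 2 + c.b 3) * (c.y * m)) :
    (ofConfig c).yNext 1 c.y c.z = 1 / c.b 7 * c.y * (1 - m) /
        (gOf c / c.b 7 * (1 - gOf c / c.b 7 * (ofConfig c).zNext 1 c.y c.z)) *
      ((ζ - (c.y - c.b 0) * (c.y - c.b 1) +
        c.z * (c.b 0 * c.b 1 / c.b 4 - c.b 0 * c.b 1 / c.b 7) / (1 - m)) /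
          (m * c.y * (ξ - c.b 3))) *
      ((ζ - (c.y - c.b 0) * (c.y - c.b 1) +
        c.z * (c.b 0 * c.b 1 / c.b 5 - c.b 0 * c.b 1 / c.b 7) / (1 - m)) /
          (m * c.y * (ξ - c.b 2))) := by
  have h7 := hc.hb 7
  have hq := qOf_ne_zero hc
  have d2 : 1 / c.b 7 * c.y * c.z * (c.b 2 - c.y) + ζ = m * c.y * (ξ - c.b 3) := by
    have : 1 / c.b 7 * c.y * c.z = m * c.y := by rw [hm]; ring
    rw [this]
    linear_combination -hξ
  have d3 : 1 / c.b 7 * c.y * c.z * (c.b 3 - c.y) + ζ = m * c.y * (ξ - c.b 2) := by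
    have : 1 / c.b 7 * c.y * c.z = m * c.y := by rw [hm]; ring
    rw [this]
    linear_combination -hξ
  have hκm : 1 / c.b 7 * c.z = m := by rw [hm]; ring
  have t : ∀ x, qOf c * (c.b 0 * c.b 1 / (qOf c * x)) = c.b 0 * c.b 1 / x := fun x => by
    rw [← mul_div_assoc, mul_div_mul_left _ _ hq]
  have e : 1 / c.b 7 * c.b 0 * c.b 1 = c.b 0 * c.b 1 / c.b 7 := by ring
  rw [Param.yNext, hζ, ofConfig_κ hc]
  generalize (ofConfig c).zNext 1 c.y c.z = zn
  simp only [ofConfig, mul_one, one_pow]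
  rw [d2, d3, hκm, t, t, e]

theorem Config.components {c : Config} {x0 x1 x2 x3 x4 x5 x6 x7 y z : ℂ}
    (h : c = ⟨![x0, x1, x2, x3, x4, x5, x6, x7], y, z⟩) :
    c.b 0 = x0 ∧ c.b 1 = x1 ∧ c.b 2 = x2 ∧ c.b 3 = x3 ∧ c.b 4 = x4 ∧ c.b 5 = x5 ∧ c.b 6 = x6 ∧
      c.b 7 = x7 ∧ c.y = y ∧ c.z = z := by
  subst h
  exact ⟨rfl, rfl, rfl, rfl, rfl, rfl, rfl, rfl, rfl, rfl⟩

/-- The birational action of the word of the shift, at a point in general position. -/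
theorem actWord_shiftWord {c : Config} (hc : c.Nice) (hg1 : gOf c ≠ 1)
    (hc2 : (actWord [5, 3, 2, 1, 0, 2] c).Nice)
    (hc3 : (actWord [5, 3, 2, 1, 0, 2, 3, 4, 3] c).Nice)
    (hc4 : (actWord [5, 3, 2, 1, 0, 2, 3, 4, 3, 2, 0, 1, 2] c).Nice) :
    actWord shiftWord c = rescale (gOf c) (1 / gOf c) (shiftConfig c) := by
  have a1 := actWord_five_three c
  have a2 : actWord [5, 3, 2, 1, 0, 2] c = actWord [2, 1, 0, 2] (actWord [5, 3] c) :=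
    actWord_append [5, 3] [2, 1, 0, 2] c
  have a3 : actWord [5, 3, 2, 1, 0, 2, 3, 4, 3] c =
      actWord [3, 4, 3] (actWord [5, 3, 2, 1, 0, 2] c) :=
    actWord_append [5, 3, 2, 1, 0, 2] [3, 4, 3] c
  have a4 : actWord [5, 3, 2, 1, 0, 2, 3, 4, 3, 2, 0, 1, 2] c =
      actWord [2, 0, 1, 2] (actWord [5, 3, 2, 1, 0, 2, 3, 4, 3] c) :=
    actWord_append [5, 3, 2, 1, 0, 2, 3, 4, 3] [2, 0, 1, 2] c
  have a5 : actWord shiftWord c =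
      actWord [3] (actWord [5, 3, 2, 1, 0, 2, 3, 4, 3, 2, 0, 1, 2] c) :=
    actWord_append [5, 3, 2, 1, 0, 2, 3, 4, 3, 2, 0, 1, 2] [3] c
  rw [a5]
  rw [actWord_two_one_zero_two] at a2
  rw [actWord_three_four_three (hc2.hb 4) (hc2.hz 4)] at a3
  rw [actWord_two_zero_one_two, actWord_two_one_zero_two] at a4
  generalize actWord [5, 3, 2, 1, 0, 2, 3, 4, 3, 2, 0, 1, 2] c = c4 at *
  generalize actWord [5, 3, 2, 1, 0, 2, 3, 4, 3] c = c3 at *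
  generalize actWord [5, 3, 2, 1, 0, 2] c = c2 at *
  generalize actWord [5, 3] c = c1 at *
  have k0 := hc.hb 0
  have k1 := hc.hb 1
  have k2 := hc.hb 2
  have k3 := hc.hb 3
  have k4 := hc.hb 4
  have k5 := hc.hb 5
  have k6 := hc.hb 6
  have k7 := hc.hb 7
  have hg0 : gOf c ≠ 0 := by
    rw [gOf_eq k6]
    exact div_ne_zero (mul_ne_zero (qOf_ne_zero hc) k7) k6
  have hg : c.b 0 * c.b 1 * (c.b 7 / c.b 4) ^ 2 * c.b 4 = gOf c * (c.b 2 * c.b 3) * c.b 5 := by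
    rw [gOf]
    field_simp
  obtain ⟨b10, b11, b12, b13, b14, b15, b16, b17, y1, z1⟩ :=
    Config.components a1
  obtain ⟨b20, b21, b22, b23, b24, b25, b26, b27, y2, z2⟩ :=
    Config.components a2
  rw [b10, b11, b12, b13, z1] at z2
  have e24 : c2.b 4 = c.b 4 * c.b 7 / (gOf c * c.b 5) := by
    rw [b24, b14, b12, b13, b10, b11, gOf]
    field_simp
  have e25 : c2.b 5 = c.b 4 / gOf c := by
    rw [b25, b15, b12, b13, b10, b11, gOf]
    field_simp
  obtain ⟨b30, b31, b32, b33, b34, b35, b36, b37, y3, z3⟩ :=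
    Config.components a3
  have e30 : c3.b 0 = gOf c * c.b 3 := by
    rw [b30, b20, b26, b16, e25, b13]
    field_simp
  have e31 : c3.b 1 = gOf c * c.b 2 := by
    rw [b31, b21, b26, b16, e25, b12]
    field_simp
  have e32 := b32.trans (b22.trans b11)
  have e33 := b33.trans (b23.trans b10)
  rw [y2, b26, b16, e25] at y3
  obtain ⟨b40, b41, b42, b43, b44, b45, b46, b47, y4, z4⟩ :=
    Config.components a4
  have e40 := b40.trans e33
  have e41 := b41.trans e32
  have e42 := b42.trans e31
  have e43 := b43.trans e30
  have e44 : c4.b 4 = c.b 7 / gOf c ^ 2 := by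
    rw [b44, b34, e24, e32, e33, e30, e31, gOf]
    field_simp
  have e45 : c4.b 5 = c.b 5 / gOf c := by
    rw [b45, b35, b26, b16, e32, e33, e30, e31, gOf]
    field_simp
  have e46 := b46.trans (b36.trans e25)
  have e47 := b47.trans (b37.trans (b27.trans b17))
  rw [e30, e31, e32, e33, z3] at z4
  have n10 := hc2.hy 3
  have n11 := hc2.hy 2
  have n15 := hc2.hz 5
  have n30 := hc3.hy 0
  have n31 := hc3.hy 1
  have n44 := hc4.hz 4
  rw [y2, b23, b10] at n10
  rw [y2, b22, b11] at n11
  rw [e25] at n15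
  rw [e30] at n30
  rw [e31] at n31
  rw [e44] at n44
  clear a1 a2 a3 a4 a5 hc2 hc3 hc4
  have hy0 := hc.hy0
  have hz0 := hc.hz0
  have w4 := hc.hz 4
  have w7 := hc.hz 7
  have hζ := ofConfig_ζ hc hg1
  obtain ⟨ζ, hζe⟩ : ∃ ζ, (ofConfig c).ζ 1 c.y c.z = ζ := ⟨_, rfl⟩
  obtain ⟨m, hm⟩ : ∃ m, m = c.z / c.b 7 := ⟨_, rfl⟩
  obtain ⟨k, hk⟩ : ∃ k, k = c.b 7 / c.b 4 := ⟨_, rfl⟩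
  have hm0 : m ≠ 0 := hm ▸ div_ne_zero hz0 k7
  have hk0 : k ≠ 0 := hk ▸ div_ne_zero k7 k4
  have hkr : k * c.b 4 = c.b 7 := by rw [hk]; field_simp
  have hmz : m * c.b 7 = c.z := by rw [hm]; field_simp
  -- The same auxiliary quantities as in the determinant computation, now defined from `ζ`; without
  -- the factors `y` and `m`, all denominators of the formulas are differences with `ξ`.
  obtain ⟨η, hη⟩ : ∃ η, η * c.y = ζ - c.y ^ 2 + (c.b 0 + c.b 1) * c.y :=
    ⟨_, div_mul_cancel₀ _ hy0⟩
  obtain ⟨ξ, hξ⟩ : ∃ ξ, ξ * (c.y * m) = ζ - m * c.y ^ 2 + (c.b 2 + c.b 3) * (c.y * m) :=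
    ⟨_, div_mul_cancel₀ _ (mul_ne_zero hy0 hm0)⟩
  have hm1 : 1 - m ≠ 0 := by
    intro h
    refine w7 ?_
    linear_combination -hmz - c.b 7 * h
  rw [hζe, ← hm] at hζ
  rw [← hk] at hg n10 n11 e40 e41 z2 z4
  have hT := shift_relation hg hξ (by rw [hkr]; exact hζ)
  have hN := shift_numerator k4 hk0 hg hη hξ hT
  have hD := shift_denominator (r := c.b 4) (k := k) hy0 hη hξ
  obtain ⟨p0, p1, hz1, hK, hy3⟩ := shift_y_intermediate (y1 := c1.y) (z1 := c2.z)
    (Y := c.y * (m * (k * c.b 4) - k * c.b 4)) (w := m * (k * c.b 4) - c.b 4)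
    k4 hk0 hm0 hg0 (by rw [hkr, hmz]; exact w4) rfl rfl hg hT
    (by rw [y1, hkr, hmz, mul_div_assoc]) n10 n11 (by rw [z2, hkr, hmz]) n15
  rw [← y3] at hy3
  obtain ⟨x2, x3, hz2⟩ := shift_z_final hk0 hm0 hg0 hN hD p0 p1 hz1 hK hy3 n31 n30
  rw [← z4] at hz2
  have hzN := ofConfig_zNext hc hζe hm hη hξ hg0 x2 x3
  have hyN := ofConfig_yNext hc hζe hm hξ
  have hz2' := hz2
  rw [hkr, hmz] at hz2'
  rw [← hz2'] at hzN
  rw [hzN] at hyN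
  rw [← hkr] at n44
  have hy4 := shift_y_final k4 hk0 hm0 hm1 k5 hg0 (by rw [hkr, hmz]; exact w4) hy0 rfl rfl hg hη
    hN hD hK x2 x3 rfl rfl hz2 n44
  rw [← hy3, hkr, hmz, ← hyN] at hy4
  refine Config.ext (funext fun i => ?_) ?_ ?_
  · obtain ⟨f0, f1, f2, f3, f4, f5, f6, f7, -, -⟩ := Config.components (c := act 3 c4) rfl
    obtain ⟨g0, g1, g2, g3, g4, g5, g6, g7, -, -⟩ :=
      Config.components (c := rescale (gOf c) (1 / gOf c) (shiftConfig c)) rfl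
    obtain ⟨d0, d1, d2, d3, d4, d5, d6, d7, -, -⟩ := Config.components (c := shiftConfig c) rfl
    rw [d0] at g0
    rw [d1] at g1
    rw [d2] at g2
    rw [d3] at g3
    rw [d4] at g4
    rw [d5] at g5
    rw [d6] at g6
    rw [d7] at g7
    have hgq : gOf c * c.b 6 = qOf c * c.b 7 := by
      rw [gOf_eq k6]
      field_simp
    have hq0 := qOf_ne_zero hc
    have hr : c4.b 6 / c4.b 4 = gOf c * c.b 4 / c.b 7 := by
      rw [e46, e44]
      field_simp
    change (act 3 c4).b i = _
    fin_cases i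
    · refine f0.trans (Eq.trans ?_ g0.symm)
      rw [hr, e40, ← hkr]
      field_simp
    · refine f1.trans (Eq.trans ?_ g1.symm)
      rw [hr, e41, ← hkr]
      field_simp
    · exact f2.trans (e42.trans g2.symm)
    · exact f3.trans (e43.trans g3.symm)
    · refine f4.trans (Eq.trans ?_ g4.symm)
      rw [e46]
      ring
    · refine f5.trans (Eq.trans ?_ g5.symm)
      rw [e45]
      ring
    · refine f6.trans (Eq.trans ?_ g6.symm)
      rw [e44]
      field_simp
      linear_combination -hgq
    · refine f7.trans (Eq.trans ?_ g7.symm)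
      rw [e47]
      field_simp
      linear_combination hgq
  · change c4.y * ((c4.z - c4.b 6) / (c4.z - c4.b 4)) = gOf c * (ofConfig c).yNext 1 c.y c.z
    rw [e46, e44, y4, hy4]
  · change c4.z = 1 / gOf c * (ofConfig c).zNext 1 c.y c.z
    rw [hzN]
    field_simp

theorem generically_gOf_ne_one : Generically fun c => gOf c ≠ 1 := by
  have h : Generically fun c =>
      c.b 0 * c.b 1 * c.b 7 ^ 2 - c.b 2 * c.b 3 * c.b 4 * c.b 5 ≠ 0 :=
    generically_ne_zero (polyB 0 * polyB 1 * polyB 7 ^ 2 - polyB 2 * polyB 3 * polyB 4 * polyB 5)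
      (fun c => by simp [Config.coords]) samplePoint (by simp [samplePoint]; norm_num)
  refine (generically_nice.and h).mono ?_
  rintro c ⟨hc, h⟩ hg
  refine h ?_
  rw [gOf, div_eq_one_iff_eq (by simp [hc.hb])] at hg
  rw [hg, sub_self]

theorem generically_actWord_shiftWord : Generically fun c =>
    actWord shiftWord c = rescale (gOf c) (1 / gOf c) (shiftConfig c) := by
  have hn : ∀ w, Generically fun c => (actWord w c).Nice := fun w =>
    isDominant_actWord w _ generically_nice
  refine (generically_nice.and (generically_gOf_ne_one.and
    ((hn [5, 3, 2, 1, 0, 2]).and ((hn [5, 3, 2, 1, 0, 2, 3, 4, 3]).and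
      (hn [5, 3, 2, 1, 0, 2, 3, 4, 3, 2, 0, 1, 2]))))).mono ?_
  rintro c ⟨h1, h2, h3, h4, h5⟩
  exact actWord_shiftWord h1 h2 h3 h4 h5

end QP6

end

noncomputable section

namespace QP6

theorem Config.ext_components {c d : Config} (h0 : c.b 0 = d.b 0) (h1 : c.b 1 = d.b 1)
    (h2 : c.b 2 = d.b 2) (h3 : c.b 3 = d.b 3) (h4 : c.b 4 = d.b 4) (h5 : c.b 5 = d.b 5)
    (h6 : c.b 6 = d.b 6) (h7 : c.b 7 = d.b 7) (hy : c.y = d.y) (hz : c.z = d.z) : c = d := by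
  refine Config.ext (funext fun k => ?_) hy hz
  fin_cases k
  · exact h0
  · exact h1
  · exact h2
  · exact h3
  · exact h4
  · exact h5
  · exact h6
  · exact h7

theorem tau_eq (c : Config) : tau c =
    ⟨![qOf c * c.b 0, qOf c * c.b 1, c.b 2, c.b 3, qOf c * c.b 4, qOf c * c.b 5, c.b 6, c.b 7],
      (tau c).y, (tau c).z⟩ :=
  rfl

theorem rescale_eq (l m : ℂ) (c : Config) : rescale l m c =
    ⟨![l * c.b 0, l * c.b 1, l * c.b 2, l * c.b 3, m * c.b 4, m * c.b 5, m * c.b 6, m * c.b 7],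
      l * c.y, m * c.z⟩ :=
  rfl

/-! ### The shift in terms of the parameters -/

namespace Param

variable {D : Param} {t : ℂ}

/-- This is the parameter relation: it makes `q` a function of the eight base points, so that these
can be treated as independent. -/
theorem qOf_config (hD : D.Admissible) (ht : t ≠ 0) (y z : ℂ) : qOf (D.config t y z) = D.q := by
  obtain ⟨hq, h1, h2, h3, h4, hκ₁, hκ₂, hθ₁, hθ₂, hrel⟩ := hD
  obtain ⟨c0, c1, c2, c3, c4, c5, c6, c7, -, -⟩ := Config.components (c := D.config t y z) rfl
  rw [qOf, c0, c1, c2, c3, c4, c5, c6, c7]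
  simp only [a₅, a₆, a₇, a₈] at hrel ⊢
  field_simp at hrel ⊢
  linear_combination -hrel

/-- Time enters only through `a₁ t`, `a₂ t`, `θ₁ t`, `θ₂ t`, so it can be absorbed into the
parameters and set to `1`. -/
theorem ofConfig_config (hD : D.Admissible) (ht : t ≠ 0) (y z : ℂ) :
    ofConfig (D.config t y z) =
      ⟨D.q, D.a₁ * t, D.a₂ * t, D.a₃, D.a₄, D.κ₁, D.κ₂, D.θ₁ * t, D.θ₂ * t⟩ := by
  have hq' := qOf_config hD ht y z
  obtain ⟨hq, h1, h2, h3, h4, hκ₁, hκ₂, hθ₁, hθ₂, hrel⟩ := hD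
  have e1 : 1 / (D.q * D.a₇) = D.κ₁ := by
    rw [a₇]
    field_simp
  have e2 : 1 / D.a₈ = D.κ₂ := by
    rw [a₈]
    field_simp
  have e3 : D.a₁ * t * (D.a₂ * t) / (D.q * (D.a₅ * t / D.q)) = D.θ₁ * t := by
    rw [a₅]
    field_simp
  have e4 : D.a₁ * t * (D.a₂ * t) / (D.q * (D.a₆ * t / D.q)) = D.θ₂ * t := by
    rw [a₆]
    field_simp
  obtain ⟨c0, c1, c2, c3, c4, c5, c6, c7, -, -⟩ := Config.components (c := D.config t y z) rfl
  rw [ofConfig, hq', c0, c1, c2, c3, c4, c5, c6, c7]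
  rw [e1, e2, e3, e4]

theorem ζ_eq_ofConfig (hD : D.Admissible) (ht : t ≠ 0) (y z : ℂ) :
    (ofConfig (D.config t y z)).ζ 1 y z = D.ζ t y z := by
  rw [ofConfig_config hD ht]
  simp only [ζ, mul_one, one_mul, mul_comm t]

theorem zNext_eq_ofConfig (hD : D.Admissible) (ht : t ≠ 0) (y z : ℂ) :
    (ofConfig (D.config t y z)).zNext 1 y z = D.zNext t y z := by
  rw [zNext, ζ_eq_ofConfig hD ht, ofConfig_config hD ht]
  simp only [zNext, mul_one]

theorem yNext_eq_ofConfig (hD : D.Admissible) (ht : t ≠ 0) (y z : ℂ) :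
    (ofConfig (D.config t y z)).yNext 1 y z = D.yNext t y z := by
  rw [yNext, zNext_eq_ofConfig hD ht, ζ_eq_ofConfig hD ht, ofConfig_config hD ht]
  have e : D.κ₂ * (D.a₁ * t) * (D.a₂ * t) = D.κ₂ * D.a₁ * D.a₂ * t ^ 2 := by ring
  simp only [yNext, mul_one, one_pow, e, mul_assoc D.q]

theorem shiftDefined_iff_ofConfig (hD : D.Admissible) (ht : t ≠ 0) (y z : ℂ) :
    (ofConfig (D.config t y z)).ShiftDefined 1 y z ↔ D.ShiftDefined t y z := by
  rw [ShiftDefined, zNext_eq_ofConfig hD ht, ζ_eq_ofConfig hD ht, ofConfig_config hD ht,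
    ShiftDefined]

theorem shiftConfig_config (hD : D.Admissible) (ht : t ≠ 0) (y z : ℂ) :
    shiftConfig (D.config t y z) = D.shift.config t (D.yNext t y z) (D.zNext t y z) := by
  have hq := qOf_config hD ht y z
  have e7 : D.shift.a₇ = D.a₇ / D.q := shift_a₇ D
  have e8 : D.shift.a₈ = D.q * D.a₈ := shift_a₈ D
  obtain ⟨c0, c1, c2, c3, c4, c5, c6, c7, cy, cz⟩ := Config.components (c := D.config t y z) rfl
  obtain ⟨d0, d1, d2, d3, d4, d5, d6, d7, dy, dz⟩ :=
    Config.components (c := D.shift.config t (D.yNext t y z) (D.zNext t y z)) rfl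
  obtain ⟨s0, s1, s2, s3, s4, s5, s6, s7, sy, sz⟩ :=
    Config.components (c := shiftConfig (D.config t y z)) rfl
  rw [cy, cz, yNext_eq_ofConfig hD ht] at sy
  rw [cy, cz, zNext_eq_ofConfig hD ht] at sz
  rw [c6, hq, ← e7] at s6
  rw [c7, hq, ← e8] at s7
  exact Config.ext_components (s0.trans (c0.trans d0.symm)) (s1.trans (c1.trans d1.symm))
    (s2.trans (c2.trans d2.symm)) (s3.trans (c3.trans d3.symm)) (s4.trans (c4.trans d4.symm))
    (s5.trans (c5.trans d5.symm)) (s6.trans d6.symm) (s7.trans d7.symm)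
    (sy.trans dy.symm) (sz.trans dz.symm)

theorem tau_config (hD : D.Admissible) (ht : t ≠ 0) {y z y' z' : ℂ} (hy : y ≠ 0) (hz : z ≠ 0)
    (h : D.Equations t y z y' z') : tau (D.config t y z) = D.config (D.q * t) y' z' := by
  have hq := qOf_config hD ht y z
  obtain ⟨h1, h2⟩ := h
  have hq0 := hD.hq
  obtain ⟨c0, c1, c2, c3, c4, c5, c6, c7, cy, cz⟩ := Config.components (c := D.config t y z) rfl
  obtain ⟨d0, d1, d2, d3, d4, d5, d6, d7, dy, dz⟩ :=
    Config.components (c := D.config (D.q * t) y' z') rfl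
  obtain ⟨s0, s1, s2, s3, s4, s5, s6, s7, -, -⟩ := Config.components (tau_eq (D.config t y z))
  have hz' : (tau (D.config t y z)).z = z' := by
    rw [tau_z, c0, c1, c2, c3, c6, c7, cy, cz, ← div_div, ← h1, mul_div_cancel_right₀ _ hz]
  have e : ∀ x, D.q * (x * t / D.q) = x * (D.q * t) / D.q := fun x => by ring
  rw [hq, c0] at s0
  rw [hq, c1] at s1
  rw [hq, c4, e] at s4
  rw [hq, c5, e] at s5
  refine Config.ext_components (s0.trans ((mul_left_comm _ _ _).trans d0.symm))
    (s1.trans ((mul_left_comm _ _ _).trans d1.symm)) (s2.trans (c2.trans d2.symm))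
    (s3.trans (c3.trans d3.symm)) (s4.trans d4.symm) (s5.trans d5.symm)
    (s6.trans (c6.trans d6.symm)) (s7.trans (c7.trans d7.symm)) ?_ hz'
  rw [tau_y, hz', hq, c2, c3, c4, c5, c6, c7, cy, mul_div_cancel₀ _ hq0, mul_div_cancel₀ _ hq0,
    ← div_div, ← h2, mul_div_cancel_right₀ _ hy, dy]

end Param

/-! ### The shift as a Bäcklund transformation -/

theorem qOf_rescale {l m : ℂ} (hl : l ≠ 0) (hm : m ≠ 0) (c : Config) :
    qOf (rescale l m c) = qOf c := by
  obtain ⟨r0, r1, r2, r3, r4, r5, r6, r7, -, -⟩ := Config.components (rescale_eq l m c)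
  rw [qOf, qOf, r0, r1, r2, r3, r4, r5, r6, r7,
    ← mul_div_mul_left (c.b 0 * c.b 1 * c.b 6 * c.b 7) (c.b 2 * c.b 3 * c.b 4 * c.b 5)
      (mul_ne_zero (pow_ne_zero 2 hl) (pow_ne_zero 2 hm))]
  congr 1 <;> ring

theorem tau_rescale {l m : ℂ} (hl : l ≠ 0) (hm : m ≠ 0) (c : Config) :
    tau (rescale l m c) = rescale l m (tau c) := by
  have hq := qOf_rescale hl hm c
  obtain ⟨r0, r1, r2, r3, r4, r5, r6, r7, ry, rz⟩ := Config.components (rescale_eq l m c)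
  obtain ⟨s0, s1, s2, s3, s4, s5, s6, s7, -, -⟩ := Config.components (tau_eq (rescale l m c))
  obtain ⟨t0, t1, t2, t3, t4, t5, t6, t7, -, -⟩ := Config.components (tau_eq c)
  obtain ⟨u0, u1, u2, u3, u4, u5, u6, u7, uy, uz⟩ := Config.components (rescale_eq l m (tau c))
  have hz : (tau (rescale l m c)).z = m * (tau c).z := by
    rw [tau_z, tau_z, r0, r1, r2, r3, r6, r7, ry, rz, ← mul_div_assoc m,
      ← mul_div_mul_left _ ((c.y - c.b 2) * (c.y - c.b 3) * c.z) (mul_ne_zero (pow_ne_zero 2 hl) hm)]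
    congr 1 <;> ring
  have hy : (tau (rescale l m c)).y = l * (tau c).y := by
    rw [tau_y, tau_y, hz, hq, r2, r3, r4, r5, r6, r7, ry, ← mul_div_assoc l,
      ← mul_div_mul_left _ (((tau c).z - c.b 6) * ((tau c).z - c.b 7) * c.y)
        (mul_ne_zero (pow_ne_zero 2 hm) hl)]
    congr 1 <;> ring
  rw [hq, r0] at s0
  rw [hq, r1] at s1
  rw [hq, r4] at s4
  rw [hq, r5] at s5
  rw [t0] at u0
  rw [t1] at u1
  rw [t4] at u4
  rw [t5] at u5
  rw [t2] at u2
  rw [t3] at u3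
  rw [t6] at u6
  rw [t7] at u7
  exact Config.ext_components (s0.trans ((mul_left_comm _ _ _).trans u0.symm))
    (s1.trans ((mul_left_comm _ _ _).trans u1.symm)) (s2.trans (r2.trans u2.symm))
    (s3.trans (r3.trans u3.symm)) (s4.trans ((mul_left_comm _ _ _).trans u4.symm))
    (s5.trans ((mul_left_comm _ _ _).trans u5.symm)) (s6.trans (r6.trans u6.symm))
    (s7.trans (r7.trans u7.symm)) (hy.trans uy.symm) (hz.trans uz.symm)

theorem rescale_injective {l m : ℂ} (hl : l ≠ 0) (hm : m ≠ 0) :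
    Function.Injective (rescale l m) := by
  intro c d h
  obtain ⟨r0, r1, r2, r3, r4, r5, r6, r7, ry, rz⟩ := Config.components (rescale_eq l m c)
  obtain ⟨s0, s1, s2, s3, s4, s5, s6, s7, sy, sz⟩ := Config.components (rescale_eq l m d)
  rw [h] at r0 r1 r2 r3 r4 r5 r6 r7 ry rz
  exact Config.ext_components (mul_left_cancel₀ hl (r0.symm.trans s0))
    (mul_left_cancel₀ hl (r1.symm.trans s1)) (mul_left_cancel₀ hl (r2.symm.trans s2))
    (mul_left_cancel₀ hl (r3.symm.trans s3)) (mul_left_cancel₀ hm (r4.symm.trans s4))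
    (mul_left_cancel₀ hm (r5.symm.trans s5)) (mul_left_cancel₀ hm (r6.symm.trans s6))
    (mul_left_cancel₀ hm (r7.symm.trans s7)) (mul_left_cancel₀ hl (ry.symm.trans sy))
    (mul_left_cancel₀ hm (rz.symm.trans sz))

end QP6

end

/-! ### Commutation of the shift with the time step, from generic points to all points. -/

noncomputable section

namespace QP6

/-- The word commutes with `tau` and equals the shift followed by a rescaling. The rescaling factor
is unchanged by the time step and rescalings commute with it, so the rescaling can be cancelled by
injectivity. -/
theorem generically_shiftConfig_tau :
    Generically fun c => shiftConfig (tau c) = tau (shiftConfig c) := by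
  have h := generically_actWord_shiftWord
  refine (generically_nice.and (h.and ((isDominant_tau _ h).and
    commutesWithTau_shiftWord))).mono ?_
  rintro c ⟨hc, h1, h2, h3⟩
  have hq := qOf_ne_zero hc
  have hg : gOf c ≠ 0 := by
    rw [gOf_eq (hc.hb 6)]
    exact div_ne_zero (mul_ne_zero hq (hc.hb 7)) (hc.hb 6)
  have hgt : gOf (tau c) = gOf c := by
    obtain ⟨t0, t1, t2, t3, t4, t5, t6, t7, -, -⟩ := Config.components (tau_eq c)
    rw [gOf, gOf, t0, t1, t2, t3, t4, t5, t7,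
      ← mul_div_mul_left (c.b 0 * c.b 1 * c.b 7 ^ 2) (c.b 2 * c.b 3 * c.b 4 * c.b 5)
        (pow_ne_zero 2 hq)]
    congr 1 <;> ring
  rw [h1, h2, hgt, tau_rescale hg (one_div_ne_zero hg)] at h3
  exact (rescale_injective hg (one_div_ne_zero hg) h3).symm

theorem generically_shiftConfig_ne_zero :
    Generically fun c => (shiftConfig c).y ≠ 0 ∧ (shiftConfig c).z ≠ 0 := by
  refine (generically_actWord_shiftWord.and (isDominant_actWord shiftWord _
    generically_nice)).mono ?_
  rintro c ⟨h1, h2⟩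
  rw [h1] at h2
  exact ⟨right_ne_zero_of_mul h2.hy0, right_ne_zero_of_mul h2.hz0⟩

/-! ### Extension of generic identities by continuity -/

instance : TopologicalSpace Config := TopologicalSpace.induced Config.coords inferInstance

theorem continuous_coords : Continuous Config.coords := continuous_induced_dom

theorem Config.continuous_b (k : Fin 8) : Continuous fun c : Config => c.b k :=
  (continuous_apply (Sum.inl k : Fin 8 ⊕ Fin 2)).comp continuous_coords

theorem Config.continuous_y : Continuous Config.y :=
  (continuous_apply (Sum.inr 0 : Fin 8 ⊕ Fin 2)).comp continuous_coords

theorem Config.continuous_z : Continuous Config.z :=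
  (continuous_apply (Sum.inr 1 : Fin 8 ⊕ Fin 2)).comp continuous_coords

theorem Config.continuousAt_of_components {X : Type*} [TopologicalSpace X] {F : X → Config} {a : X}
    (hb : ∀ k, ContinuousAt (fun x => (F x).b k) a) (hy : ContinuousAt (fun x => (F x).y) a)
    (hz : ContinuousAt (fun x => (F x).z) a) : ContinuousAt F a := by
  refine (Topology.IsInducing.mk rfl : Topology.IsInducing Config.coords).continuousAt_iff.2
    (continuousAt_pi.2 fun s => ?_)
  rcases s with k | k
  · exact hb k
  · fin_cases k
    · exact hy
    · exact hz

/-- On the complex line joining `c` to a point where `P ≠ 0`, the restriction of `P` is a non-zero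
polynomial in one variable. Its finitely many roots leave `c` in the closure of the good points. -/
theorem Generically.dense {Q : Config → Prop} (h : Generically Q) : Dense {c | Q c} := by
  obtain ⟨P, hP, h⟩ := h
  intro c
  obtain ⟨d, hd⟩ := exists_eval_ne_zero hP
  let line : ℂ → Config := fun x =>
    ⟨fun k => c.b k + x * (d.b k - c.b k), c.y + x * (d.y - c.y), c.z + x * (d.z - c.z)⟩
  let p : ℂ[X] := MvPolynomial.aeval
    (fun s => Polynomial.C (c.coords s) + X * Polynomial.C (d.coords s - c.coords s)) P
  have hp : ∀ x, p.eval x = MvPolynomial.eval (line x).coords P := by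
    intro x
    have e : (line x).coords = fun s => Polynomial.eval x
        (Polynomial.C (c.coords s) + X * Polynomial.C (d.coords s - c.coords s)) := by
      funext s
      rcases s with k | k
      · simp [line, Config.coords]
      · fin_cases k <;> simp [line, Config.coords]
    rw [e]
    simp only [p, MvPolynomial.aeval_def]
    rw [← Polynomial.coe_evalRingHom, MvPolynomial.eval, MvPolynomial.coe_eval₂Hom,
      MvPolynomial.hom_eval₂]
    congr 1
    ext <;> simp
  have hp0 : p ≠ 0 := by
    intro h0
    have h1 := hp 1
    have e : line 1 = d := by
      refine Config.ext (funext fun k => ?_) ?_ ?_ <;> simp [line]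
    rw [h0, e, Polynomial.eval_zero] at h1
    exact hd h1.symm
  have hdense : Dense (Set.univ \ {x | p.IsRoot x}) :=
    dense_univ.sdiff_finite (Polynomial.finite_setOfPred_isRoot hp0)
  have hline : Continuous line := continuous_iff_continuousAt.2 fun x =>
    Config.continuousAt_of_components
      (fun k => (continuous_const.add (continuous_id.mul continuous_const)).continuousAt)
      (continuous_const.add (continuous_id.mul continuous_const)).continuousAt
      (continuous_const.add (continuous_id.mul continuous_const)).continuousAt
  have h0 : line 0 = c := by
    refine Config.ext (funext fun k => ?_) ?_ ?_ <;> simp [line]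
  rw [← h0]
  refine closure_mono ?_ (image_closure_subset_closure_image hline ⟨0, hdense 0, rfl⟩)
  rintro _ ⟨x, ⟨-, hx⟩, rfl⟩
  refine h _ ?_
  change MvPolynomial.eval (line x).coords P ≠ 0
  rw [← hp]
  exact hx

/-- A generic identity holds at all points where both sides are continuous. -/
theorem Generically.eq_of_continuousAt {f g : Config → ℂ} (h : Generically fun c => f c = g c)
    {c : Config} (hf : ContinuousAt f c) (hg : ContinuousAt g c) : f c = g c := by
  have hc := mem_closure_iff_nhdsWithin_neBot.1 (h.dense c)
  have h1 : Filter.Tendsto f (nhdsWithin c {c | f c = g c}) (nhds (f c)) :=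
    hf.mono_left nhdsWithin_le_nhds
  have h2 : Filter.Tendsto g (nhdsWithin c {c | f c = g c}) (nhds (g c)) :=
    hg.mono_left nhdsWithin_le_nhds
  refine tendsto_nhds_unique (h1.congr' ?_) h2
  exact eventually_mem_nhdsWithin

theorem continuousAt_qOf {c : Config} (hb : ∀ k, c.b k ≠ 0) : ContinuousAt qOf c := by
  have h : ∀ k, ContinuousAt (fun c : Config => c.b k) c := fun k =>
    (Config.continuous_b k).continuousAt
  exact ((((h 0).mul (h 1)).mul (h 6)).mul (h 7)).div ((((h 2).mul (h 3)).mul (h 4)).mul (h 5))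
    (by simp [hb])

theorem continuousAt_tau {c : Config} (hb : ∀ k, c.b k ≠ 0) (hy : c.y ≠ 0) (hz : c.z ≠ 0)
    (y2 : c.y ≠ c.b 2) (y3 : c.y ≠ c.b 3) (z6 : (tau c).z ≠ c.b 6) (z7 : (tau c).z ≠ c.b 7) :
    ContinuousAt tau c := by
  have h : ∀ k, ContinuousAt (fun c : Config => c.b k) c := fun k =>
    (Config.continuous_b k).continuousAt
  have h_y := Config.continuous_y.continuousAt (x := c)
  have h_z := Config.continuous_z.continuousAt (x := c)
  have hq := continuousAt_qOf hb
  have htz : ContinuousAt (fun c => (tau c).z) c :=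
    ((((h 6).mul (h 7)).mul (h_y.sub (h 0))).mul (h_y.sub (h 1))).div
      (((h_y.sub (h 2)).mul (h_y.sub (h 3))).mul h_z)
      (mul_ne_zero (mul_ne_zero (sub_ne_zero.2 y2) (sub_ne_zero.2 y3)) hz)
  refine Config.continuousAt_of_components (fun k => ?_) ?_ htz
  · fin_cases k
    · exact hq.mul (h 0)
    · exact hq.mul (h 1)
    · exact h 2
    · exact h 3
    · exact hq.mul (h 4)
    · exact hq.mul (h 5)
    · exact h 6
    · exact h 7
  · exact ((((h 2).mul (h 3)).mul (htz.sub (hq.mul (h 4)))).mul (htz.sub (hq.mul (h 5)))).div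
      (((htz.sub (h 6)).mul (htz.sub (h 7))).mul h_y)
      (mul_ne_zero (mul_ne_zero (sub_ne_zero.2 z6) (sub_ne_zero.2 z7)) hy)

theorem continuousAt_shiftConfig {c : Config} (hb : ∀ k, c.b k ≠ 0)
    (hs : (ofConfig c).ShiftDefined 1 c.y c.z) : ContinuousAt shiftConfig c := by
  obtain ⟨n1, n2, n3, n4, n5⟩ := hs
  have h : ∀ k, ContinuousAt (fun c : Config => c.b k) c := fun k =>
    (Config.continuous_b k).continuousAt
  have h_y := Config.continuous_y.continuousAt (x := c)
  have h_z := Config.continuous_z.continuousAt (x := c)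
  have hq0 : qOf c ≠ 0 := by simp [qOf, hb]
  have hq := continuousAt_qOf hb
  have c1 : ContinuousAt (fun c => (ofConfig c).κ₁) c :=
    continuousAt_const.div (hq.mul (h 6)) (mul_ne_zero hq0 (hb 6))
  have c2 : ContinuousAt (fun c => (ofConfig c).κ₂) c := continuousAt_const.div (h 7) (hb 7)
  have t1 : ContinuousAt (fun c => (ofConfig c).θ₁) c :=
    ((h 0).mul (h 1)).div (hq.mul (h 4)) (mul_ne_zero hq0 (hb 4))
  have t2 : ContinuousAt (fun c => (ofConfig c).θ₂) c :=
    ((h 0).mul (h 1)).div (hq.mul (h 5)) (mul_ne_zero hq0 (hb 5))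
  have d1 : (ofConfig c).κ₁ * c.b 2 * c.b 3 ≠ 0 :=
    mul_ne_zero (mul_ne_zero (one_div_ne_zero (mul_ne_zero hq0 (hb 6))) (hb 2)) (hb 3)
  have hκ0 : qOf c ^ 2 * (ofConfig c).κ₁ ≠ 0 :=
    mul_ne_zero (pow_ne_zero 2 hq0) (one_div_ne_zero (mul_ne_zero hq0 (hb 6)))
  have hκz : ContinuousAt (fun c => 1 - (ofConfig c).κ₂ * c.z) c :=
    continuousAt_const.sub (c2.mul h_z)
  have hκz0 : 1 - (ofConfig c).κ₂ * c.z ≠ 0 := sub_ne_zero.2 n2.symm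
  have s1 : ∀ k, ContinuousAt (fun c : Config => c.b k * 1) c := fun k =>
    (h k).mul continuousAt_const
  have hqκ := ((hq.mul c1).mul (h 2)).mul (h 3)
  have hζ : ContinuousAt (fun c => (ofConfig c).ζ 1 c.y c.z) c :=
    ((((c2.mul (h_y.sub (s1 0))).mul (h_y.sub (s1 1))).sub
      ((((((hq.pow 2).mul c1).mul c2).mul (h_y.sub (h 2))).mul (h_y.sub (h 3))).mul h_z)).add
      (((c2.mul h_z).div hκz hκz0).mul ((((continuousAt_const.mul t1).sub hqκ).mul
        ((continuousAt_const.mul t2).sub hqκ)).div ((c1.mul (h 2)).mul (h 3)) d1))).div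
      (c2.sub ((hq.pow 2).mul c1)) (sub_ne_zero.2 n1)
  have D2 : ContinuousAt (fun c => (ofConfig c).κ₂ * c.y * c.z * (c.b 2 - c.y)
      + (ofConfig c).ζ 1 c.y c.z) c := (((c2.mul h_y).mul h_z).mul ((h 2).sub h_y)).add hζ
  have D3 : ContinuousAt (fun c => (ofConfig c).κ₂ * c.y * c.z * (c.b 3 - c.y)
      + (ofConfig c).ζ 1 c.y c.z) c := (((c2.mul h_y).mul h_z).mul ((h 3).sub h_y)).add hζ
  have hz : ContinuousAt (fun c => (ofConfig c).zNext 1 c.y c.z) c :=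
    (((c2.mul h_z).mul ((h_y.mul ((s1 0).sub h_y)).add hζ)).mul
      ((h_y.mul ((s1 1).sub h_y)).add hζ)).div ((((hq.pow 2).mul c1).mul D2).mul D3)
      (mul_ne_zero (mul_ne_zero hκ0 n3) n4)
  have hP := (hζ.sub ((h_y.sub (s1 0)).mul (h_y.sub (s1 1))))
  have hs := ((c2.mul (h 0)).mul (h 1)).mul
    (continuousAt_const (x := c) (y := (1 : ℂ) ^ 2))
  have hy : ContinuousAt (fun c => (ofConfig c).yNext 1 c.y c.z) c :=
    ((((c2.mul h_y).mul hκz).div (((hq.pow 2).mul c1).mul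
      (continuousAt_const.sub (((hq.pow 2).mul c1).mul hz)))
      (mul_ne_zero hκ0 (sub_ne_zero.2 n5.symm))).mul
      ((hP.add ((h_z.mul (((hq.mul t1).mul continuousAt_const).sub hs)).div hκz hκz0)).div
        D2 n3)).mul
      ((hP.add ((h_z.mul (((hq.mul t2).mul continuousAt_const).sub hs)).div hκz hκz0)).div
        D3 n4)
  refine Config.continuousAt_of_components (fun k => ?_) hy hz
  fin_cases k
  · exact h 0
  · exact h 1
  · exact h 2
  · exact h 3
  · exact h 4
  · exact h 5
  · exact (h 6).div hq hq0
  · exact hq.mul (h 7)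

/-- The shift commutes with the time evolution wherever all denominators are non-zero. -/
theorem shiftConfig_tau {c : Config} (hb : ∀ k, c.b k ≠ 0) (hbt : ∀ k, (tau c).b k ≠ 0)
    (hy : c.y ≠ 0) (hz : c.z ≠ 0)
    (y2 : c.y ≠ c.b 2) (y3 : c.y ≠ c.b 3) (z6 : (tau c).z ≠ c.b 6) (z7 : (tau c).z ≠ c.b 7)
    (hs : (ofConfig c).ShiftDefined 1 c.y c.z)
    (hst : (ofConfig (tau c)).ShiftDefined 1 (tau c).y (tau c).z)
    (Y2 : (shiftConfig c).y ≠ c.b 2) (Y3 : (shiftConfig c).y ≠ c.b 3)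
    (Z6 : (shiftConfig (tau c)).z ≠ c.b 6 / qOf c)
    (Z7 : (shiftConfig (tau c)).z ≠ qOf c * c.b 7) :
    (shiftConfig (tau c)).z * (shiftConfig c).z =
      c.b 6 / qOf c * (qOf c * c.b 7) * ((shiftConfig c).y - c.b 0) *
        ((shiftConfig c).y - c.b 1) /
        (((shiftConfig c).y - c.b 2) * ((shiftConfig c).y - c.b 3)) ∧
    (shiftConfig (tau c)).y * (shiftConfig c).y =
      c.b 2 * c.b 3 * ((shiftConfig (tau c)).z - qOf c * c.b 4) *
        ((shiftConfig (tau c)).z - qOf c * c.b 5) /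
        (((shiftConfig (tau c)).z - c.b 6 / qOf c) *
          ((shiftConfig (tau c)).z - qOf c * c.b 7)) := by
  have h : ∀ k, ContinuousAt (fun c : Config => c.b k) c := fun k =>
    (Config.continuous_b k).continuousAt
  have hq0 : qOf c ≠ 0 := by simp [qOf, hb]
  have hq := continuousAt_qOf hb
  have h1 := continuousAt_shiftConfig hb hs
  have h2 : ContinuousAt (fun c => shiftConfig (tau c)) c :=
    ContinuousAt.comp (f := tau) (continuousAt_shiftConfig hbt hst)
      (continuousAt_tau hb hy hz y2 y3 z6 z7)
  have h1y : ContinuousAt (fun c => (shiftConfig c).y) c :=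
    ContinuousAt.comp (f := shiftConfig) Config.continuous_y.continuousAt h1
  have h1z : ContinuousAt (fun c => (shiftConfig c).z) c :=
    ContinuousAt.comp (f := shiftConfig) Config.continuous_z.continuousAt h1
  have h2y : ContinuousAt (fun c => (shiftConfig (tau c)).y) c :=
    ContinuousAt.comp (f := fun c => shiftConfig (tau c)) Config.continuous_y.continuousAt h2
  have h2z : ContinuousAt (fun c => (shiftConfig (tau c)).z) c :=
    ContinuousAt.comp (f := fun c => shiftConfig (tau c)) Config.continuous_z.continuousAt h2
  have hqS : ∀ {c : Config}, c.Nice → qOf (shiftConfig c) = qOf c := by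
    intro c hc
    obtain ⟨s0, s1, s2, s3, s4, s5, s6, s7, -, -⟩ := Config.components (c := shiftConfig c) rfl
    have hq0 := qOf_ne_zero hc
    rw [qOf, s0, s1, s2, s3, s4, s5, s6, s7]
    conv_rhs => rw [qOf]
    congr 1
    field_simp
  constructor
  · refine Generically.eq_of_continuousAt
      (f := fun c => (shiftConfig (tau c)).z * (shiftConfig c).z)
      (g := fun c => c.b 6 / qOf c * (qOf c * c.b 7) * ((shiftConfig c).y - c.b 0) *
        ((shiftConfig c).y - c.b 1) /
        (((shiftConfig c).y - c.b 2) * ((shiftConfig c).y - c.b 3))) ?_ (h2z.mul h1z) ?_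
    -- Generically, the first component of `tau` is the first equation divided by the shifted `z`;
    -- since that coordinate is generically non-zero, the division can be undone.
    · refine (generically_nice.and (generically_shiftConfig_tau.and
        generically_shiftConfig_ne_zero)).mono ?_
      rintro c ⟨hc, hτ, -, hZ⟩
      obtain ⟨s0, s1, s2, s3, s4, s5, s6, s7, -, -⟩ := Config.components (c := shiftConfig c) rfl
      have e := tau_z (shiftConfig c)
      rw [← hτ, s0, s1, s2, s3, s6, s7, ← div_div] at e
      rw [e, div_mul_cancel₀ _ hZ]
    · exact (((((h 6).div hq hq0).mul (hq.mul (h 7))).mul (h1y.sub (h 0))).mul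
        (h1y.sub (h 1))).div ((h1y.sub (h 2)).mul (h1y.sub (h 3)))
        (mul_ne_zero (sub_ne_zero.2 Y2) (sub_ne_zero.2 Y3))
  · refine Generically.eq_of_continuousAt
      (f := fun c => (shiftConfig (tau c)).y * (shiftConfig c).y)
      (g := fun c => c.b 2 * c.b 3 * ((shiftConfig (tau c)).z - qOf c * c.b 4) *
        ((shiftConfig (tau c)).z - qOf c * c.b 5) /
        (((shiftConfig (tau c)).z - c.b 6 / qOf c) *
          ((shiftConfig (tau c)).z - qOf c * c.b 7))) ?_ (h2y.mul h1y) ?_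
    · refine (generically_nice.and (generically_shiftConfig_tau.and
        generically_shiftConfig_ne_zero)).mono ?_
      rintro c ⟨hc, hτ, hY, -⟩
      obtain ⟨s0, s1, s2, s3, s4, s5, s6, s7, -, -⟩ := Config.components (c := shiftConfig c) rfl
      have e := tau_y (shiftConfig c)
      rw [← hτ, s2, s3, s4, s5, s6, s7, hqS hc, ← div_div] at e
      rw [e, div_mul_cancel₀ _ hY]
    · exact ((((h 2).mul (h 3)).mul (h2z.sub (hq.mul (h 4)))).mul (h2z.sub (hq.mul (h 5)))).div
        ((h2z.sub ((h 6).div hq hq0)).mul (h2z.sub (hq.mul (h 7))))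
        (mul_ne_zero (sub_ne_zero.2 Z6) (sub_ne_zero.2 Z7))

theorem Param.config_b_ne_zero {D : Param} (hD : D.Admissible) {t : ℂ} (ht : t ≠ 0) (y z : ℂ)
    (k : Fin 8) : (D.config t y z).b k ≠ 0 := by
  obtain ⟨c0, c1, c2, c3, c4, c5, c6, c7, -, -⟩ := Config.components (c := D.config t y z) rfl
  obtain ⟨hq, h1, h2, h3, h4, hκ₁, hκ₂, hθ₁, hθ₂, hrel⟩ := hD
  fin_cases k
  · exact c0 ▸ mul_ne_zero h1 ht
  · exact c1 ▸ mul_ne_zero h2 ht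
  · exact c2 ▸ h3
  · exact c3 ▸ h4
  · exact c4 ▸ div_ne_zero (mul_ne_zero (div_ne_zero (mul_ne_zero h1 h2) hθ₁) ht) hq
  · exact c5 ▸ div_ne_zero (mul_ne_zero (div_ne_zero (mul_ne_zero h1 h2) hθ₂) ht) hq
  · exact c6 ▸ one_div_ne_zero (mul_ne_zero hq hκ₁)
  · exact c7 ▸ one_div_ne_zero hκ₂

/-- The shift is a Bäcklund transformation of q-P_VI. -/
theorem Param.Admissible.isSolution_shift {D : Param} (hD : D.Admissible) {T : Set ℂ}
    {y z : ℂ → ℂ} (hT : ∀ t ∈ T, t ≠ 0 ∧ D.q * t ∈ T)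
    (h0 : ∀ t ∈ T, y t ≠ 0 ∧ z t ≠ 0 ∧ D.Defined (y t) (z (D.q * t)))
    (hsol : D.IsSolution T y z) (hs : ∀ t ∈ T, D.ShiftDefined t (y t) (z t))
    (hs' : ∀ t ∈ T, D.shift.Defined (D.yNext t (y t) (z t))
      (D.zNext (D.q * t) (y (D.q * t)) (z (D.q * t)))) :
    D.shift.IsSolution T (fun t => D.yNext t (y t) (z t)) (fun t => D.zNext t (y t) (z t)) := by
  intro t ht
  obtain ⟨t0, hqt⟩ := hT t ht
  obtain ⟨hy, hz, hd⟩ := h0 t ht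
  have hqt0 := (hT _ hqt).1
  have hq := Param.qOf_config hD t0 (y t) (z t)
  have hτ := Param.tau_config hD t0 hy hz (hsol t ht)
  obtain ⟨c0, c1, c2, c3, c4, c5, c6, c7, cy, cz⟩ :=
    Config.components (c := D.config t (y t) (z t)) rfl
  have hS := Param.shiftConfig_config hD t0 (y t) (z t)
  have hSt := Param.shiftConfig_config hD hqt0 (y (D.q * t)) (z (D.q * t))
  obtain ⟨y2, y3, z6, z7⟩ := hd
  obtain ⟨Y2, Y3, Z6, Z7⟩ := hs' t ht
  have hSy : (shiftConfig (D.config t (y t) (z t))).y = D.yNext t (y t) (z t) := by rw [hS]; rfl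
  have hSz : (shiftConfig (D.config t (y t) (z t))).z = D.zNext t (y t) (z t) := by rw [hS]; rfl
  have hSty : (shiftConfig (D.config (D.q * t) (y (D.q * t)) (z (D.q * t)))).y =
      D.yNext (D.q * t) (y (D.q * t)) (z (D.q * t)) := by rw [hSt]; rfl
  have hStz : (shiftConfig (D.config (D.q * t) (y (D.q * t)) (z (D.q * t)))).z =
      D.zNext (D.q * t) (y (D.q * t)) (z (D.q * t)) := by rw [hSt]; rfl
  have key := shiftConfig_tau (c := D.config t (y t) (z t))
    (Param.config_b_ne_zero hD t0 _ _)
    (by rw [hτ]; exact Param.config_b_ne_zero hD hqt0 _ _) hy hz (by rw [cy, c2]; exact y2)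
    (by rw [cy, c3]; exact y3) (by rw [hτ, c6]; exact z6) (by rw [hτ, c7]; exact z7)
    ((Param.shiftDefined_iff_ofConfig hD t0 _ _).2 (hs t ht))
    (by rw [hτ]; exact (Param.shiftDefined_iff_ofConfig hD hqt0 _ _).2 (hs _ hqt))
    (by rw [hSy, c2]; exact Y2) (by rw [hSy, c3]; exact Y3)
    (by rw [hτ, hStz, c6, hq, ← Param.shift_a₇]; exact Z6)
    (by rw [hτ, hStz, c7, hq, ← Param.shift_a₈]; exact Z7)
  rw [hτ, hSy, hSz, hSty, hStz, c0, c1, c2, c3, c4, c5, c6, c7, hq, ← Param.shift_a₇,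
    ← Param.shift_a₈, mul_div_cancel₀ _ hD.hq, mul_div_cancel₀ _ hD.hq] at key
  exact key

end QP6

end

noncomputable section

namespace QP6

/-! ### The translation -/

theorem simpleCoroot_apply (i : Fin 6) (α : RootLattice) :
    simpleCoroot i α = α 0 * cartan 0 i + α 1 * cartan 1 i + α 2 * cartan 2 i + α 3 * cartan 3 i
      + α 4 * cartan 4 i + α 5 * cartan 5 i := by
  simp [simpleCoroot, Fintype.linearCombination_apply, Fin.sum_univ_six]

theorem simpleReflection_apply (i : Fin 6) (α : RootLattice) :
    simpleReflection i α = α - simpleCoroot i α • simpleRoot i :=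
  Module.reflection_apply _ _

theorem simpleReflection_vec (a b c d e f : ℤ) :
    simpleReflection 0 ![a, b, c, d, e, f] = ![c - a, b, c, d, e, f] ∧
    simpleReflection 1 ![a, b, c, d, e, f] = ![a, c - b, c, d, e, f] ∧
    simpleReflection 2 ![a, b, c, d, e, f] = ![a, b, a + b + d - c, d, e, f] ∧
    simpleReflection 3 ![a, b, c, d, e, f] = ![a, b, c, c + e + f - d, e, f] ∧
    simpleReflection 4 ![a, b, c, d, e, f] = ![a, b, c, d, d - e, f] ∧
    simpleReflection 5 ![a, b, c, d, e, f] = ![a, b, c, d, e, d - f] := by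
  refine ⟨?_, ?_, ?_, ?_, ?_, ?_⟩ <;>
  · rw [simpleReflection_apply, simpleCoroot_apply]
    funext k
    fin_cases k <;> simp [cartan, simpleRoot] <;> ring

theorem shiftWord_prod_mem :
    (shiftWord.map simpleReflection).prod ∈ extendedAffineWeylGroup := by
  refine Subgroup.list_prod_mem _ fun g hg => ?_
  obtain ⟨i, -, rfl⟩ := List.mem_map.1 hg
  exact Subgroup.subset_closure (Or.inl ⟨i, rfl⟩)

/-- A direct linear computation in six integer unknowns: the word adds the null root with
multiplicity `d ↦ 2f - d` formed from the coefficients `d`, `f` of `α₃`, `α₅`. -/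
theorem shiftWord_prod_apply (α : RootLattice) :
    (shiftWord.map simpleReflection).prod α = α + simpleCoroot 5 α • nullRoot := by
  have hα : α = ![α 0, α 1, α 2, α 3, α 4, α 5] := by
    funext k
    fin_cases k <;> rfl
  rw [simpleCoroot_apply]
  generalize α 0 = a at *
  generalize α 1 = b at *
  generalize α 2 = c at *
  generalize α 3 = d at *
  generalize α 4 = e at *
  generalize α 5 = f at *
  subst hα
  have r0 := fun a b c d e f => (simpleReflection_vec a b c d e f).1
  have r1 := fun a b c d e f => (simpleReflection_vec a b c d e f).2.1
  have r2 := fun a b c d e f => (simpleReflection_vec a b c d e f).2.2.1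
  have r3 := fun a b c d e f => (simpleReflection_vec a b c d e f).2.2.2.1
  have r4 := fun a b c d e f => (simpleReflection_vec a b c d e f).2.2.2.2.1
  have r5 := fun a b c d e f => (simpleReflection_vec a b c d e f).2.2.2.2.2
  simp only [List.map_cons, List.map_nil, List.prod_cons, List.prod_nil, mul_one,
    LinearEquiv.mul_apply, r0, r1, r2, r3, r4, r5]
  funext k
  fin_cases k <;> simp [cartan, nullRoot] <;> ring

end QP6

end

theorem mainTheorem4 :
    -- the shift `n → n + 1` of the orthogonal polynomial system
    (∀ (J : QOrth.WeightData) (p : ℕ → ℂ[X]), J.Admissible → J.IsOrthonormal p →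
      ∃ θ₁ θ₂ : ℂ,
        (∀ n : ℕ, ((J.A p n).map (Polynomial.eval 0)).charpoly =
          (X - C (θ₁ * J.t)) * (X - C (θ₂ * J.t))) ∧
        ∀ n : ℕ, (J.param θ₁ θ₂ n).Admissible ∧
          J.param θ₁ θ₂ (n + 1) = (J.param θ₁ θ₂ n).shift ∧
          (J.HasCoordinates p n → J.HasCoordinates p (n + 1) →
            (J.param θ₁ θ₂ n).ShiftDefined J.t (J.y p n) (J.z p n) →
              J.z p (n + 1) = (J.param θ₁ θ₂ n).zNext J.t (J.y p n) (J.z p n) ∧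
              J.y p (n + 1) = (J.param θ₁ θ₂ n).yNext J.t (J.y p n) (J.z p n))) ∧
    -- the action on the parameters
    (∀ D : QP6.Param, D.Admissible → D.shift.Admissible ∧
      D.shift.q = D.q ∧ D.shift.a₁ = D.a₁ ∧ D.shift.a₂ = D.a₂ ∧ D.shift.a₃ = D.a₃ ∧
      D.shift.a₄ = D.a₄ ∧ D.shift.a₅ = D.a₅ ∧ D.shift.a₆ = D.a₆ ∧
      D.shift.a₇ = D.a₇ / D.q ∧ D.shift.a₈ = D.q * D.a₈) ∧
    -- the shift is a Bäcklund transformation of q-P_VI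
    (∀ D : QP6.Param, D.Admissible → ∀ (T : Set ℂ) (y z : ℂ → ℂ),
      (∀ t ∈ T, t ≠ 0 ∧ D.q * t ∈ T) →
      (∀ t ∈ T, y t ≠ 0 ∧ z t ≠ 0 ∧ D.Defined (y t) (z (D.q * t))) →
      D.IsSolution T y z →
      (∀ t ∈ T, D.ShiftDefined t (y t) (z t)) →
      (∀ t ∈ T, D.shift.Defined (D.yNext t (y t) (z t))
        (D.zNext (D.q * t) (y (D.q * t)) (z (D.q * t)))) →
      D.shift.IsSolution T (fun t => D.yNext t (y t) (z t)) (fun t => D.zNext t (y t) (z t))) ∧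
    -- the birational maps `sᵢ` act on the root variables as the simple reflections of type
    -- `D_5^{(1)}` and satisfy the Coxeter relations
    (∀ (i j : Fin 6) (c : QP6.Config), (∀ k, c.b k ≠ 0) →
      QP6.rootVariable j (QP6.act i c) =
        QP6.rootVariable j c * QP6.rootVariable i c ^ (-QP6.cartan j i)) ∧
    (∀ i j : Fin 6, QP6.Generically fun c =>
      (fun c => QP6.act j (QP6.act i c))^[QP6.coxeterExponent i j] c = c) ∧
    -- the shift is a translation in the extended affine Weyl group
    (∃ word : List (Fin 6),
      (word.map QP6.simpleReflection).prod ∈ QP6.extendedAffineWeylGroup ∧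
      (∀ α : QP6.RootLattice, (word.map QP6.simpleReflection).prod α =
        α + QP6.simpleCoroot 5 α • QP6.nullRoot) ∧
      QP6.Generically fun c => ∀ (D : QP6.Param) (t : ℂ), D.Admissible → t ≠ 0 →
        D.config t c.y c.z = c →
          ∃ l m : ℂ, l ≠ 0 ∧ m ≠ 0 ∧
            QP6.actWord word c =
              QP6.rescale l m (D.shift.config t (D.yNext t c.y c.z) (D.zNext t c.y c.z))) := by
  refine ⟨fun J p hJ hp => QOrth.WeightData.orthogonal_polynomial_shift hJ hp, ?_, ?_,
    QP6.rootVariable_act, QP6.coxeter_relation, QP6.shiftWord, QP6.shiftWord_prod_mem, QP6.shiftWord_prod_apply, ?_⟩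
  · exact fun D hD => ⟨hD.shift, rfl, rfl, rfl, rfl, rfl, rfl, rfl, D.shift_a₇, D.shift_a₈⟩
  · exact fun D hD T y z hT h0 hsol hs hs' => hD.isSolution_shift hT h0 hsol hs hs'
  · refine (QP6.generically_nice.and QP6.generically_actWord_shiftWord).mono ?_
    rintro c ⟨hc, h⟩ D t hD ht hDc
    have hg : QP6.gOf c ≠ 0 := by
      rw [QP6.gOf_eq (hc.hb 6)]
      exact div_ne_zero (mul_ne_zero (QP6.qOf_ne_zero hc) (hc.hb 7)) (hc.hb 6)
    -- The scaling factors depend only on the base points, and they leave all six root variables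
    -- unchanged.
    refine ⟨QP6.gOf c, 1 / QP6.gOf c, hg, one_div_ne_zero hg, ?_⟩
    rw [h, ← QP6.Param.shiftConfig_config hD ht, hDc]
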